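/- Let $f:\mathbb R^d\to\mathbb R$ be differentiable and $L$-smooth, i.e. $\|\nabla f(x)-\nabla f(y)\|\le L\|x-y\|$ for all $x,y$ (Euclidean norm, $L\ge 0$), and bounded below, $f(x)\ge f^*$ for all $x$. Let $g(x)=g(x,\zeta)$ be a stochastic gradient oracle, where $\zeta$ is a random sample with law $P$, that is unbiased, $\mathbb E[g(x)]=\nabla f(x)$ for every $x$, and has coordinate-wise affine noise: for every $x$ and $i\in[d]$, almost surely $(g(x)_i-\nabla f(x)_i)^2\le\sigma_{0,i}^2+\sigma_{1,i}^2\,\nabla f(x)_i^2$, where $\boldsymbol\sigma_0,\boldsymbol\sigma_1$ have nonnegative entries. Let $0\le\beta_1<\beta_2<1$, $C_0,\epsilon_0>0$, $T\ge1$, $\eta=C_0\sqrt{1-\beta_2}$, $\epsilon=\epsilon_0\sqrt{1-\beta_2}$. Adam starts from $x_1\in\mathbb R^d$, $m_0=v_0=0$ and, for $s=1,\dots,T$, takes $g_s=g(x_s,\zeta_s)$ with $\zeta_1,\zeta_2,\dots$ independent of law $P$, and sets for every $i\in[d]$ $$m_{s,i}=\beta_1m_{s-1,i}+(1-\beta_1)g_{s,i},\quad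 v_{s,i}=\beta_2v_{s-1,i}+(1-\beta_2)g_{s,i}^2,\quad x_{s+1,i}=x_{s,i}-\frac{\eta_s}{\sqrt{v_{s,i}}+\epsilon_s}m_{s,i},$$ $$\eta_s=\frac{\eta\sqrt{1-\beta_2^s}}{1-\beta_1^s},\qquad \epsilon_s=\epsilon\sqrt{1-\beta_2^s}.$$ The proxy step size is $$a_{s,i}=\sqrt{\beta_2v_{s-1,i}+(1-\beta_2)\bigl(\sigma_{0,i}^2+(1+\sigma_{1,i}^2)\nabla f(x_s)_i^2\bigr)}+\epsilon_s.$$ For $\delta\in(0,1)$ put $r=1-\beta_1/\beta_2$, $\Sigma_{\max}=\max\{1,\sqrt{(1+\beta_2)/\beta_2}-1\}$, $$\mathcal F(T)=1+\frac{2}{\epsilon^2}\Bigl[\bigl(\|\boldsymbol\sigma_0\|_\infty^2+2(1+\|\boldsymbol\sigma_1\|_\infty^2)\|\nabla f(x_1)\|^2\bigr)T+\frac{2(1+\|\boldsymbol\sigma_1\|_\infty^2)\,d\,L^2C_0^2}{r}T^3\Bigr],$$ $\ell=\log(dT/\delta)$, $\Lambda=\log(\mathcal F(T)/\beta_2^T)$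 and $$\begin{aligned}G={}&8L(f(x_1)-f^*)+\frac{256L^2C_0^2\beta_1^2d^2}{(1-\beta_1)^3r}+\frac{4L^2C_0^2\beta_1^2d}{(1-\beta_1)^2r}+\frac{48LC_0\|\boldsymbol\sigma_0\|_\infty}{1-\beta_1}\,d\,\ell\\&+\frac{8LC_0\beta_1^2}{(1-\beta_1)^2r}\Bigl[\frac{4\|\boldsymbol\sigma_0\|_\infty}{\beta_2}+\frac{\epsilon_0+\sqrt2\|\boldsymbol\sigma_0\|_\infty}{\sqrt{\beta_2}}+\frac{LC_0}{2}(1+4\Sigma_{\max}^2)\Bigr]d\,\Lambda\\&+8\Bigl(\frac{3L^2C_0^2}{(1-\beta_1)^2}+\frac{8L\|\boldsymbol\sigma_0\|_\infty C_0}{1-\beta_1}\Bigr)d\,\Lambda+\frac{2304L^2C_0^2\|\boldsymbol\sigma_1\|_\infty^2}{(1-\beta_1)^2}d^2\ell^2\\&+256\Bigl[\frac{16L^2C_0^2\|\boldsymbol\sigma_1\|_\infty^2}{(1-\beta_1)^2}+\frac{9L^2C_0^2\beta_1^4(1+\|\boldsymbol\sigma_1\|_\infty^2)}{\beta_2^2(1-\beta_1)^4r^2}\Bigr]d^2\Lambda^2.\end{aligned}$$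 Then, with probability at least $1-\delta$, $$\|\nabla f(x_{t+1})\|^2\le G-L\sum_{i=1}^d\sum_{s=1}^t\eta_s\,\frac{\nabla f(x_s)_i^2}{a_{s,i}}\quad\text{for all }t\in[T],$$ and consequently, on the same event, $\|\nabla f(x_t)\|^2\le G$ for all $t\in[T+1]$. Moreover, when $\beta_2=1-1/T$ and all parameters other than $T$ are fixed, $G=O(\log^2T)$ as $T\to\infty$, so that the gradients stay of order $O(\mathrm{poly}(\log T))$ along the trajectory. -/

import Mathlib

open MeasureTheory ProbabilityTheory

noncomputable section

namespace Adam

/-- `f : ℝ^d → ℝ` is `L`-smooth: it is differentiable and its gradient is `L`-Lipschitz in the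
Euclidean norm. -/
structure LSmooth {d : ℕ} (f : EuclideanSpace ℝ (Fin d) → ℝ) (L : ℝ) : Prop where
  differentiable : Differentiable ℝ f
  gradient_lipschitz : ∀ x y, ‖gradient f x - gradient f y‖ ≤ L * ‖x - y‖

/-- The hyper-parameters of Adam. -/
structure Params where
  β₁ : ℝ
  β₂ : ℝ
  η : ℝ
  ε : ℝ

/-- The setting `η = C₀ √(1 - β₂)`, `ε = ε₀ √(1 - β₂)`. -/
def params (β₁ β₂ C₀ ε₀ : ℝ) : Params where
  β₁ := β₁
  β₂ := β₂
  η := C₀ * √(1 - β₂)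
  ε := ε₀ * √(1 - β₂)

/-- `η_s = η √(1 - β₂^s) / (1 - β₁^s)`. -/
def stepSize (p : Params) (s : ℕ) : ℝ := p.η * √(1 - p.β₂ ^ s) / (1 - p.β₁ ^ s)

/-- `ε_s = ε √(1 - β₂^s)`. -/
def eps (p : Params) (s : ℕ) : ℝ := p.ε * √(1 - p.β₂ ^ s)

/-- The memory of Adam: the current point and the two moving averages. -/
structure State (d : ℕ) where
  x : EuclideanSpace ℝ (Fin d)
  m : Fin d → ℝ
  v : Fin d → ℝ

/-- First moment update `m_s = β₁ m_{s-1} + (1 - β₁) g_s`. -/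
def nextM {d : ℕ} (p : Params) (S : State d) (g : EuclideanSpace ℝ (Fin d)) (i : Fin d) : ℝ :=
  p.β₁ * S.m i + (1 - p.β₁) * g i

/-- Second moment update `v_s = β₂ v_{s-1} + (1 - β₂) g_s²`. -/
def nextV {d : ℕ} (p : Params) (S : State d) (g : EuclideanSpace ℝ (Fin d)) (i : Fin d) : ℝ :=
  p.β₂ * S.v i + (1 - p.β₂) * g i ^ 2

/-- Iteration number `s` of Adam, with stochastic gradient `g`. -/
def step {d : ℕ} (p : Params) (s : ℕ) (g : EuclideanSpace ℝ (Fin d)) (S : State d) : State d where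
  x := WithLp.toLp 2 fun i =>
    S.x i - stepSize p s / (√(nextV p S g i) + eps p s) * nextM p S g i
  m := nextM p S g
  v := nextV p S g

/-- The memory after `s` iterations, that is `(x_{s+1}, m_s, v_s)`, started from
`(x₁, 0, 0)`. Here `z` is the sequence of samples `z_1, z_2, …` fed to the stochastic gradient
oracle `g`, so that the gradient used in iteration `s` is `g_s = g (x_s, z_s)`. -/
def state {d : ℕ} {Z : Type*} (p : Params)
    (g : EuclideanSpace ℝ (Fin d) → Z → EuclideanSpace ℝ (Fin d))
    (x₁ : EuclideanSpace ℝ (Fin d)) (z : ℕ → Z) : ℕ → State d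
  | 0 => ⟨x₁, 0, 0⟩
  | s + 1 => step p (s + 1) (g (state p g x₁ z s).x (z (s + 1))) (state p g x₁ z s)

/-- The iterate `x_s`, `s ≥ 1`. -/
def iterate {d : ℕ} {Z : Type*} (p : Params)
    (g : EuclideanSpace ℝ (Fin d) → Z → EuclideanSpace ℝ (Fin d))
    (x₁ : EuclideanSpace ℝ (Fin d)) (z : ℕ → Z) (s : ℕ) : EuclideanSpace ℝ (Fin d) :=
  (state p g x₁ z (s - 1)).x

/-- The proxy step size, `s ≥ 1`:
`a_{s,i} = √(β₂ v_{s-1,i} + (1-β₂)(σ_{0,i}² + (1+σ_{1,i}²) (∇f(x_s)_i)²)) + ε_s`. -/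
def proxy {d : ℕ} {Z : Type*} (p : Params) (f : EuclideanSpace ℝ (Fin d) → ℝ)
    (σ₀ σ₁ : Fin d → ℝ)
    (g : EuclideanSpace ℝ (Fin d) → Z → EuclideanSpace ℝ (Fin d))
    (x₁ : EuclideanSpace ℝ (Fin d)) (z : ℕ → Z) (s : ℕ) (i : Fin d) : ℝ :=
  √(p.β₂ * (state p g x₁ z (s - 1)).v i
      + (1 - p.β₂) * (σ₀ i ^ 2
        + (1 + σ₁ i ^ 2) * gradient f (iterate p g x₁ z s) i ^ 2))
    + eps p s

/-- The polynomial `𝓕(T)`; `‖σ₀‖`, `‖σ₁‖` on `Fin d → ℝ` are sup norms, and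
`ε² = ε₀² (1 - β₂)`. -/
def polyF {d : ℕ} (f : EuclideanSpace ℝ (Fin d) → ℝ) (L : ℝ) (σ₀ σ₁ : Fin d → ℝ)
    (x₁ : EuclideanSpace ℝ (Fin d)) (β₁ β₂ C₀ ε₀ : ℝ) (T : ℕ) : ℝ :=
  1 + 2 / (ε₀ * √(1 - β₂)) ^ 2 *
    ((‖σ₀‖ ^ 2 + 2 * (1 + ‖σ₁‖ ^ 2) * ‖gradient f x₁‖ ^ 2) * T
      + 2 * (1 + ‖σ₁‖ ^ 2) * d * L ^ 2 * C₀ ^ 2 / (1 - β₁ / β₂) * T ^ 3)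

/-- `Σ_max = max {1, √((1+β₂)/β₂) - 1}`. -/
def sigmaMax (β₂ : ℝ) : ℝ := max 1 (√((1 + β₂) / β₂) - 1)

/-- The explicit gradient bound `G`; `‖σ₀‖`, `‖σ₁‖` on `Fin d → ℝ` are sup norms. -/
def boundG {d : ℕ} (f : EuclideanSpace ℝ (Fin d) → ℝ) (fstar L : ℝ) (σ₀ σ₁ : Fin d → ℝ)
    (x₁ : EuclideanSpace ℝ (Fin d)) (β₁ β₂ C₀ ε₀ δ : ℝ) (T : ℕ) : ℝ :=
  let r : ℝ := 1 - β₁ / β₂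
  let ℓ : ℝ := Real.log (d * T / δ)
  let Λ : ℝ := Real.log (polyF f L σ₀ σ₁ x₁ β₁ β₂ C₀ ε₀ T / β₂ ^ T)
  8 * L * (f x₁ - fstar)
  + 256 * L ^ 2 * C₀ ^ 2 * β₁ ^ 2 * d ^ 2 / ((1 - β₁) ^ 3 * r)
  + 4 * L ^ 2 * C₀ ^ 2 * β₁ ^ 2 * d / ((1 - β₁) ^ 2 * r)
  + 48 * L * C₀ * ‖σ₀‖ / (1 - β₁) * d * ℓ
  + 8 * L * C₀ * β₁ ^ 2 / ((1 - β₁) ^ 2 * r)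
      * (4 * ‖σ₀‖ / β₂ + (ε₀ + √2 * ‖σ₀‖) / √β₂ + L * C₀ / 2 * (1 + 4 * sigmaMax β₂ ^ 2))
      * d * Λ
  + 8 * (3 * L ^ 2 * C₀ ^ 2 / (1 - β₁) ^ 2 + 8 * L * ‖σ₀‖ * C₀ / (1 - β₁)) * d * Λ
  + 2304 * L ^ 2 * C₀ ^ 2 * ‖σ₁‖ ^ 2 / (1 - β₁) ^ 2 * d ^ 2 * ℓ ^ 2
  + 256 * (16 * L ^ 2 * C₀ ^ 2 * ‖σ₁‖ ^ 2 / (1 - β₁) ^ 2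
      + 9 * L ^ 2 * C₀ ^ 2 * β₁ ^ 4 * (1 + ‖σ₁‖ ^ 2) / (β₂ ^ 2 * (1 - β₁) ^ 4 * r ^ 2))
      * d ^ 2 * Λ ^ 2

end Adam

end

/-! The momentum is removed by following the auxiliary points `aux`, y = x + β₁/(1-β₁)·(last
displacement). Their increments contain only the fresh gradient, divided by the current denominator,
and a term due to the change of step size over denominator (`aux_succ`). The descent lemma is
applied at y with the gradient taken at x (`aux_descent`).

In each coordinate the denominator, which depends on the fresh sample, is exchanged for the proxy,
which depends only on the past (`coordinate_step`). This produces the descent term η h²/a, a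
martingale term linear in the noise, and errors. Young's inequality pays for each error with a
fraction of the descent term and a multiple of (γ/b)² or (m/b)². The sums of these squares telescope
into a logarithm (`Moments.sum_sq_div_le_log`, `Moments.sum_sqAvg_div_le`). That logarithm is at
most Λ because, under the noise bound alone, gradients grow at most linearly in time
(`log_potential_le`).

The remaining errors are proportional to the noise level, hence to 1 and √G as long as earlier
gradients satisfy ‖∇f‖² ≤ G. With ‖∇f(y)‖² ≤ 2L(f(y) - f*) and a return from y to x, the next
squared gradient is bounded by terms free of G plus multiples of √G. `G` is chosen so that Young's
inequality closes this loop (`boundG_absorb`), and strong induction on time gives the pathwise bound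
(`gradient_bound_of_martingale_bound`).

The martingale bound cannot presuppose bounded gradients, so its coefficients are switched off once
‖∇f‖² exceeds G. Hoeffding's lemma then makes the compensated exponential product have mean at most
one (`lintegral_prod_expNoise_le`). Markov's inequality and a union bound over the d·T pairs of a
time and a coordinate cost probability δ. On the good event the induction shows that the switch is
never used.

For β₂ = 1 - 1/T both logarithms in G are O(log T) and their coefficients converge, so G = O(log²
T). -/

namespace Adam

/-! ### Scalar moving averages -/

/-- The two moving averages of a scalar sequence `γ`, started from zero. -/
structure Moments (β₁ β₂ : ℝ) (γ m v : ℕ → ℝ) : Prop where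
  m_zero : m 0 = 0
  v_zero : v 0 = 0
  m_succ : ∀ n, m (n + 1) = β₁ * m n + (1 - β₁) * γ n
  v_succ : ∀ n, v (n + 1) = β₂ * v n + (1 - β₂) * γ n ^ 2

/-- The unnormalised moving average `∑_{j < n} β^{n-1-j} γ_j²`. -/
def sqAvg (β : ℝ) (γ : ℕ → ℝ) : ℕ → ℝ
  | 0 => 0
  | n + 1 => β * sqAvg β γ n + γ n ^ 2

lemma sqAvg_nonneg {β : ℝ} (hβ : 0 ≤ β) (γ : ℕ → ℝ) (n : ℕ) : 0 ≤ sqAvg β γ n := by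
  induction n with
  | zero => simp [sqAvg]
  | succ n ih => simp only [sqAvg]; positivity

section

variable {β₁ β₂ : ℝ} {γ m v : ℕ → ℝ}

lemma Moments.v_nonneg (hM : Moments β₁ β₂ γ m v) (h₂ : 0 ≤ β₂) (h₂' : β₂ < 1) (n : ℕ) :
    0 ≤ v n := by
  induction n with
  | zero => simp [hM.v_zero]
  | succ n ih =>
    rw [hM.v_succ]
    have : 0 < 1 - β₂ := by linarith
    positivity

lemma Moments.v_le (hM : Moments β₁ β₂ γ m v) (h₂ : 0 ≤ β₂) (h₂' : β₂ < 1) {c : ℝ} (hc : 0 ≤ c)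
    (n : ℕ) (hγ : ∀ j < n, γ j ^ 2 ≤ c) : v n ≤ c := by
  induction n with
  | zero => simpa [hM.v_zero]
  | succ n ih =>
    rw [hM.v_succ]
    have h1 := ih fun j hj => hγ j (by omega)
    have h2 := hγ n (by omega)
    nlinarith

lemma Moments.v_le_sum (hM : Moments β₁ β₂ γ m v) (h₂ : 0 ≤ β₂) (h₂' : β₂ < 1) (n : ℕ) :
    v n ≤ (1 - β₂) * ∑ j ∈ Finset.range n, γ j ^ 2 := by
  induction n with
  | zero => simp [hM.v_zero]
  | succ n ih =>
    rw [hM.v_succ, Finset.sum_range_succ]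
    have := hM.v_nonneg h₂ h₂' n
    nlinarith

/-- Cauchy–Schwarz for the weights (1-β₁)β₁^k, whose total mass is 1-β₁^n. That mass is kept because
it later compensates the bias correction in the step size. -/
lemma Moments.m_sq_le (hM : Moments β₁ β₂ γ m v) (h₁ : 0 ≤ β₁) (h₁' : β₁ < 1) (n : ℕ) :
    m n ^ 2 ≤ (1 - β₁) * (1 - β₁ ^ n) * sqAvg β₁ γ n := by
  induction n with
  | zero => simp [hM.m_zero]
  | succ n ih =>
    rw [hM.m_succ, sqAvg]
    set A := 1 - β₁ ^ n with hA
    have hA0 : 0 ≤ A := by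
      have := pow_le_one₀ (n := n) h₁ h₁'.le
      linarith
    have hA' : 1 - β₁ ^ (n + 1) = β₁ * A + (1 - β₁) := by rw [hA]; ring
    rw [hA']
    set q := sqAvg β₁ γ n
    have hq : 0 ≤ q := sqAvg_nonneg h₁ γ n
    have hb : 0 < 1 - β₁ := by linarith
    -- The cross term of the square, by AM-GM and the induction hypothesis.
    have key : 2 * (m n * γ n) ≤ A * γ n ^ 2 + (1 - β₁) * q := by
      have hX : 0 ≤ A * γ n ^ 2 := by positivity
      have hY : 0 ≤ (1 - β₁) * q := by positivity
      apply le_of_sq_le_sq _ (by positivity)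
      have : (m n * γ n) ^ 2 ≤ (A * γ n ^ 2) * ((1 - β₁) * q) := by
        have := mul_le_mul_of_nonneg_right ih (sq_nonneg (γ n))
        nlinarith
      nlinarith [sq_nonneg (A * γ n ^ 2 - (1 - β₁) * q)]
    have h1 : 0 ≤ (1 - β₁) * β₁ * (A * γ n ^ 2 + (1 - β₁) * q - 2 * (m n * γ n)) := by
      apply mul_nonneg (by positivity); linarith
    have h2 : 0 ≤ β₁ ^ 2 * ((1 - β₁) * A * q - m n ^ 2) := by
      apply mul_nonneg (by positivity); linarith
    nlinarith

/-- Since β₁ < β₂, the weights decay faster than those of `v`. The factor r = 1-β₁/β₂ ≤ 1 only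
weakens the estimate and gives it the shape used in `G`. -/
lemma Moments.sqAvg_le (hM : Moments β₁ β₂ γ m v) (h₁ : 0 ≤ β₁) (h₁₂ : β₁ < β₂) (h₂' : β₂ < 1)
    (n : ℕ) : sqAvg β₁ γ n ≤ v n / ((1 - β₂) * (1 - β₁ / β₂)) := by
  have h₂ : 0 < β₂ := by linarith
  have hr : 0 < 1 - β₁ / β₂ := by
    rw [sub_pos, div_lt_one h₂]; exact h₁₂
  have hr1 : 1 - β₁ / β₂ ≤ 1 := by
    have : 0 ≤ β₁ / β₂ := by positivity
    linarith
  have hs : 0 < 1 - β₂ := by linarith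
  induction n with
  | zero => simp [sqAvg, hM.v_zero]
  | succ n ih =>
    rw [hM.v_succ, sqAvg]
    rw [le_div_iff₀ (by positivity)] at ih ⊢
    have hv := hM.v_nonneg h₂.le h₂' n
    have h1 := mul_le_mul_of_nonneg_left ih h₁
    have h2 : (1 - β₂) * γ n ^ 2 * (1 - β₁ / β₂) ≤ (1 - β₂) * γ n ^ 2 :=
      mul_le_of_le_one_right (by positivity) hr1
    nlinarith

lemma Moments.m_sq_le_v (hM : Moments β₁ β₂ γ m v) (h₁ : 0 ≤ β₁) (h₁₂ : β₁ < β₂) (h₂' : β₂ < 1)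
    (n : ℕ) : m n ^ 2 ≤
      (1 - β₁) * (1 - β₁ ^ n) * (v n / ((1 - β₂) * (1 - β₁ / β₂))) := by
  refine (hM.m_sq_le h₁ (by linarith) n).trans ?_
  have : β₁ ^ n ≤ 1 := pow_le_one₀ h₁ (by linarith)
  exact mul_le_mul_of_nonneg_left (hM.sqAvg_le h₁ h₁₂ h₂' n)
    (mul_nonneg (by linarith) (by linarith))

lemma Moments.mul_v_add_le (hM : Moments β₁ β₂ γ m v) (h₂' : β₂ < 1)
    {κ : ℝ} (hκ : 0 < κ) (n : ℕ) : β₂ * (v n + κ) ≤ v (n + 1) + κ := by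
  rw [hM.v_succ]
  nlinarith [mul_nonneg (sub_nonneg.2 h₂'.le) (sq_nonneg (γ n)), mul_pos (sub_pos.2 h₂') hκ]

/-- With B_n = v_n + κ, the recursion gives (1-β₂)γ_n² ≤ B_{n+1} - β₂B_n. Each summand is thus at
most 1 - β₂B_n/B_{n+1} ≤ log(B_{n+1}/(β₂B_n)); these telescope at a cost of -log β₂ per step. -/
lemma Moments.sum_sq_div_le_log (hM : Moments β₁ β₂ γ m v) (h₂ : 0 < β₂) (h₂' : β₂ < 1)
    {κ : ℝ} (hκ : 0 < κ) (n : ℕ) :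
    (1 - β₂) * ∑ j ∈ Finset.range n, γ j ^ 2 / (v (j + 1) + κ)
      ≤ Real.log ((v n + κ) / κ) - n * Real.log β₂ := by
  induction n with
  | zero => simp [hM.v_zero, hκ.ne']
  | succ n ih =>
    rw [Finset.sum_range_succ, mul_add]
    have hv := hM.v_nonneg h₂.le h₂' n
    have hv' := hM.v_nonneg h₂.le h₂' (n + 1)
    have hB : 0 < v n + κ := by linarith
    have hB' : 0 < v (n + 1) + κ := by linarith
    have key : (1 - β₂) * (γ n ^ 2 / (v (n + 1) + κ)) ≤
        Real.log ((v (n + 1) + κ) / (β₂ * (v n + κ))) := by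
      have h1 := Real.one_sub_inv_le_log_of_pos (x := (v (n + 1) + κ) / (β₂ * (v n + κ)))
        (by positivity)
      refine le_trans ?_ h1
      rw [inv_div, ← mul_div_assoc, le_sub_iff_add_le, ← add_div, div_le_one hB', hM.v_succ]
      nlinarith [mul_pos (sub_pos.2 h₂') hκ]
    rw [Real.log_div hB'.ne' (by positivity), Real.log_mul h₂.ne' hB.ne'] at key
    rw [Real.log_div hB.ne' hκ.ne'] at ih
    rw [Real.log_div hB'.ne' hκ.ne']
    push_cast
    linarith

lemma sum_le_of_geometric {ρ : ℝ} (hρ : 0 ≤ ρ) {Q u : ℕ → ℝ} (hQ0 : Q 0 = 0)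
    (hQ : ∀ n, 0 ≤ Q n) (hs : ∀ n, Q (n + 1) ≤ ρ * Q n + u n) (n : ℕ) :
    (1 - ρ) * ∑ j ∈ Finset.range (n + 1), Q j ≤ ∑ j ∈ Finset.range n, u j := by
  -- The boundary term ρ·Q n makes the induction close.
  suffices (1 - ρ) * ∑ j ∈ Finset.range (n + 1), Q j + ρ * Q n ≤ ∑ j ∈ Finset.range n, u j by
    nlinarith [mul_nonneg hρ (hQ n)]
  induction n with
  | zero => simp [hQ0]
  | succ n ih =>
    rw [Finset.sum_range_succ, Finset.sum_range_succ u]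
    nlinarith [hs n]

/-- Dividing by v + κ turns the decay rate β₁ into β₁/β₂, since v + κ shrinks at most by the factor
β₂ per step. Summing the geometric recursion is the origin of r. -/
lemma Moments.sum_sqAvg_div_le (hM : Moments β₁ β₂ γ m v) (h₁ : 0 ≤ β₁) (h₁₂ : β₁ < β₂)
    (h₂' : β₂ < 1) {κ : ℝ} (hκ : 0 < κ) (n : ℕ) :
    (1 - β₁ / β₂) * ∑ j ∈ Finset.range (n + 1), sqAvg β₁ γ j / (v j + κ)
      ≤ ∑ j ∈ Finset.range n, γ j ^ 2 / (v (j + 1) + κ) := by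
  have h₂ : 0 < β₂ := by linarith
  have hv := hM.v_nonneg h₂.le h₂'
  have hq := sqAvg_nonneg h₁ γ
  have hB : ∀ n, 0 < v n + κ := fun n => by linarith [hv n]
  refine sum_le_of_geometric (by positivity) (by simp [sqAvg])
    (fun j => div_nonneg (hq j) (hB j).le) (fun j => ?_) n
  rw [sqAvg, add_div]
  gcongr
  have := hB j
  have := hB (j + 1)
  rw [div_mul_div_comm]
  exact div_le_div_of_nonneg_left (mul_nonneg h₁ (hq j)) (by positivity)
    (hM.mul_v_add_le h₂' hκ j)

end

end Adam

namespace Adam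

/-! ### Step sizes -/

section

variable {β₁ β₂ C₀ ε₀ : ℝ}

lemma stepSize_nonneg (h₁ : 0 ≤ β₁) (h₁' : β₁ < 1) (hC : 0 ≤ C₀) (n : ℕ) :
    0 ≤ stepSize (params β₁ β₂ C₀ ε₀) n := by
  have : β₁ ^ n ≤ 1 := pow_le_one₀ h₁ h₁'.le
  have : 0 ≤ 1 - β₁ ^ n := by linarith
  simp only [stepSize, params]
  positivity

lemma one_sub_le_one_sub_pow (h₁ : 0 ≤ β₁) (h₁' : β₁ < 1) (n : ℕ) :
    1 - β₁ ≤ 1 - β₁ ^ (n + 1) := by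
  have : β₁ ^ (n + 1) ≤ β₁ := pow_le_of_le_one h₁ h₁'.le n.succ_ne_zero
  linarith

lemma sqrt_one_sub_pow_le_one (h₂ : 0 ≤ β₂) (n : ℕ) : √(1 - β₂ ^ n) ≤ 1 := by
  rw [Real.sqrt_le_one]
  have : 0 ≤ β₂ ^ n := by positivity
  linarith

lemma stepSize_succ_le (h₁ : 0 ≤ β₁) (h₁' : β₁ < 1) (h₂ : 0 ≤ β₂) (hC : 0 ≤ C₀) (n : ℕ) :
    stepSize (params β₁ β₂ C₀ ε₀) (n + 1) ≤ C₀ * √(1 - β₂) / (1 - β₁) := by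
  simp only [stepSize, params]
  have h := one_sub_le_one_sub_pow h₁ h₁' n
  have h' := sqrt_one_sub_pow_le_one h₂ (n + 1)
  have h0 : 0 < 1 - β₁ := by linarith
  exact div_le_div₀ (by positivity) (mul_le_of_le_one_right (by positivity) h') h0 h

lemma stepSize_succ_mul_le (h₁ : 0 ≤ β₁) (h₁' : β₁ < 1) (h₂ : 0 ≤ β₂) (hC : 0 ≤ C₀) (n : ℕ) :
    stepSize (params β₁ β₂ C₀ ε₀) (n + 1) * ((1 - β₁) * (1 - β₁ ^ n)) ≤ C₀ * √(1 - β₂) := by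
  have h := stepSize_succ_le (ε₀ := ε₀) h₁ h₁' h₂ hC n
  have h0 : 0 < 1 - β₁ := by linarith
  rw [le_div_iff₀ h0] at h
  have hn : β₁ ^ n ≤ 1 := pow_le_one₀ h₁ h₁'.le
  have hn' : 0 ≤ β₁ ^ n := by positivity
  rw [← mul_assoc]
  refine le_trans (mul_le_of_le_one_right ?_ (by linarith)) h
  exact mul_nonneg (stepSize_nonneg h₁ h₁' hC _) h0.le

/-- The bias correction contributes (1-β₁^n)⁻², which is absorbed because 1-β₁ ≤ 1-β₁^n. The factor
on the left is the one from `Moments.m_sq_le`. -/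
lemma stepSize_sq_mul_le (h₁ : 0 ≤ β₁) (h₁' : β₁ < 1) (h₂ : 0 ≤ β₂) (h₂' : β₂ < 1) (n : ℕ) :
    stepSize (params β₁ β₂ C₀ ε₀) n ^ 2 * ((1 - β₁) * (1 - β₁ ^ n)) ≤ C₀ ^ 2 * (1 - β₂) := by
  have h0 : 0 < 1 - β₁ := by linarith
  have h2 : 0 < 1 - β₂ := by linarith
  rcases n with _ | n
  · simp; positivity
  · have h := one_sub_le_one_sub_pow h₁ h₁' n
    have hA : 0 < 1 - β₁ ^ (n + 1) := by linarith
    have hp : β₂ ^ (n + 1) ≤ 1 := pow_le_one₀ h₂ h₂'.le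
    have hp' : 0 ≤ β₂ ^ (n + 1) := by positivity
    simp only [stepSize, params]
    rw [div_pow, mul_pow, mul_pow, Real.sq_sqrt h2.le, Real.sq_sqrt (by linarith),
      div_mul_eq_mul_div, div_le_iff₀ (by positivity), mul_assoc]
    refine mul_le_mul_of_nonneg_left ?_ (by positivity)
    calc (1 - β₂ ^ (n + 1)) * ((1 - β₁) * (1 - β₁ ^ (n + 1)))
        ≤ 1 * ((1 - β₁ ^ (n + 1)) * (1 - β₁ ^ (n + 1))) := by gcongr; linarith
      _ = _ := by ring

/-- The step size is a constant times an increasing factor A ≤ 1 and a decreasing factor P ≤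
1/(1-β₁). The total variation of the product is at most the sum of two telescoping variations, each
at most 1/(1-β₁). -/
lemma sum_abs_stepSize_sub_le (h₁ : 0 ≤ β₁) (h₁' : β₁ < 1) (h₂ : 0 ≤ β₂) (h₂' : β₂ < 1)
    (hC : 0 ≤ C₀) (t : ℕ) :
    ∑ n ∈ Finset.range t, |stepSize (params β₁ β₂ C₀ ε₀) (n + 2)
        - stepSize (params β₁ β₂ C₀ ε₀) (n + 1)| ≤ 2 * (C₀ * √(1 - β₂) / (1 - β₁)) := by
  have h0 : 0 < 1 - β₁ := by linarith
  set c := C₀ * √(1 - β₂) with hc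
  have hc0 : 0 ≤ c := by positivity
  let A : ℕ → ℝ := fun n => √(1 - β₂ ^ (n + 1))
  let P : ℕ → ℝ := fun n => (1 - β₁ ^ (n + 1))⁻¹
  have hw : ∀ n, stepSize (params β₁ β₂ C₀ ε₀) (n + 1) = c * (A n * P n) := fun n => by
    simp only [stepSize, params, A, P, hc]; rw [div_eq_mul_inv]; ring
  have hP : ∀ n, P n ≤ (1 - β₁)⁻¹ := fun n =>
    inv_anti₀ h0 (one_sub_le_one_sub_pow h₁ h₁' n)
  have hP0 : ∀ n, 0 ≤ P n := fun n =>
    inv_nonneg.2 (h0.le.trans (one_sub_le_one_sub_pow h₁ h₁' n))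
  have hPd : ∀ n, P (n + 1) ≤ P n := fun n =>
    inv_anti₀ (h0.trans_le (one_sub_le_one_sub_pow h₁ h₁' n)) (by
      have := pow_le_pow_of_le_one h₁ h₁'.le ((n + 1).le_add_right 1)
      linarith)
  have hA1 : ∀ n, A n ≤ 1 := fun n => sqrt_one_sub_pow_le_one h₂ _
  have hA0 : ∀ n, 0 ≤ A n := fun n => Real.sqrt_nonneg _
  have hAi : ∀ n, A n ≤ A (n + 1) := fun n => Real.sqrt_le_sqrt (by
      have := pow_le_pow_of_le_one h₂ h₂'.le ((n + 1).le_add_right 1)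
      linarith)
  have hstep : ∀ n, |A (n + 1) * P (n + 1) - A n * P n| ≤
      (1 - β₁)⁻¹ * (A (n + 1) - A n) + (P n - P (n + 1)) := fun n => by
    have e : A (n + 1) * P (n + 1) - A n * P n
      = P (n + 1) * (A (n + 1) - A n) - A n * (P n - P (n + 1)) := by ring
    have i1 : P (n + 1) * (A (n + 1) - A n) ≤ (1 - β₁)⁻¹ * (A (n + 1) - A n) :=
      mul_le_mul_of_nonneg_right (hP _) (sub_nonneg.2 (hAi n))
    have i2 : A n * (P n - P (n + 1)) ≤ P n - P (n + 1) :=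
      mul_le_of_le_one_left (sub_nonneg.2 (hPd n)) (hA1 n)
    have i3 : 0 ≤ P (n + 1) * (A (n + 1) - A n) :=
      mul_nonneg (hP0 _) (sub_nonneg.2 (hAi n))
    have i4 : 0 ≤ A n * (P n - P (n + 1)) := mul_nonneg (hA0 n) (sub_nonneg.2 (hPd n))
    rw [e, abs_le]
    constructor <;> linarith [i1, i2, i3, i4]
  have hsum : ∑ n ∈ Finset.range t, |stepSize (params β₁ β₂ C₀ ε₀) (n + 2)
        - stepSize (params β₁ β₂ C₀ ε₀) (n + 1)| ≤
      c * ((1 - β₁)⁻¹ * (A t - A 0) + (P 0 - P t)) := by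
    rw [← Finset.sum_range_sub A t, ← neg_sub (P t) (P 0), ← Finset.sum_range_sub P t,
      Finset.mul_sum, ← Finset.sum_neg_distrib, ← Finset.sum_add_distrib, Finset.mul_sum]
    refine Finset.sum_le_sum fun n _ => ?_
    rw [hw, hw, ← mul_sub, abs_mul, abs_of_nonneg hc0, neg_sub]
    exact mul_le_mul_of_nonneg_left (hstep n) hc0
  refine hsum.trans ?_
  rw [mul_div_assoc', mul_comm 2 c, mul_div_assoc]
  refine mul_le_mul_of_nonneg_left ?_ hc0
  have i0 : 0 < (1 - β₁)⁻¹ := by positivity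
  have i1 : (1 - β₁)⁻¹ * (A t - A 0) ≤ (1 - β₁)⁻¹ :=
    mul_le_of_le_one_right i0.le (by linarith [hA1 t, hA0 0])
  rw [div_eq_mul_inv]
  linarith [hP 0, hP0 t]

lemma eps_nonneg (hε : 0 ≤ ε₀) (n : ℕ) : 0 ≤ eps (params β₁ β₂ C₀ ε₀) n := by
  simp only [eps, params]; positivity

lemma eps_le (h₂ : 0 ≤ β₂) (hε : 0 ≤ ε₀) (n : ℕ) :
    eps (params β₁ β₂ C₀ ε₀) n ≤ ε₀ * √(1 - β₂) :=
  mul_le_of_le_one_right (by simp only [params]; positivity) (sqrt_one_sub_pow_le_one h₂ n)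

lemma eps_le_eps_succ (h₂ : 0 ≤ β₂) (h₂' : β₂ < 1) (hε : 0 ≤ ε₀) (n : ℕ) :
    eps (params β₁ β₂ C₀ ε₀) n ≤ eps (params β₁ β₂ C₀ ε₀) (n + 1) := by
  have := pow_le_pow_of_le_one h₂ h₂'.le (n.le_add_right 1)
  simp only [eps, params]
  gcongr

lemma eps_succ_sq_ge (h₂ : 0 ≤ β₂) (h₂' : β₂ < 1) (n : ℕ) :
    (ε₀ * √(1 - β₂)) ^ 2 * (1 - β₂) ≤ eps (params β₁ β₂ C₀ ε₀) (n + 1) ^ 2 := by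
  have h := one_sub_le_one_sub_pow h₂ h₂' n
  simp only [eps, params]
  rw [mul_pow _ (√(1 - β₂ ^ (n + 1))), Real.sq_sqrt (by linarith)]
  gcongr

lemma eps_succ_pos (h₂ : 0 ≤ β₂) (h₂' : β₂ < 1) (hε : 0 < ε₀) (n : ℕ) :
    0 < eps (params β₁ β₂ C₀ ε₀) (n + 1) := by
  have h := one_sub_le_one_sub_pow h₂ h₂' n
  have h0 : 0 < 1 - β₂ := by linarith
  have h1 : 0 < 1 - β₂ ^ (n + 1) := by linarith
  simp only [eps, params]
  positivity

/-- Consecutive ratios of step sizes to denominators differ by at most a factor `sigmaMax`. -/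
lemma abs_ratio_sub_le (h₁ : 0 ≤ β₁) (h₁' : β₁ < 1) (h₂ : 0 < β₂) (h₂' : β₂ < 1)
    (hC : 0 ≤ C₀) (n : ℕ) {b b' : ℝ} (hb : 0 < b) (hb' : √β₂ * b ≤ b') :
    |stepSize (params β₁ β₂ C₀ ε₀) (n + 2) / b' - stepSize (params β₁ β₂ C₀ ε₀) (n + 1) / b|
      ≤ sigmaMax β₂ * (stepSize (params β₁ β₂ C₀ ε₀) (n + 1) / b) := by
  have h0 : 0 < 1 - β₁ := by linarith
  set w := stepSize (params β₁ β₂ C₀ ε₀) (n + 1) with hw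
  set w' := stepSize (params β₁ β₂ C₀ ε₀) (n + 2) with hw'
  have hw0 : 0 ≤ w := stepSize_nonneg h₁ h₁' hC _
  have hw0' : 0 ≤ w' := stepSize_nonneg h₁ h₁' hC _
  have hbeta : 0 < √β₂ := Real.sqrt_pos.2 h₂
  have hbp : 0 < b' := lt_of_lt_of_le (by positivity) hb'
  -- The correction 1/(1-β₁^s) decreases, and 1-β₂^(n+2) ≤ (1+β₂)(1-β₂^(n+1)) because β₂^(n+1) ≤ β₂.
  have hww : w' ≤ √(1 + β₂) * w := by
    simp only [hw, hw', stepSize, params]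
    rw [mul_div_assoc', mul_left_comm, ← Real.sqrt_mul (by positivity)]
    have := pow_le_pow_of_le_one h₁ h₁'.le ((n + 1).le_add_right 1)
    have := one_sub_le_one_sub_pow h₁ h₁' n
    gcongr
    · linarith
    · have : β₂ ^ (n + 1) ≤ β₂ := pow_le_of_le_one h₂.le h₂'.le n.succ_ne_zero
      have e : β₂ ^ (n + 2) = β₂ * β₂ ^ (n + 1) := by ring
      rw [e]; nlinarith
  have hup : w' / b' ≤ √((1 + β₂) / β₂) * (w / b) := by
    rw [Real.sqrt_div (by positivity), div_mul_div_comm]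
    gcongr
  have hwb : 0 ≤ w / b := by positivity
  have hwb' : 0 ≤ w' / b' := by positivity
  have m1 : 1 * (w / b) ≤ sigmaMax β₂ * (w / b) :=
    mul_le_mul_of_nonneg_right (le_max_left _ _) hwb
  have m2 : (√((1 + β₂) / β₂) - 1) * (w / b) ≤ sigmaMax β₂ * (w / b) :=
    mul_le_mul_of_nonneg_right (le_max_right _ _) hwb
  -- The upper side uses the square-root entry of the maximum. The lower side uses only that the new
  -- ratio is nonnegative, hence the entry 1.
  rw [abs_le]
  constructor <;> linarith

end

/-! ### Elementary inequalities -/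

/-- Since 1/a - 1/b = (b-a)/(ab), half of the 1/a stays with h, and |a-b| ≤ √(R·a) pays for the
other half. The error becomes a fraction c of the descent term plus a summable square. -/
lemma mul_sub_inv_le_young {w a b c R h t : ℝ} (hw : 0 ≤ w) (ha : 0 < a) (hb : 0 < b)
    (hc : 0 < c) (hR : (a - b) ^ 2 ≤ R * a) :
    w * (h * t * (1 / a - 1 / b)) ≤ c * (w * (h ^ 2 / a)) + R / (4 * c) * (w * (t / b) ^ 2) := by
  have e : h * t * (1 / a - 1 / b) = h * (t / b) * (b - a) / a := by
    field_simp
  set u := t / b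
  rw [e]
  have : h * u * (b - a) / a ≤ c * (h ^ 2 / a) + R / (4 * c) * u ^ 2 := by
    rw [div_le_iff₀ ha]
    have e2 : (c * (h ^ 2 / a) + R / (4 * c) * u ^ 2) * a
      = c * h ^ 2 + (R * a) * u ^ 2 / (4 * c) := by field_simp
    rw [e2]
    have h1 : (a - b) ^ 2 * u ^ 2 / (4 * c) ≤ (R * a) * u ^ 2 / (4 * c) := by gcongr
    refine le_trans ?_ (add_le_add_right h1 _)
    rw [← sub_nonneg]
    have e3 : c * h ^ 2 + (a - b) ^ 2 * u ^ 2 / (4 * c) - h * u * (b - a)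
      = (2 * c * h - u * (b - a)) ^ 2 / (4 * c) := by field_simp; ring
    rw [e3]; positivity
  calc _ ≤ w * (c * (h ^ 2 / a) + R / (4 * c) * u ^ 2) := mul_le_mul_of_nonneg_left this hw
    _ = _ := by ring

/-- The map x ↦ √(V+x²) is the norm of (√V, x), hence 1-Lipschitz; `hAB` is Cauchy–Schwarz. -/
lemma sq_sqrt_add_sub_le {V : ℝ} (p q : ℝ) (hV : 0 ≤ V) :
    (√(V + p ^ 2) - √(V + q ^ 2)) ^ 2 ≤ (p - q) ^ 2 := by
  set A := √(V + p ^ 2) with hA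
  set B := √(V + q ^ 2) with hB
  have hA2 : A ^ 2 = V + p ^ 2 := Real.sq_sqrt (by positivity)
  have hB2 : B ^ 2 = V + q ^ 2 := Real.sq_sqrt (by positivity)
  have hAB : V + p * q ≤ A * B := by
    rw [hA, hB, ← Real.sqrt_mul (by positivity)]
    apply Real.le_sqrt_of_sq_le
    nlinarith [mul_nonneg hV (sq_nonneg (p - q))]
  nlinarith

/-- Exchanging a stochastic gradient for its proxy inside the denominator. -/
lemma sq_proxy_sub_le {V s N h γ : ℝ} (hV : 0 ≤ V) (hN : 0 ≤ N)
    (hγ : |γ - h| ≤ N) :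
    (√(V + s ^ 2 * (N ^ 2 + h ^ 2)) - √(V + s ^ 2 * γ ^ 2)) ^ 2 ≤ 4 * (s * N) ^ 2 := by
  set P := √(N ^ 2 + h ^ 2) with hP
  have hP2 : P ^ 2 = N ^ 2 + h ^ 2 := Real.sq_sqrt (by positivity)
  have hP0 : 0 ≤ P := Real.sqrt_nonneg _
  have hγ1 : |γ| ≤ N + |h| := by
    calc |γ| = |(γ - h) + h| := by ring_nf
      _ ≤ _ := (abs_add_le _ _).trans (by linarith)
  have hγ2 : |h| ≤ N + |γ| := by
    calc |h| = |γ - (γ - h)| := by ring_nf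
      _ ≤ _ := (abs_sub _ _).trans (by linarith)
  have hP1 : |h| ≤ P := by rw [hP]; exact Real.abs_le_sqrt (by nlinarith)
  have hP3 : P ≤ N + |h| := by
    rw [hP]; apply Real.sqrt_le_iff.2 ⟨by positivity, ?_⟩
    nlinarith [sq_abs h, mul_nonneg hN (abs_nonneg h)]
  have e1 : s ^ 2 * (N ^ 2 + h ^ 2) = (s * P) ^ 2 := by rw [mul_pow, hP2]
  have e2 : s ^ 2 * γ ^ 2 = (s * |γ|) ^ 2 := by rw [mul_pow, sq_abs]
  rw [e1, e2]
  refine (sq_sqrt_add_sub_le _ _ hV).trans ?_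
  have : |P - (|γ|)| ≤ 2 * N := by rw [abs_le]; constructor <;> linarith
  calc (s * P - s * |γ|) ^ 2 = s ^ 2 * |P - (|γ|)| ^ 2 := by rw [sq_abs]; ring
    _ ≤ s ^ 2 * (2 * N) ^ 2 := by gcongr
    _ = _ := by ring

/-- The proxy denominator against the previous denominator. -/
lemma sq_proxy_sub_prev_le {β s W v e e' ε Wm : ℝ} (hβ : 0 < β) (hβ' : β < 1)
    (hs : 0 ≤ s) (hs2 : s ^ 2 = 1 - β)
    (hW : 0 ≤ W) (hv : 0 ≤ v) (he : 0 ≤ e) (hee : e ≤ e') (he' : e' ≤ ε * s)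
    (hWm : 0 ≤ Wm) (hWW : W ≤ Wm ^ 2) (hvW : v ≤ 2 * Wm ^ 2) :
    (√(β * v + s ^ 2 * W) + e' - (√v + e)) ^ 2 ≤
      s * ((ε + √2 * Wm) / √β) * (√(β * v + s ^ 2 * W) + e') := by
  have hs1 : s ≤ 1 := by nlinarith
  have hsb : 0 < √β := Real.sqrt_pos.2 hβ
  have hsb2 : √β ^ 2 = β := Real.sq_sqrt hβ.le
  have hsb1 : √β ≤ 1 := Real.sqrt_le_one.2 hβ'.le
  set Y := √(β * v + s ^ 2 * W) with hY
  have hY0 : 0 ≤ Y := Real.sqrt_nonneg _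
  have hV0 : 0 ≤ √v := Real.sqrt_nonneg _
  have hlow : √β * √v ≤ Y := by
    rw [hY, ← Real.sqrt_mul hβ.le]; apply Real.sqrt_le_sqrt; nlinarith [mul_nonneg (sq_nonneg s) hW]
  have hup : Y ≤ √v + s * Wm := by
    rw [hY]; apply Real.sqrt_le_iff.2 ⟨by positivity, ?_⟩
    have : √v ^ 2 = v := Real.sq_sqrt hv
    have : s ^ 2 * W ≤ s ^ 2 * Wm ^ 2 := by gcongr
    nlinarith [mul_nonneg hV0 (mul_nonneg hs hWm)]
  have hsv : √v ≤ √2 * Wm := by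
    apply Real.sqrt_le_iff.2 ⟨by positivity, ?_⟩
    rw [mul_pow, Real.sq_sqrt (by norm_num)]; exact hvW
  have hε : 0 ≤ ε * s := by linarith
  have h2 : 1 ≤ √2 := Real.one_le_sqrt.2 (by norm_num)
  set a := Y + e' with ha
  have ha0 : 0 ≤ a := by linarith
  -- An increase of the denominator is at most s(√2·Wm + ε), and also at most a. A decrease is at
  -- most (1-√β)√v, where 1-√β ≤ 1-β = s² and √v is bounded both by √2·Wm and by a/√β.
  by_cases hcase : √v + e ≤ a
  · have hD0 : 0 ≤ a - (√v + e) := by linarith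
    have hD1 : a - (√v + e) ≤ a := by linarith
    have hD2 : a - (√v + e) ≤ s * (√2 * Wm) + ε * s := by
      have : s * Wm ≤ s * (√2 * Wm) := by
        gcongr; exact le_mul_of_one_le_left hWm h2
      linarith
    calc (a - (√v + e)) ^ 2 = (a - (√v + e)) * (a - (√v + e)) := sq _
      _ ≤ (s * (√2 * Wm) + ε * s) * a := by gcongr
      _ ≤ ((s * (√2 * Wm) + ε * s) / √β) * a := by
          gcongr
          rw [le_div_iff₀ hsb]
          exact mul_le_of_le_one_right (by positivity) hsb1
      _ = _ := by ring
  · push Not at hcase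
    have hε0 : 0 ≤ ε ∨ s = 0 := by
      rcases hs.eq_or_lt with h | h
      · exact Or.inr h.symm
      · exact Or.inl (nonneg_of_mul_nonneg_left hε h)
    have hD0 : 0 ≤ √v + e - a := by linarith
    have hD1 : √v + e - a ≤ (1 - √β) * √v := by linarith
    have hone : (1 - √β) ≤ s ^ 2 := by rw [hs2]; nlinarith
    have hone' : (1 - √β) ≤ 1 := by linarith
    have hone0 : 0 ≤ (1 - √β) := by linarith
    have hss : s ^ 2 ≤ s := by nlinarith
    have hva : √v ≤ a / √β := by
      rw [le_div_iff₀ hsb]; linarith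
    have hWb : 0 ≤ √2 * Wm := by positivity
    calc (a - (√v + e)) ^ 2 = (√v + e - a) * (√v + e - a) := by ring
      _ ≤ ((1 - √β) * √v) * ((1 - √β) * √v) := by gcongr
      _ = ((1 - √β) * (1 - √β)) * (√v * √v) := by ring
      _ ≤ (s * 1) * ((√2 * Wm) * (a / √β)) := by
          gcongr
          linarith
      _ = s * ((√2 * Wm) / √β) * a := by ring
      _ ≤ s * ((ε + √2 * Wm) / √β) * a := by
          rcases hε0 with h | h
          · gcongr; linarith
          · simp [h]

/-- Young's inequality in the form used to absorb a multiple of `√G`. -/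
lemma mul_sqrt_le (x : ℝ) {G : ℝ} (hG : 0 ≤ G) : x * √G ≤ G / 8 + 2 * x ^ 2 := by
  have := Real.sq_sqrt hG
  nlinarith [sq_nonneg (√G - 4 * x)]

end Adam

namespace Adam

/-! ### Smooth functions -/

section

variable {d : ℕ} {f : EuclideanSpace ℝ (Fin d) → ℝ} {L : ℝ}

lemma LSmooth.continuous_gradient (hf : LSmooth f L) : Continuous (gradient f) := by
  refine (LipschitzWith.of_dist_le_mul (K := L.toNNReal) fun x y => ?_).continuous
  rw [dist_eq_norm, dist_eq_norm]
  exact (hf.gradient_lipschitz x y).trans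
    (mul_le_mul_of_nonneg_right (Real.le_coe_toNNReal L) (norm_nonneg _))

/-- Along the segment, f minus its quadratic upper model has nonpositive derivative, by the
Lipschitz gradient and Cauchy–Schwarz. -/
lemma LSmooth.le_add_inner_add (hf : LSmooth f L) (x u : EuclideanSpace ℝ (Fin d)) :
    f (x + u) ≤ f x + inner ℝ (gradient f x) u + L / 2 * ‖u‖ ^ 2 := by
  let φ : ℝ → ℝ := fun t => f (x + t • u) - t * inner ℝ (gradient f x) u - L / 2 * t ^ 2 * ‖u‖ ^ 2
  have hd : ∀ t, HasDerivAt φ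
      (inner ℝ (gradient f (x + t • u)) u - inner ℝ (gradient f x) u - L * t * ‖u‖ ^ 2) t := by
    intro t
    have h1 : HasDerivAt (fun t : ℝ => x + t • u) u t := by
      simpa using ((hasDerivAt_id t).smul_const u).const_add x
    have h2 := (hf.differentiable (x + t • u)).hasGradientAt.hasFDerivAt.comp_hasDerivAt t h1
    have h3 := ((hasDerivAt_id t).mul_const (inner ℝ (gradient f x) u))
    have h4 := (((hasDerivAt_pow 2 t).const_mul (L / 2)).mul_const (‖u‖ ^ 2))
    have h5 := (h2.sub h3).sub h4
    refine (h5.congr_deriv ?_)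
    rw [InnerProductSpace.toDual_apply_apply, show t ^ (2 - 1) = t from pow_one t]
    push_cast
    ring
  have hmono : AntitoneOn φ (Set.Icc 0 1) := by
    refine antitoneOn_of_deriv_nonpos (convex_Icc 0 1)
      (fun t _ => (hd t).continuousAt.continuousWithinAt)
      (fun t _ => (hd t).differentiableAt.differentiableWithinAt) fun t ht => ?_
    rw [interior_Icc] at ht
    rw [(hd t).deriv, ← inner_sub_left]
    have h1 := real_inner_le_norm (gradient f (x + t • u) - gradient f x) u
    have h2 := hf.gradient_lipschitz (x + t • u) x
    rw [add_sub_cancel_left, norm_smul, Real.norm_of_nonneg ht.1.le] at h2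
    have h3 := mul_le_mul_of_nonneg_right h2 (norm_nonneg u)
    nlinarith
  have := hmono (Set.left_mem_Icc.2 zero_le_one) (Set.right_mem_Icc.2 zero_le_one) zero_le_one
  simp only [φ, one_smul, zero_smul, add_zero] at this
  linarith

/-- A gradient step of length 1/L cannot go below the lower bound c. -/
lemma LSmooth.sq_norm_gradient_le (hf : LSmooth f L) (hL : 0 ≤ L) {c : ℝ} (hc : ∀ x, c ≤ f x)
    (x : EuclideanSpace ℝ (Fin d)) : ‖gradient f x‖ ^ 2 ≤ 2 * L * (f x - c) := by
  have key : ∀ t : ℝ, t * ‖gradient f x‖ ^ 2 ≤ f x - c + L / 2 * t ^ 2 * ‖gradient f x‖ ^ 2 := by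
    intro t
    have h1 := hf.le_add_inner_add x (-t • gradient f x)
    have h2 := hc (x + -t • gradient f x)
    rw [inner_smul_right, real_inner_self_eq_norm_sq, norm_smul, mul_pow, norm_neg,
      Real.norm_eq_abs, sq_abs] at h1
    linarith
  set n := ‖gradient f x‖ ^ 2
  have hn : 0 ≤ n := by positivity
  have hfc : 0 ≤ f x - c := sub_nonneg.2 (hc x)
  rcases hL.eq_or_lt with h0 | hpos
  -- For L = 0 a nonzero gradient would let f decrease linearly without bound; the step length is
  -- chosen to pass c by one unit.
  · by_contra hcon
    push Not at hcon
    rw [← h0] at hcon key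
    have hn0 : 0 < n := by simpa using hcon
    have h1 := key ((f x - c + 1) / n)
    rw [div_mul_cancel₀ _ hn0.ne'] at h1
    linarith
  · have h1 := key (1 / L)
    field_simp at h1
    nlinarith

/-- One step of the auxiliary sequence: the error made when the gradient is taken at a point
`x` near `y` instead of `y`. -/
lemma LSmooth.le_add_inner_near (hf : LSmooth f L) (hL : 0 ≤ L)
    (x y u : EuclideanSpace ℝ (Fin d)) {p q S : ℝ} (hS : 1 ≤ S) (hxy : ‖y - x‖ ≤ q)
    (hu : ‖u‖ ≤ p + S * q) :
    f (y + u) ≤ f y + inner ℝ (gradient f x) u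
      + L * ((1 / 2 + 2 * S ^ 2) * q ^ 2 + 3 / 2 * p ^ 2) := by
  have h0 := hf.le_add_inner_add y u
  have h1 := real_inner_le_norm (gradient f y - gradient f x) u
  rw [inner_sub_left] at h1
  have h2 := hf.gradient_lipschitz y x
  have hq : 0 ≤ q := (norm_nonneg _).trans hxy
  have h3 : ‖gradient f y - gradient f x‖ * ‖u‖ ≤ (L * q) * (p + S * q) := by
    refine mul_le_mul (h2.trans (mul_le_mul_of_nonneg_left hxy hL)) hu (norm_nonneg _)
      (by positivity)
  have h4 : L / 2 * ‖u‖ ^ 2 ≤ L / 2 * (p + S * q) ^ 2 := by gcongr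
  -- AM-GM on the cross terms pq and p·Sq, then S ≤ S².
  have h5 : q * (p + S * q) + (p + S * q) ^ 2 / 2 ≤
      (1 / 2 + 2 * S ^ 2) * q ^ 2 + 3 / 2 * p ^ 2 := by
    have : 0 ≤ (S - 1) * S * q ^ 2 := by
      have : 0 ≤ S - 1 := by linarith
      positivity
    nlinarith [sq_nonneg (p - q), sq_nonneg (p - S * q)]
  have h6 := mul_le_mul_of_nonneg_left h5 hL
  linarith

end

end Adam

namespace Adam

/-! ### One coordinate of Adam -/

/-- The admissible hyper-parameters. -/
structure Admissible (β₁ β₂ C₀ ε₀ : ℝ) : Prop where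
  nonneg₁ : 0 ≤ β₁
  lt : β₁ < β₂
  lt_one : β₂ < 1
  pos_C : 0 < C₀
  pos_ε : 0 < ε₀

/-- The noise level `√(σ₀² + σ₁² h²)`. -/
noncomputable def noiseLevel (σ₀ σ₁ h : ℝ) : ℝ := √(σ₀ ^ 2 + σ₁ ^ 2 * h ^ 2)

/-- The denominator `√v_n + ε_n`. -/
noncomputable def denom (p : Params) (v : ℕ → ℝ) (n : ℕ) : ℝ := √(v n) + eps p n

/-- The proxy denominator in iteration `n + 1`, for a coordinate `h` of the gradient. -/
noncomputable def proxyDenom (p : Params) (σ₀ σ₁ : ℝ) (v h : ℕ → ℝ) (n : ℕ) : ℝ :=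
  √(p.β₂ * v n + (1 - p.β₂) * (σ₀ ^ 2 + (1 + σ₁ ^ 2) * h n ^ 2)) + eps p (n + 1)

lemma noiseLevel_nonneg (σ₀ σ₁ h : ℝ) : 0 ≤ noiseLevel σ₀ σ₁ h := Real.sqrt_nonneg _

lemma noiseLevel_sq (σ₀ σ₁ h : ℝ) : noiseLevel σ₀ σ₁ h ^ 2 = σ₀ ^ 2 + σ₁ ^ 2 * h ^ 2 :=
  Real.sq_sqrt (by positivity)

lemma noiseLevel_le {σ₀ σ₁ h S₀ S₁ G : ℝ} (h₀ : 0 ≤ σ₀) (h₁ : 0 ≤ σ₁) (h₀' : σ₀ ≤ S₀)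
    (h₁' : σ₁ ≤ S₁) (hG : h ^ 2 ≤ G) : noiseLevel σ₀ σ₁ h ≤ S₀ + S₁ * √G := by
  have hS₀ : 0 ≤ S₀ := h₀.trans h₀'
  have hS₁ : 0 ≤ S₁ := h₁.trans h₁'
  have hG0 : 0 ≤ G := (sq_nonneg h).trans hG
  apply Real.sqrt_le_iff.2 ⟨by positivity, ?_⟩
  have i1 : σ₀ ^ 2 ≤ S₀ ^ 2 := by gcongr
  have i2 : σ₁ ^ 2 * h ^ 2 ≤ S₁ ^ 2 * G := by gcongr
  have i3 : 0 ≤ S₀ * (S₁ * √G) := by positivity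
  have := Real.sq_sqrt hG0
  nlinarith

lemma second_moment_le {σ₀ σ₁ h S₀ S₁ G : ℝ} (h₀ : 0 ≤ σ₀) (h₁ : 0 ≤ σ₁) (h₀' : σ₀ ≤ S₀)
    (h₁' : σ₁ ≤ S₁) (hG : h ^ 2 ≤ G) :
    σ₀ ^ 2 + (1 + σ₁ ^ 2) * h ^ 2 ≤ (S₀ + √(1 + S₁ ^ 2) * √G) ^ 2 := by
  have hS₀ : 0 ≤ S₀ := h₀.trans h₀'
  have hS₁ : 0 ≤ S₁ := h₁.trans h₁'
  have hG0 : 0 ≤ G := (sq_nonneg h).trans hG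
  have i1 : σ₀ ^ 2 ≤ S₀ ^ 2 := by gcongr
  have i2 : (1 + σ₁ ^ 2) * h ^ 2 ≤ (1 + S₁ ^ 2) * G := by gcongr
  have i3 : 0 ≤ S₀ * (√(1 + S₁ ^ 2) * √G) := by positivity
  have := Real.sq_sqrt hG0
  have : √(1 + S₁ ^ 2) ^ 2 = 1 + S₁ ^ 2 := Real.sq_sqrt (by positivity)
  calc _ ≤ S₀ ^ 2 + √(1 + S₁ ^ 2) ^ 2 * √G ^ 2 := by rw [this, Real.sq_sqrt hG0]; linarith
    _ ≤ _ := by nlinarith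

lemma sq_le_of_noise {σ₀ σ₁ h γ : ℝ} (hγ : |γ - h| ≤ noiseLevel σ₀ σ₁ h) :
    γ ^ 2 ≤ 2 * (σ₀ ^ 2 + (1 + σ₁ ^ 2) * h ^ 2) := by
  have h1 : (γ - h) ^ 2 ≤ σ₀ ^ 2 + σ₁ ^ 2 * h ^ 2 := by
    rw [← noiseLevel_sq, ← sq_abs]
    gcongr
  nlinarith [sq_nonneg (γ - 2 * h)]

section

variable {β₁ β₂ C₀ ε₀ σ₀ σ₁ : ℝ} {γ m v h : ℕ → ℝ}

namespace Admissible

lemma lt_one₁ (H : Admissible β₁ β₂ C₀ ε₀) : β₁ < 1 := H.lt.trans H.lt_one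

lemma pos₂ (H : Admissible β₁ β₂ C₀ ε₀) : 0 < β₂ := H.nonneg₁.trans_lt H.lt

lemma r_pos (H : Admissible β₁ β₂ C₀ ε₀) : 0 < 1 - β₁ / β₂ := by
  rw [sub_pos, div_lt_one H.pos₂]; exact H.lt

lemma sqrt_pos (H : Admissible β₁ β₂ C₀ ε₀) : 0 < √(1 - β₂) :=
  Real.sqrt_pos.2 (sub_pos.2 H.lt_one)

lemma sq_sqrt (H : Admissible β₁ β₂ C₀ ε₀) : √(1 - β₂) ^ 2 = 1 - β₂ :=
  Real.sq_sqrt (sub_pos.2 H.lt_one).le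

end Admissible

lemma denom_succ_pos (H : Admissible β₁ β₂ C₀ ε₀) (n : ℕ) :
    0 < denom (params β₁ β₂ C₀ ε₀) v (n + 1) :=
  add_pos_of_nonneg_of_pos (Real.sqrt_nonneg _) (eps_succ_pos H.pos₂.le H.lt_one H.pos_ε n)

lemma proxyDenom_pos (H : Admissible β₁ β₂ C₀ ε₀) (n : ℕ) :
    0 < proxyDenom (params β₁ β₂ C₀ ε₀) σ₀ σ₁ v h n :=
  add_pos_of_nonneg_of_pos (Real.sqrt_nonneg _) (eps_succ_pos H.pos₂.le H.lt_one H.pos_ε n)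

/-- The term (1-β₂)N² is part of the radicand of the proxy. This one inequality controls both the
exchange of denominators and the conditional variance of the martingale. -/
lemma noise_le_proxyDenom (H : Admissible β₁ β₂ C₀ ε₀) (n : ℕ) (hv : 0 ≤ v n) :
    √(1 - β₂) * noiseLevel σ₀ σ₁ (h n) ≤ proxyDenom (params β₁ β₂ C₀ ε₀) σ₀ σ₁ v h n := by
  have h1 := eps_nonneg (β₁ := β₁) (β₂ := β₂) (C₀ := C₀) H.pos_ε.le (n + 1)
  have h2 : 0 ≤ 1 - β₂ := (sub_pos.2 H.lt_one).le
  have h3 := H.pos₂.le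
  rw [noiseLevel, ← Real.sqrt_mul h2, proxyDenom]
  refine le_trans (Real.sqrt_le_sqrt ?_) (le_add_of_nonneg_right h1)
  simp only [params]
  have h4 : 0 ≤ β₂ * v n := by positivity
  have h5 : (1 - β₂) * (σ₀ ^ 2 + σ₁ ^ 2 * h n ^ 2) ≤
      (1 - β₂) * (σ₀ ^ 2 + (1 + σ₁ ^ 2) * h n ^ 2) := by
    gcongr; linarith
  linarith

/-- The regularisation entering the logarithmic sums. -/
noncomputable def kappa (β₂ ε₀ : ℝ) : ℝ := (ε₀ * √(1 - β₂)) ^ 2 * (1 - β₂)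

lemma kappa_pos (H : Admissible β₁ β₂ C₀ ε₀) : 0 < kappa β₂ ε₀ := by
  have := H.sqrt_pos
  have := H.pos_ε
  have : 0 < 1 - β₂ := sub_pos.2 H.lt_one
  unfold kappa; positivity

/-- From (√v+ε_{n+1})² ≥ v+ε_{n+1}² and 1-β₂^(n+1) ≥ 1-β₂. The logarithmic telescoping needs a
regularisation independent of time. -/
lemma le_denom_sq (H : Admissible β₁ β₂ C₀ ε₀) (n : ℕ) (hv : 0 ≤ v (n + 1)) :
    v (n + 1) + kappa β₂ ε₀ ≤ denom (params β₁ β₂ C₀ ε₀) v (n + 1) ^ 2 := by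
  have h1 := eps_succ_sq_ge (β₁ := β₁) (C₀ := C₀) (ε₀ := ε₀) H.pos₂.le H.lt_one n
  have h2 := eps_nonneg (β₁ := β₁) (β₂ := β₂) (C₀ := C₀) H.pos_ε.le (n + 1)
  have h3 := Real.sq_sqrt hv
  have h4 := mul_nonneg (Real.sqrt_nonneg (v (n + 1))) h2
  unfold denom kappa
  nlinarith

lemma sqrt_mul_denom_le (hM : Moments β₁ β₂ γ m v) (H : Admissible β₁ β₂ C₀ ε₀) (n : ℕ) :
    √β₂ * denom (params β₁ β₂ C₀ ε₀) v n ≤ denom (params β₁ β₂ C₀ ε₀) v (n + 1) := by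
  have h1 := eps_le_eps_succ (β₁ := β₁) (C₀ := C₀) H.pos₂.le H.lt_one H.pos_ε.le n
  have h2 := eps_nonneg (β₁ := β₁) (β₂ := β₂) (C₀ := C₀) H.pos_ε.le n
  have h3 : √β₂ ≤ 1 := Real.sqrt_le_one.2 H.lt_one.le
  have h5 : 0 < 1 - β₂ := sub_pos.2 H.lt_one
  have h4 : √β₂ * √(v n) ≤ √(v (n + 1)) := by
    rw [← Real.sqrt_mul H.pos₂.le, hM.v_succ]
    apply Real.sqrt_le_sqrt
    have : 0 ≤ (1 - β₂) * γ n ^ 2 := by positivity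
    linarith
  unfold denom
  nlinarith

lemma momentum_ratio_sq_le (hM : Moments β₁ β₂ γ m v) (H : Admissible β₁ β₂ C₀ ε₀) (n : ℕ) :
    (m n / denom (params β₁ β₂ C₀ ε₀) v n) ^ 2 ≤
      (1 - β₁) * (1 - β₁ ^ n) / ((1 - β₂) * (1 - β₁ / β₂)) := by
  have h0 : 0 < 1 - β₁ := sub_pos.2 H.lt_one₁
  have h2 : 0 < 1 - β₂ := sub_pos.2 H.lt_one
  have hr := H.r_pos
  rcases n with _ | n
  · simp [hM.m_zero]
  · have hp : β₁ ^ (n + 1) ≤ 1 := pow_le_one₀ H.nonneg₁ H.lt_one₁.le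
    have hb := denom_succ_pos (v := v) H n
    have hv := hM.v_nonneg H.pos₂.le H.lt_one (n + 1)
    have hB := le_denom_sq H n hv
    have hk := kappa_pos H
    rw [div_pow, div_le_div_iff₀ (by positivity) (by positivity)]
    have h1 := hM.m_sq_le_v H.nonneg₁ H.lt H.lt_one (n + 1)
    rw [mul_div_assoc', le_div_iff₀ (by positivity)] at h1
    refine h1.trans (mul_le_mul_of_nonneg_left (by linarith) ?_)
    exact mul_nonneg h0.le (by linarith)

lemma momentum_ratio_sq_le_sqAvg (hM : Moments β₁ β₂ γ m v) (H : Admissible β₁ β₂ C₀ ε₀) (n : ℕ) :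
    (m n / denom (params β₁ β₂ C₀ ε₀) v n) ^ 2 ≤
      (1 - β₁) * (1 - β₁ ^ n) * (sqAvg β₁ γ n / (v n + kappa β₂ ε₀)) := by
  rcases n with _ | n
  · simp [hM.m_zero]
  · have hv := hM.v_nonneg H.pos₂.le H.lt_one (n + 1)
    have hk := kappa_pos H
    have hB := le_denom_sq H n hv
    rw [div_pow, mul_div_assoc']
    have h1 := hM.m_sq_le H.nonneg₁ H.lt_one₁ (n + 1)
    exact div_le_div₀ ((sq_nonneg _).trans h1) h1 (by linarith) hB

/-- The inner product of one coordinate of the gradient with the increment of the auxiliary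
sequence. -/
lemma coordinate_step (hM : Moments β₁ β₂ γ m v) (H : Admissible β₁ β₂ C₀ ε₀) (n : ℕ)
    {k Wm : ℝ} (hk : 0 ≤ k) (hnoise : |γ n - h n| ≤ noiseLevel σ₀ σ₁ (h n)) (hWm : 0 ≤ Wm)
    (hW : σ₀ ^ 2 + (1 + σ₁ ^ 2) * h n ^ 2 ≤ Wm ^ 2) (hv : v n ≤ 2 * Wm ^ 2) :
    let p := params β₁ β₂ C₀ ε₀
    let w := stepSize p
    let b := denom p v
    let a := proxyDenom p σ₀ σ₁ v h n
    let s := √(1 - β₂)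
    h n * (-(w (n + 1) * (γ n / b (n + 1)))
        - k * ((w (n + 1) / b (n + 1) - w n / b n) * m n)) ≤
      -(3 / 8) * (w (n + 1) * (h n ^ 2 / a)) - w (n + 1) * h n / a * (γ n - h n)
      + 8 * (s * noiseLevel σ₀ σ₁ (h n)) * (w (n + 1) * (γ n / b (n + 1)) ^ 2)
      + 4 * k ^ 2 * (s * noiseLevel σ₀ σ₁ (h n)) * (w (n + 1) * (m n / b (n + 1)) ^ 2)
      + k ^ 2 * (s * ((ε₀ + √2 * Wm) / √β₂)) * (w (n + 1) * (m n / b n) ^ 2)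
      + k * (|w (n + 1) - w n| * |m n / b n| * |h n|) := by
  intro p w b a s
  set N := noiseLevel σ₀ σ₁ (h n) with hN
  have hN0 : 0 ≤ N := noiseLevel_nonneg _ _ _
  have hN2 : N ^ 2 = σ₀ ^ 2 + σ₁ ^ 2 * h n ^ 2 := noiseLevel_sq _ _ _
  have hs : 0 ≤ s := Real.sqrt_nonneg _
  have hs2 : s ^ 2 = 1 - β₂ := H.sq_sqrt
  have hw : 0 ≤ w (n + 1) := stepSize_nonneg H.nonneg₁ H.lt_one₁ H.pos_C.le _
  have ha : 0 < a := proxyDenom_pos H n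
  have hb : 0 < b (n + 1) := denom_succ_pos H n
  have hv0 : 0 ≤ v n := hM.v_nonneg H.pos₂.le H.lt_one n
  have haN : s * N ≤ a := noise_le_proxyDenom H n hv0
  have hWe : σ₀ ^ 2 + (1 + σ₁ ^ 2) * h n ^ 2 = N ^ 2 + h n ^ 2 := by rw [hN2]; ring
  have hae : a = √(β₂ * v n + s ^ 2 * (N ^ 2 + h n ^ 2)) + eps p (n + 1) := by
    rw [hs2, ← hWe]; rfl
  have hbe : b (n + 1) = √(β₂ * v n + s ^ 2 * γ n ^ 2) + eps p (n + 1) := by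
    simp only [b, denom, hM.v_succ, hs2]
  have hR : (a - b (n + 1)) ^ 2 ≤ 4 * (s * N) * a := by
    -- Both radicands share β₂v_n, so the denominators differ by at most 2sN, and sN ≤ a trades one
    -- factor for a.
    rw [hae, hbe, add_sub_add_right_eq_sub, ← hae]
    refine (sq_proxy_sub_le (mul_nonneg H.pos₂.le hv0) hN0 hnoise).trans ?_
    nlinarith [mul_nonneg hs hN0]
  -- The Young weights 1/8, 1/4 and 1/4 (the last for the previous denominator) leave 1 - 5/8 = 3/8
  -- of the descent term.
  have hA := mul_sub_inv_le_young (c := 1 / 8) (h := h n) (t := γ n) hw ha hb (by norm_num) hR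
  have hB1 := mul_sub_inv_le_young (c := 1 / 4) (h := h n) (t := k * m n) hw ha hb
    (by norm_num) hR
  -- At n = 0 the denominator b 0 vanishes, but so does the momentum.
  rcases n with _ | n
  · have hm := hM.m_zero
    simp only [hm, mul_zero, sub_zero, zero_div, abs_zero, zero_mul] at hA ⊢
    have hx : 0 ≤ w (0 + 1) * (h 0 ^ 2 / a) := by positivity
    have e1 : h 0 * -(w (0 + 1) * (γ 0 / b (0 + 1))) =
        -(w (0 + 1) * (h 0 ^ 2 / a)) - w (0 + 1) * h 0 / a * (γ 0 - h 0)
        + w (0 + 1) * (h 0 * γ 0 * (1 / a - 1 / b (0 + 1))) := by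
      field_simp; ring
    rw [e1]
    norm_num at hA hx ⊢
    linarith
  · have hb0 : 0 < b (n + 1) := denom_succ_pos H n
    have hR2 : (a - b (n + 1)) ^ 2 ≤ s * ((ε₀ + √2 * Wm) / √β₂) * a := by
      rw [hae]
      exact sq_proxy_sub_prev_le H.pos₂ H.lt_one hs hs2 (by positivity) hv0
        (eps_nonneg H.pos_ε.le _) (eps_le_eps_succ H.pos₂.le H.lt_one H.pos_ε.le _)
        (eps_le H.pos₂.le H.pos_ε.le _) hWm (hWe ▸ hW) hv
    have hB2 := mul_sub_inv_le_young (c := 1 / 4) (h := h (n + 1)) (t := -(k * m (n + 1)))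
      hw ha hb0 (by norm_num) hR2
    have hB3 : k * ((w (n + 1 + 1) - w (n + 1)) * (m (n + 1) / b (n + 1)) * -(h (n + 1))) ≤
        k * (|w (n + 1 + 1) - w (n + 1)| * |m (n + 1) / b (n + 1)| * |h (n + 1)|) := by
      refine mul_le_mul_of_nonneg_left ?_ hk
      rw [← abs_neg (h (n + 1)), ← abs_mul, ← abs_mul]
      exact le_abs_self _
    -- Both 1/b_{n+1} and 1/b_n are compared with 1/a; the change of step size at the fixed old
    -- denominator is split off.
    have e1 : h (n + 1) * (-(w (n + 1 + 1) * (γ (n + 1) / b (n + 1 + 1)))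
        - k * ((w (n + 1 + 1) / b (n + 1 + 1) - w (n + 1) / b (n + 1)) * m (n + 1))) =
        -(w (n + 1 + 1) * (h (n + 1) ^ 2 / a))
        - w (n + 1 + 1) * h (n + 1) / a * (γ (n + 1) - h (n + 1))
        + w (n + 1 + 1) * (h (n + 1) * γ (n + 1) * (1 / a - 1 / b (n + 1 + 1)))
        + w (n + 1 + 1) * (h (n + 1) * (k * m (n + 1)) * (1 / a - 1 / b (n + 1 + 1)))
        + w (n + 1 + 1) * (h (n + 1) * (-(k * m (n + 1))) * (1 / a - 1 / b (n + 1)))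
        + k * ((w (n + 1 + 1) - w (n + 1)) * (m (n + 1) / b (n + 1)) * -(h (n + 1))) := by
      field_simp; ring
    rw [e1]
    have e2 : (-(k * m (n + 1)) / b (n + 1)) ^ 2 = k ^ 2 * (m (n + 1) / b (n + 1)) ^ 2 := by
      ring
    have e3 : (k * m (n + 1) / b (n + 1 + 1)) ^ 2 = k ^ 2 * (m (n + 1) / b (n + 1 + 1)) ^ 2 := by
      ring
    rw [e2] at hB2
    rw [e3] at hB1
    rw [show 4 * (s * N) / (4 * (1 / 8)) = 8 * (s * N) by ring] at hA
    rw [show 4 * (s * N) / (4 * (1 / 4)) = 4 * (s * N) by ring] at hB1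
    rw [show 4 * (1 / 4 : ℝ) = 1 by norm_num, div_one] at hB2
    linarith

end

end Adam

/-! ### Summation of the one-coordinate estimates over the iterations -/

namespace Adam

section

variable {β₁ β₂ C₀ ε₀ σ₀ σ₁ Λ : ℝ} {γ m v h : ℕ → ℝ}

lemma sum_sq_div_le (hM : Moments β₁ β₂ γ m v) (H : Admissible β₁ β₂ C₀ ε₀) (t : ℕ)
    (hΛ : Real.log ((v t + kappa β₂ ε₀) / kappa β₂ ε₀) - t * Real.log β₂ ≤ Λ) :
    ∑ n ∈ Finset.range t, γ n ^ 2 / (v (n + 1) + kappa β₂ ε₀) ≤ Λ / (1 - β₂) := by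
  rw [le_div_iff₀' (sub_pos.2 H.lt_one)]
  exact (hM.sum_sq_div_le_log H.pos₂ H.lt_one (kappa_pos H) t).trans hΛ

lemma sum_sqAvg_div_le (hM : Moments β₁ β₂ γ m v) (H : Admissible β₁ β₂ C₀ ε₀) (t : ℕ)
    (hΛ : Real.log ((v t + kappa β₂ ε₀) / kappa β₂ ε₀) - t * Real.log β₂ ≤ Λ) :
    ∑ n ∈ Finset.range t, sqAvg β₁ γ n / (v n + kappa β₂ ε₀)
      ≤ Λ / (1 - β₂) / (1 - β₁ / β₂) := by
  rw [le_div_iff₀' H.r_pos]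
  refine le_trans ?_ (sum_sq_div_le hM H t hΛ)
  refine le_trans ?_ (hM.sum_sqAvg_div_le H.nonneg₁ H.lt H.lt_one (kappa_pos H) t)
  refine mul_le_mul_of_nonneg_left ?_ H.r_pos.le
  rw [Finset.sum_range_succ]
  exact le_add_of_nonneg_right (div_nonneg (sqAvg_nonneg H.nonneg₁ γ t)
    (add_nonneg (hM.v_nonneg H.pos₂.le H.lt_one t) (kappa_pos H).le))

lemma gradient_ratio_sq_le (hM : Moments β₁ β₂ γ m v) (H : Admissible β₁ β₂ C₀ ε₀) (n : ℕ) :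
    (γ n / denom (params β₁ β₂ C₀ ε₀) v (n + 1)) ^ 2 ≤
      γ n ^ 2 / (v (n + 1) + kappa β₂ ε₀) := by
  have hv := hM.v_nonneg H.pos₂.le H.lt_one (n + 1)
  rw [div_pow]
  exact div_le_div_of_nonneg_left (sq_nonneg _) (add_pos_of_nonneg_of_pos hv (kappa_pos H))
    (le_denom_sq H n hv)

lemma sum_sq_gradient_term_le (hM : Moments β₁ β₂ γ m v) (H : Admissible β₁ β₂ C₀ ε₀) (t : ℕ)
    (hΛ : Real.log ((v t + kappa β₂ ε₀) / kappa β₂ ε₀) - t * Real.log β₂ ≤ Λ) :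
    let p := params β₁ β₂ C₀ ε₀
    ∑ n ∈ Finset.range t, (stepSize p (n + 1) * (γ n / denom p v (n + 1))) ^ 2
      ≤ C₀ ^ 2 / (1 - β₁) ^ 2 * Λ := by
  intro p
  have h0 : 0 < 1 - β₁ := sub_pos.2 H.lt_one₁
  have h2 : 0 < 1 - β₂ := sub_pos.2 H.lt_one
  calc _ ≤ ∑ n ∈ Finset.range t, (C₀ * √(1 - β₂) / (1 - β₁)) ^ 2 *
        (γ n ^ 2 / (v (n + 1) + kappa β₂ ε₀)) := by
        refine Finset.sum_le_sum fun n _ => ?_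
        rw [mul_pow]
        gcongr
        · exact stepSize_nonneg H.nonneg₁ H.lt_one₁ H.pos_C.le _
        · exact stepSize_succ_le H.nonneg₁ H.lt_one₁ H.pos₂.le H.pos_C.le n
        · exact gradient_ratio_sq_le hM H n
    _ ≤ (C₀ * √(1 - β₂) / (1 - β₁)) ^ 2 * (Λ / (1 - β₂)) := by
        rw [← Finset.mul_sum]
        gcongr
        exact sum_sq_div_le hM H t hΛ
    _ = _ := by
        rw [div_pow, mul_pow, H.sq_sqrt]; field_simp

/-- The prefactor √(1-β₂) comes from the noise errors; with the √(1-β₂) in the step size it cancels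
the 1/(1-β₂) of the logarithmic sum. -/
lemma sum_gradient_term_le (hM : Moments β₁ β₂ γ m v) (H : Admissible β₁ β₂ C₀ ε₀) (t : ℕ)
    (hΛ : Real.log ((v t + kappa β₂ ε₀) / kappa β₂ ε₀) - t * Real.log β₂ ≤ Λ) :
    let p := params β₁ β₂ C₀ ε₀
    √(1 - β₂) * ∑ n ∈ Finset.range t, stepSize p (n + 1) * (γ n / denom p v (n + 1)) ^ 2
      ≤ C₀ / (1 - β₁) * Λ := by
  intro p
  have h0 : 0 < 1 - β₁ := sub_pos.2 H.lt_one₁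
  have h2 : 0 < 1 - β₂ := sub_pos.2 H.lt_one
  have hC := H.pos_C
  calc _ ≤ √(1 - β₂) * ∑ n ∈ Finset.range t, (C₀ * √(1 - β₂) / (1 - β₁)) *
        (γ n ^ 2 / (v (n + 1) + kappa β₂ ε₀)) := by
        gcongr with n _
        · exact stepSize_succ_le H.nonneg₁ H.lt_one₁ H.pos₂.le H.pos_C.le n
        · exact gradient_ratio_sq_le hM H n
    _ ≤ √(1 - β₂) * ((C₀ * √(1 - β₂) / (1 - β₁)) * (Λ / (1 - β₂))) := by
        rw [← Finset.mul_sum]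
        gcongr
        exact sum_sq_div_le hM H t hΛ
    _ = √(1 - β₂) ^ 2 * (C₀ / (1 - β₁)) * (Λ / (1 - β₂)) := by ring
    _ = _ := by
        rw [H.sq_sqrt]; field_simp

lemma sum_sq_move_le (hM : Moments β₁ β₂ γ m v) (H : Admissible β₁ β₂ C₀ ε₀) (t : ℕ)
    (hΛ : Real.log ((v t + kappa β₂ ε₀) / kappa β₂ ε₀) - t * Real.log β₂ ≤ Λ) :
    let p := params β₁ β₂ C₀ ε₀
    ∑ n ∈ Finset.range t, (stepSize p n * (m n / denom p v n)) ^ 2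
      ≤ C₀ ^ 2 / (1 - β₁ / β₂) * Λ := by
  intro p
  have h2 : 0 < 1 - β₂ := sub_pos.2 H.lt_one
  have hr := H.r_pos
  calc _ ≤ ∑ n ∈ Finset.range t, (C₀ ^ 2 * (1 - β₂)) *
        (sqAvg β₁ γ n / (v n + kappa β₂ ε₀)) := by
        refine Finset.sum_le_sum fun n _ => ?_
        rw [mul_pow]
        have hq : 0 ≤ sqAvg β₁ γ n / (v n + kappa β₂ ε₀) :=
          div_nonneg (sqAvg_nonneg H.nonneg₁ γ n)
            (add_nonneg (hM.v_nonneg H.pos₂.le H.lt_one n) (kappa_pos H).le)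
        calc _ ≤ stepSize p n ^ 2 *
              ((1 - β₁) * (1 - β₁ ^ n) * (sqAvg β₁ γ n / (v n + kappa β₂ ε₀))) :=
              mul_le_mul_of_nonneg_left (momentum_ratio_sq_le_sqAvg hM H n) (sq_nonneg _)
          _ = (stepSize p n ^ 2 * ((1 - β₁) * (1 - β₁ ^ n))) *
              (sqAvg β₁ γ n / (v n + kappa β₂ ε₀)) := by ring
          _ ≤ _ := mul_le_mul_of_nonneg_right
              (stepSize_sq_mul_le H.nonneg₁ H.lt_one₁ H.pos₂.le H.lt_one n) hq
    _ ≤ (C₀ ^ 2 * (1 - β₂)) * (Λ / (1 - β₂) / (1 - β₁ / β₂)) := by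
        rw [← Finset.mul_sum]
        gcongr
        exact sum_sqAvg_div_le hM H t hΛ
    _ = _ := by field_simp

lemma sum_momentum_term_le (hM : Moments β₁ β₂ γ m v) (H : Admissible β₁ β₂ C₀ ε₀) (t : ℕ)
    (hΛ : Real.log ((v t + kappa β₂ ε₀) / kappa β₂ ε₀) - t * Real.log β₂ ≤ Λ) :
    let p := params β₁ β₂ C₀ ε₀
    √(1 - β₂) * ∑ n ∈ Finset.range t, stepSize p (n + 1) * (m n / denom p v n) ^ 2
      ≤ C₀ / (1 - β₁ / β₂) * Λ := by
  intro p
  have h2 : 0 < 1 - β₂ := sub_pos.2 H.lt_one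
  have hr := H.r_pos
  have hC := H.pos_C
  calc _ ≤ √(1 - β₂) * ∑ n ∈ Finset.range t, (C₀ * √(1 - β₂)) *
        (sqAvg β₁ γ n / (v n + kappa β₂ ε₀)) := by
        refine mul_le_mul_of_nonneg_left (Finset.sum_le_sum fun n _ => ?_) (Real.sqrt_nonneg _)
        have hq : 0 ≤ sqAvg β₁ γ n / (v n + kappa β₂ ε₀) :=
          div_nonneg (sqAvg_nonneg H.nonneg₁ γ n)
            (add_nonneg (hM.v_nonneg H.pos₂.le H.lt_one n) (kappa_pos H).le)
        calc _ ≤ stepSize p (n + 1) *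
              ((1 - β₁) * (1 - β₁ ^ n) * (sqAvg β₁ γ n / (v n + kappa β₂ ε₀))) :=
              mul_le_mul_of_nonneg_left (momentum_ratio_sq_le_sqAvg hM H n)
                (stepSize_nonneg H.nonneg₁ H.lt_one₁ H.pos_C.le _)
          _ = (stepSize p (n + 1) * ((1 - β₁) * (1 - β₁ ^ n))) *
              (sqAvg β₁ γ n / (v n + kappa β₂ ε₀)) := by ring
          _ ≤ _ := mul_le_mul_of_nonneg_right
              (stepSize_succ_mul_le H.nonneg₁ H.lt_one₁ H.pos₂.le H.pos_C.le n) hq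
    _ ≤ √(1 - β₂) * ((C₀ * √(1 - β₂)) * (Λ / (1 - β₂) / (1 - β₁ / β₂))) := by
        rw [← Finset.mul_sum]
        gcongr
        exact sum_sqAvg_div_le hM H t hΛ
    _ = √(1 - β₂) ^ 2 * C₀ * (Λ / (1 - β₂) / (1 - β₁ / β₂)) := by ring
    _ = _ := by rw [H.sq_sqrt]; field_simp

/-- The squared denominator loses at most a factor β₂ per iteration, so the shifted index costs
1/β₂. -/
lemma sum_shifted_momentum_term_le (hM : Moments β₁ β₂ γ m v) (H : Admissible β₁ β₂ C₀ ε₀) (t : ℕ)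
    (hΛ : Real.log ((v t + kappa β₂ ε₀) / kappa β₂ ε₀) - t * Real.log β₂ ≤ Λ) :
    let p := params β₁ β₂ C₀ ε₀
    √(1 - β₂) * ∑ n ∈ Finset.range t, stepSize p (n + 1) * (m n / denom p v (n + 1)) ^ 2
      ≤ C₀ / (1 - β₁ / β₂) * Λ / β₂ := by
  intro p
  have hb := H.pos₂
  rw [le_div_iff₀' hb]
  refine le_trans ?_ (sum_momentum_term_le hM H t hΛ)
  rw [mul_left_comm, Finset.mul_sum]
  refine mul_le_mul_of_nonneg_left (Finset.sum_le_sum fun n _ => ?_) (Real.sqrt_nonneg _)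
  rw [mul_left_comm]
  refine mul_le_mul_of_nonneg_left ?_ (stepSize_nonneg H.nonneg₁ H.lt_one₁ H.pos_C.le _)
  rcases n with _ | n
  · simp [hM.m_zero]
  · have h1 := denom_succ_pos (v := v) H n
    have h2 := denom_succ_pos (v := v) H (n + 1)
    have h3 := sqrt_mul_denom_le hM H (n + 1)
    rw [div_pow, div_pow, mul_div_assoc', div_le_div_iff₀ (by positivity) (by positivity)]
    have h4 : (√β₂ * denom (params β₁ β₂ C₀ ε₀) v (n + 1)) ^ 2 ≤
      denom (params β₁ β₂ C₀ ε₀) v (n + 1 + 1) ^ 2 := by gcongr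
    rw [mul_pow, Real.sq_sqrt hb.le] at h4
    have := mul_le_mul_of_nonneg_left h4 (sq_nonneg (m (n + 1)))
    simp only [p]
    linarith

/-- The ratio m/b is uniformly of order (1-β₂)^(-1/2), which cancels the √(1-β₂) in the total
variation of the step sizes. The index 0 drops out since m_0 = 0. -/
lemma sum_stepSize_change_le (hM : Moments β₁ β₂ γ m v) (H : Admissible β₁ β₂ C₀ ε₀) (t : ℕ)
    {G : ℝ} (hh : ∀ n < t, h n ^ 2 ≤ G) :
    let p := params β₁ β₂ C₀ ε₀
    ∑ n ∈ Finset.range t, |stepSize p (n + 1) - stepSize p n| * |m n / denom p v n| * |h n|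
      ≤ 2 * C₀ / (1 - β₁) * √((1 - β₁) / (1 - β₁ / β₂)) * √G := by
  intro p
  have h0 : 0 < 1 - β₁ := sub_pos.2 H.lt_one₁
  have h2 : 0 < 1 - β₂ := sub_pos.2 H.lt_one
  have hr := H.r_pos
  have hC := H.pos_C
  set R := √((1 - β₁) / ((1 - β₂) * (1 - β₁ / β₂))) with hR
  have hRm : ∀ n, |m n / denom p v n| ≤ R := fun n => by
    rw [hR]
    refine Real.abs_le_sqrt ((momentum_ratio_sq_le hM H n).trans ?_)
    gcongr
    have : 0 ≤ β₁ ^ n := pow_nonneg H.nonneg₁ n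
    exact mul_le_of_le_one_right h0.le (by linarith)
  rcases t with _ | t
  · simp; positivity
  rw [Finset.sum_range_succ']
  simp only [hM.m_zero, zero_div, abs_zero, mul_zero, zero_mul, add_zero]
  calc _ ≤ ∑ n ∈ Finset.range t, |stepSize p (n + 2) - stepSize p (n + 1)| * (R * √G) := by
        refine Finset.sum_le_sum fun n hn => ?_
        rw [mul_assoc]
        have := Real.abs_le_sqrt (hh (n + 1) (by simpa using hn))
        have := hRm (n + 1)
        gcongr
    _ ≤ 2 * (C₀ * √(1 - β₂) / (1 - β₁)) * (R * √G) := by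
        rw [← Finset.sum_mul]
        gcongr
        exact sum_abs_stepSize_sub_le H.nonneg₁ H.lt_one₁ H.pos₂.le H.lt_one H.pos_C.le t
    _ = 2 * C₀ / (1 - β₁) * (√(1 - β₂) * R) * √G := by ring
    _ = _ := by
        rw [hR, ← Real.sqrt_mul h2.le]
        congr 3
        field_simp

/-- The accumulated inner products of one coordinate, on the event that the gradients stay
bounded and the martingale term is controlled. -/
theorem coordinate_sum (hM : Moments β₁ β₂ γ m v) (H : Admissible β₁ β₂ C₀ ε₀) (t : ℕ)
    (hΛ : Real.log ((v t + kappa β₂ ε₀) / kappa β₂ ε₀) - t * Real.log β₂ ≤ Λ)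
    {k G S₀ S₁ c : ℝ} (hk : 0 ≤ k) (hh : ∀ n < t, h n ^ 2 ≤ G)
    (h₀ : 0 ≤ σ₀) (h₁ : 0 ≤ σ₁) (h₀' : σ₀ ≤ S₀) (h₁' : σ₁ ≤ S₁)
    (hnoise : ∀ n < t, |γ n - h n| ≤ noiseLevel σ₀ σ₁ (h n))
    (hmart : ∑ n ∈ Finset.range t, -(stepSize (params β₁ β₂ C₀ ε₀) (n + 1) * h n /
        proxyDenom (params β₁ β₂ C₀ ε₀) σ₀ σ₁ v h n * (γ n - h n)) ≤
      1 / 12 * ∑ n ∈ Finset.range t, stepSize (params β₁ β₂ C₀ ε₀) (n + 1) * (h n ^ 2 /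
        proxyDenom (params β₁ β₂ C₀ ε₀) σ₀ σ₁ v h n) + c) :
    let p := params β₁ β₂ C₀ ε₀
    let w := stepSize p
    let b := denom p v
    let r := 1 - β₁ / β₂
    let S := S₀ + S₁ * √G
    let K := (ε₀ + √2 * (S₀ + √(1 + S₁ ^ 2) * √G)) / √β₂
    ∑ n ∈ Finset.range t, h n * (-(w (n + 1) * (γ n / b (n + 1)))
        - k * ((w (n + 1) / b (n + 1) - w n / b n) * m n)) ≤
      -(7 / 24) * (∑ n ∈ Finset.range t, w (n + 1) * (h n ^ 2 / proxyDenom p σ₀ σ₁ v h n))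
      + c + 8 * S * (C₀ / (1 - β₁) * Λ) + 4 * k ^ 2 * S * (C₀ / r * Λ / β₂)
      + k ^ 2 * K * (C₀ / r * Λ)
      + k * (2 * C₀ / (1 - β₁) * √((1 - β₁) / r) * √G) := by
  intro p w b r S K
  have hS₀ : 0 ≤ S₀ := h₀.trans h₀'
  have hS₁ : 0 ≤ S₁ := h₁.trans h₁'
  set Wm := S₀ + √(1 + S₁ ^ 2) * √G with hWm
  have hWm0 : 0 ≤ Wm := by positivity
  have hε := H.pos_ε
  have hw : ∀ n, 0 ≤ w n := fun n => stepSize_nonneg H.nonneg₁ H.lt_one₁ H.pos_C.le n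
  have hW : ∀ n < t, σ₀ ^ 2 + (1 + σ₁ ^ 2) * h n ^ 2 ≤ Wm ^ 2 := fun n hn =>
    second_moment_le h₀ h₁ h₀' h₁' (hh n hn)
  have hγ : ∀ n < t, γ n ^ 2 ≤ 2 * Wm ^ 2 := fun n hn =>
    (sq_le_of_noise (hnoise n hn)).trans (by linarith [hW n hn])
  -- `v n` is a subconvex combination of the earlier squared gradients.
  have hv : ∀ n < t, v n ≤ 2 * Wm ^ 2 := fun n hn =>
    hM.v_le H.pos₂.le H.lt_one (by positivity) n fun j hj => hγ j (hj.trans hn)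
  have hN : ∀ n < t, noiseLevel σ₀ σ₁ (h n) ≤ S := fun n hn =>
    noiseLevel_le h₀ h₁ h₀' h₁' (hh n hn)
  have hS : 0 ≤ S := by positivity
  have hK : 0 ≤ K := by positivity
  have hs : 0 ≤ √(1 - β₂) := Real.sqrt_nonneg _
  have step : ∀ n ∈ Finset.range t, h n * (-(w (n + 1) * (γ n / b (n + 1)))
        - k * ((w (n + 1) / b (n + 1) - w n / b n) * m n)) ≤
      -(3 / 8) * (w (n + 1) * (h n ^ 2 / proxyDenom p σ₀ σ₁ v h n))
      + -(w (n + 1) * h n / proxyDenom p σ₀ σ₁ v h n * (γ n - h n))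
      + 8 * S * (√(1 - β₂) * (w (n + 1) * (γ n / b (n + 1)) ^ 2))
      + 4 * k ^ 2 * S * (√(1 - β₂) * (w (n + 1) * (m n / b (n + 1)) ^ 2))
      + k ^ 2 * K * (√(1 - β₂) * (w (n + 1) * (m n / b n) ^ 2))
      + k * (|w (n + 1) - w n| * |m n / b n| * |h n|) := fun n hn => by
    rw [Finset.mem_range] at hn
    have := coordinate_step hM H n hk (hnoise n hn) hWm0 (hW n hn) (hv n hn)
    have i1 : 8 * (√(1 - β₂) * noiseLevel σ₀ σ₁ (h n)) * (w (n + 1) * (γ n / b (n + 1)) ^ 2) ≤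
        8 * (√(1 - β₂) * S) * (w (n + 1) * (γ n / b (n + 1)) ^ 2) := by
      have := hN n hn
      have := hw (n + 1)
      gcongr
    have i2 : 4 * k ^ 2 * (√(1 - β₂) * noiseLevel σ₀ σ₁ (h n)) *
        (w (n + 1) * (m n / b (n + 1)) ^ 2) ≤
        4 * k ^ 2 * (√(1 - β₂) * S) * (w (n + 1) * (m n / b (n + 1)) ^ 2) := by
      have := hN n hn
      have := hw (n + 1)
      gcongr
    refine this.trans ?_
    simp only [p, w, b, K] at i1 i2 ⊢
    linarith
  refine (Finset.sum_le_sum step).trans ?_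
  simp only [Finset.sum_add_distrib, ← Finset.mul_sum]
  -- The martingale uses 1/12 of the descent term, leaving 3/8 - 1/12 = 7/24.
  have j1 := mul_le_mul_of_nonneg_left (sum_gradient_term_le hM H t hΛ)
    (show 0 ≤ 8 * S by positivity)
  have j2 := mul_le_mul_of_nonneg_left (sum_shifted_momentum_term_le hM H t hΛ)
    (show 0 ≤ 4 * k ^ 2 * S by positivity)
  have j3 := mul_le_mul_of_nonneg_left (sum_momentum_term_le hM H t hΛ)
    (show 0 ≤ k ^ 2 * K by positivity)
  have j4 := mul_le_mul_of_nonneg_left (sum_stepSize_change_le (h := h) hM H t hh) hk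
  simp only [p, w, b, r] at j1 j2 j3 j4 hmart ⊢
  linarith

end

end Adam

namespace Adam

section

variable {d : ℕ} {Z : Type*} {f : EuclideanSpace ℝ (Fin d) → ℝ} {L fstar : ℝ}
  {g : EuclideanSpace ℝ (Fin d) → Z → EuclideanSpace ℝ (Fin d)} {σ₀ σ₁ : Fin d → ℝ}
  {x₁ : EuclideanSpace ℝ (Fin d)} {β₁ β₂ C₀ ε₀ δ : ℝ} {z : ℕ → Z}

/-! ### The trajectory -/

lemma moments_state (β₁ β₂ C₀ ε₀ : ℝ) (i : Fin d) :
    let p := params β₁ β₂ C₀ ε₀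
    Moments β₁ β₂ (fun n => g (state p g x₁ z n).x (z (n + 1)) i)
      (fun n => (state p g x₁ z n).m i) (fun n => (state p g x₁ z n).v i) where
  m_zero := rfl
  v_zero := rfl
  m_succ _ := rfl
  v_succ _ := rfl

/-- Coordinate `i` of the displacement `x_n - x_{n+1}` of iteration `n`. -/
noncomputable def move (p : Params) (g : EuclideanSpace ℝ (Fin d) → Z → EuclideanSpace ℝ (Fin d))
    (x₁ : EuclideanSpace ℝ (Fin d)) (z : ℕ → Z) (n : ℕ) (i : Fin d) : ℝ :=
  stepSize p n * ((state p g x₁ z n).m i / denom p (fun n => (state p g x₁ z n).v i) n)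

lemma state_succ_x (p : Params) (n : ℕ) (i : Fin d) :
    (state p g x₁ z (n + 1)).x i = (state p g x₁ z n).x i - move p g x₁ z (n + 1) i := by
  change (state p g x₁ z n).x i - stepSize p (n + 1) / _ * _ = _
  unfold move
  rw [div_mul_eq_mul_div, mul_div_assoc]
  rfl

lemma move_sq_le (H : Admissible β₁ β₂ C₀ ε₀) (n : ℕ) (i : Fin d) :
    move (params β₁ β₂ C₀ ε₀) g x₁ z n i ^ 2 ≤ C₀ ^ 2 / (1 - β₁ / β₂) := by
  have h1 := momentum_ratio_sq_le (moments_state (g := g) (x₁ := x₁) (z := z)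
    β₁ β₂ C₀ ε₀ i) H n
  have h2 := stepSize_sq_mul_le (C₀ := C₀) (ε₀ := ε₀) H.nonneg₁ H.lt_one₁ H.pos₂.le H.lt_one n
  have hr := H.r_pos
  have hs : 0 < 1 - β₂ := sub_pos.2 H.lt_one
  rw [move, mul_pow]
  refine (mul_le_mul_of_nonneg_left h1 (sq_nonneg _)).trans ?_
  rw [mul_div_assoc', div_le_div_iff₀ (by positivity) hr]
  calc _ ≤ C₀ ^ 2 * (1 - β₂) * (1 - β₁ / β₂) := mul_le_mul_of_nonneg_right h2 hr.le
    _ = _ := by ring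

/-- Each displacement is bounded uniformly and without any event. This crude drift is enough because
it enters only through a logarithm. -/
lemma norm_state_sub_le (H : Admissible β₁ β₂ C₀ ε₀) (n : ℕ) :
    ‖(state (params β₁ β₂ C₀ ε₀) g x₁ z n).x - x₁‖
      ≤ n * √(d * (C₀ ^ 2 / (1 - β₁ / β₂))) := by
  induction n with
  | zero => simp [state]
  | succ n ih =>
    set p := params β₁ β₂ C₀ ε₀
    have h1 : ‖(state p g x₁ z (n + 1)).x - (state p g x₁ z n).x‖
        ≤ √(d * (C₀ ^ 2 / (1 - β₁ / β₂))) := by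
      rw [EuclideanSpace.norm_eq]
      apply Real.sqrt_le_sqrt
      calc _ ≤ ∑ _i : Fin d, C₀ ^ 2 / (1 - β₁ / β₂) := by
            refine Finset.sum_le_sum fun i _ => ?_
            rw [PiLp.sub_apply, state_succ_x, sub_sub_cancel_left, norm_neg, Real.norm_eq_abs,
              sq_abs]
            exact move_sq_le H (n + 1) i
        _ = _ := by simp
    have h2 := norm_add_le ((state p g x₁ z (n + 1)).x - (state p g x₁ z n).x)
      ((state p g x₁ z n).x - x₁)
    rw [sub_add_sub_cancel] at h2
    push_cast
    linarith

lemma one_le_polyF (H : Admissible β₁ β₂ C₀ ε₀) (T : ℕ) :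
    1 ≤ polyF f L σ₀ σ₁ x₁ β₁ β₂ C₀ ε₀ T := by
  have := H.r_pos
  unfold polyF
  rw [le_add_iff_nonneg_right]
  positivity

lemma abs_apply_le_norm (x : EuclideanSpace ℝ (Fin d)) (i : Fin d) : |x i| ≤ ‖x‖ := by
  simpa using PiLp.norm_apply_le x i

lemma sq_apply_le_sq_norm (x : EuclideanSpace ℝ (Fin d)) (i : Fin d) : x i ^ 2 ≤ ‖x‖ ^ 2 := by
  rw [← sq_abs]
  have := abs_apply_le_norm x i
  gcongr

/-- The logarithmic potential never exceeds `Λ`. -/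
lemma log_potential_le (H : Admissible β₁ β₂ C₀ ε₀) (hL : 0 ≤ L) (hf : LSmooth f L)
    (hσ₀ : ∀ i, 0 ≤ σ₀ i) (hσ₁ : ∀ i, 0 ≤ σ₁ i) {T t : ℕ} (htT : t ≤ T) (i : Fin d)
    (hnoise : ∀ n < t, |g (state (params β₁ β₂ C₀ ε₀) g x₁ z n).x (z (n + 1)) i
        - gradient f (state (params β₁ β₂ C₀ ε₀) g x₁ z n).x i| ≤
      noiseLevel (σ₀ i) (σ₁ i) (gradient f (state (params β₁ β₂ C₀ ε₀) g x₁ z n).x i)) :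
    Real.log (((state (params β₁ β₂ C₀ ε₀) g x₁ z t).v i + kappa β₂ ε₀) / kappa β₂ ε₀)
        - t * Real.log β₂
      ≤ Real.log (polyF f L σ₀ σ₁ x₁ β₁ β₂ C₀ ε₀ T / β₂ ^ T) := by
  set p := params β₁ β₂ C₀ ε₀ with hp
  have hM := moments_state (g := g) (x₁ := x₁) (z := z) β₁ β₂ C₀ ε₀ i
  have hr := H.r_pos
  have hs : 0 < 1 - β₂ := sub_pos.2 H.lt_one
  have hκ := kappa_pos H
  have hsq := H.sqrt_pos
  have hε := H.pos_ε
  have hv := hM.v_nonneg H.pos₂.le H.lt_one t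
  have hF1 := one_le_polyF (f := f) (L := L) (σ₀ := σ₀) (σ₁ := σ₁) (x₁ := x₁) H T
  have hb := H.pos₂
  have hlogβ : Real.log β₂ ≤ 0 := Real.log_nonpos H.pos₂.le H.lt_one.le
  have h0i : σ₀ i ≤ ‖σ₀‖ := (le_abs_self _).trans (norm_le_pi_norm σ₀ i)
  have h1i : σ₁ i ≤ ‖σ₁‖ := (le_abs_self _).trans (norm_le_pi_norm σ₁ i)
  have hgrad : ∀ n < t, g (state p g x₁ z n).x (z (n + 1)) i ^ 2 ≤
      2 * (‖σ₀‖ ^ 2 + (1 + ‖σ₁‖ ^ 2) *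
        (2 * ‖gradient f x₁‖ ^ 2 + 2 * (L ^ 2 * (T ^ 2 * (d * (C₀ ^ 2 / (1 - β₁ / β₂))))))) := by
    intro n hn
    refine (sq_le_of_noise (hnoise n hn)).trans ?_
    have a0 := hσ₀ i
    have a1 := hσ₁ i
    have hgn : gradient f (state p g x₁ z n).x i ^ 2 ≤ 2 * ‖gradient f x₁‖ ^ 2 +
        2 * (L ^ 2 * (T ^ 2 * (d * (C₀ ^ 2 / (1 - β₁ / β₂))))) := by
      refine (sq_apply_le_sq_norm _ i).trans ?_
      have b1 := hf.gradient_lipschitz (state p g x₁ z n).x x₁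
      have b2 := norm_state_sub_le (g := g) (x₁ := x₁) (z := z) H n
      have b3 : ‖gradient f (state p g x₁ z n).x - gradient f x₁‖ ^ 2 ≤
          L ^ 2 * (T ^ 2 * (d * (C₀ ^ 2 / (1 - β₁ / β₂)))) := by
        have hnT : (n : ℝ) ≤ T := by exact_mod_cast (hn.le.trans htT)
        calc _ ≤ (L * (T * √(d * (C₀ ^ 2 / (1 - β₁ / β₂))))) ^ 2 := by
              gcongr
              exact b1.trans (mul_le_mul_of_nonneg_left
                (b2.trans (by gcongr)) hL)
          _ = _ := by rw [mul_pow, mul_pow, Real.sq_sqrt (by positivity)]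
      have b4 := norm_add_le (gradient f (state p g x₁ z n).x - gradient f x₁) (gradient f x₁)
      rw [sub_add_cancel] at b4
      have b5 : ‖gradient f (state p g x₁ z n).x‖ ^ 2 ≤
        (‖gradient f (state p g x₁ z n).x - gradient f x₁‖ + ‖gradient f x₁‖) ^ 2 := by gcongr
      nlinarith [sq_nonneg (‖gradient f (state p g x₁ z n).x - gradient f x₁‖
        - ‖gradient f x₁‖)]
    gcongr
  have hsum : ∑ n ∈ Finset.range t, g (state p g x₁ z n).x (z (n + 1)) i ^ 2 ≤
      T * (2 * (‖σ₀‖ ^ 2 + (1 + ‖σ₁‖ ^ 2) *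
        (2 * ‖gradient f x₁‖ ^ 2 +
          2 * (L ^ 2 * (T ^ 2 * (d * (C₀ ^ 2 / (1 - β₁ / β₂)))))))) := by
    refine (Finset.sum_le_sum fun n hn => hgrad n (Finset.mem_range.1 hn)).trans ?_
    rw [Finset.sum_const, Finset.card_range, nsmul_eq_mul]
    gcongr
  -- The factor 1-β₂ in κ cancels the one in `v_le_sum`, leaving the plain sum of squares over ε²,
  -- which is of order T³.
  have hvF : ((state p g x₁ z t).v i + kappa β₂ ε₀) / kappa β₂ ε₀ ≤
      polyF f L σ₀ σ₁ x₁ β₁ β₂ C₀ ε₀ T := by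
    have h1 := hM.v_le_sum H.pos₂.le H.lt_one t
    have h2 : (state p g x₁ z t).v i / kappa β₂ ε₀ ≤
        (∑ n ∈ Finset.range t, g (state p g x₁ z n).x (z (n + 1)) i ^ 2)
          / (ε₀ * √(1 - β₂)) ^ 2 := by
      rw [div_le_div_iff₀ hκ (by positivity)]
      unfold kappa
      have := mul_le_mul_of_nonneg_right h1 (sq_nonneg (ε₀ * √(1 - β₂)))
      calc _ ≤ _ := this
        _ = _ := by ring
    rw [add_div, div_self hκ.ne', add_comm]
    unfold polyF
    refine add_le_add_right (h2.trans ?_) 1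
    rw [div_mul_eq_mul_div]
    refine div_le_div_of_nonneg_right (hsum.trans (le_of_eq ?_)) (by positivity)
    ring
  rw [Real.log_div (x := polyF f L σ₀ σ₁ x₁ β₁ β₂ C₀ ε₀ T) (by positivity) (by positivity),
    Real.log_pow]
  have h3 : Real.log (((state p g x₁ z t).v i + kappa β₂ ε₀) / kappa β₂ ε₀) ≤
      Real.log (polyF f L σ₀ σ₁ x₁ β₁ β₂ C₀ ε₀ T) :=
    Real.log_le_log (by positivity) hvF
  have h4 : (T : ℝ) * Real.log β₂ ≤ t * Real.log β₂ :=
    mul_le_mul_of_nonpos_right (by exact_mod_cast htT) hlogβ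
  linarith

/-! ### The auxiliary sequence -/

/-- The auxiliary sequence `y_n = x_n + β₁ / (1 - β₁) (x_n - x_{n-1})`. -/
noncomputable def aux (p : Params) (g : EuclideanSpace ℝ (Fin d) → Z → EuclideanSpace ℝ (Fin d))
    (x₁ : EuclideanSpace ℝ (Fin d)) (z : ℕ → Z) (n : ℕ) : EuclideanSpace ℝ (Fin d) :=
  (state p g x₁ z n).x - (p.β₁ / (1 - p.β₁)) • WithLp.toLp 2 (move p g x₁ z n)

/-- Coordinate `i` of the increment of the auxiliary sequence. -/
noncomputable def auxIncrement (p : Params)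
    (g : EuclideanSpace ℝ (Fin d) → Z → EuclideanSpace ℝ (Fin d))
    (x₁ : EuclideanSpace ℝ (Fin d)) (z : ℕ → Z) (n : ℕ) (i : Fin d) : ℝ :=
  let b := denom p (fun n => (state p g x₁ z n).v i);
  -(stepSize p (n + 1) * (g (state p g x₁ z n).x (z (n + 1)) i / b (n + 1)))
    - p.β₁ / (1 - p.β₁) * ((stepSize p (n + 1) / b (n + 1) - stepSize p n / b n)
      * (state p g x₁ z n).m i)

lemma move_zero (p : Params) (i : Fin d) : move p g x₁ z 0 i = 0 := by
  simp [move, state]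

lemma aux_zero (p : Params) : aux p g x₁ z 0 = x₁ := by
  have : move p g x₁ z 0 = 0 := funext (move_zero p)
  simp [aux, this, state]

/-- With k = β₁/(1-β₁), 1 + k = 1/(1-β₁), so (1+k)m_{n+1} = γ_n + k·m_n: the new momentum is
replaced by the fresh gradient and the old momentum. -/
lemma aux_succ (H : Admissible β₁ β₂ C₀ ε₀) (n : ℕ) :
    aux (params β₁ β₂ C₀ ε₀) g x₁ z (n + 1) = aux (params β₁ β₂ C₀ ε₀) g x₁ z n
      + WithLp.toLp 2 (auxIncrement (params β₁ β₂ C₀ ε₀) g x₁ z n) := by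
  ext i
  have h0 : 1 - β₁ ≠ 0 := (sub_pos.2 H.lt_one₁).ne'
  simp only [aux, PiLp.sub_apply, PiLp.add_apply, PiLp.smul_apply, smul_eq_mul, state_succ_x]
  simp only [move, auxIncrement, (moments_state (g := g) (x₁ := x₁) (z := z)
    β₁ β₂ C₀ ε₀ i).m_succ n]
  simp only [params]
  field_simp
  ring

/-- The fresh-gradient part gives p; the change of ratio is at most `sigmaMax` times the old ratio,
so it is controlled by the last displacement. This is the form p + S·q of
`LSmooth.le_add_inner_near`, with q = ‖y - x‖ by `norm_aux_sub`. -/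
lemma norm_auxIncrement_le (H : Admissible β₁ β₂ C₀ ε₀) (n : ℕ) :
    ‖WithLp.toLp 2 (auxIncrement (params β₁ β₂ C₀ ε₀) g x₁ z n)‖ ≤
      √(∑ i, (stepSize (params β₁ β₂ C₀ ε₀) (n + 1) *
        (g (state (params β₁ β₂ C₀ ε₀) g x₁ z n).x (z (n + 1)) i / denom (params β₁ β₂ C₀ ε₀)
          (fun n => (state (params β₁ β₂ C₀ ε₀) g x₁ z n).v i) (n + 1))) ^ 2)
      + sigmaMax β₂ *
        (β₁ / (1 - β₁) * √(∑ i, move (params β₁ β₂ C₀ ε₀) g x₁ z n i ^ 2)) := by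
  set p := params β₁ β₂ C₀ ε₀ with hp
  have hD : 0 < 1 - β₁ := sub_pos.2 H.lt_one₁
  have hk : 0 ≤ β₁ / (1 - β₁) := div_nonneg H.nonneg₁ hD.le
  have hS : 0 ≤ sigmaMax β₂ := zero_le_one.trans (le_max_left _ _)
  let b : ℕ → Fin d → ℝ := fun n i => denom p (fun n => (state p g x₁ z n).v i) n
  let U : Fin d → ℝ := fun i =>
    stepSize p (n + 1) * (g (state p g x₁ z n).x (z (n + 1)) i / b (n + 1) i)
  let V : Fin d → ℝ := fun i =>
    β₁ / (1 - β₁) * ((stepSize p (n + 1) / b (n + 1) i - stepSize p n / b n i)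
      * (state p g x₁ z n).m i)
  have hV : ∀ i, V i ^ 2 ≤ (sigmaMax β₂ * (β₁ / (1 - β₁))) ^ 2 * move p g x₁ z n i ^ 2 := by
    intro i
    rcases n with _ | n
    · have : V i = 0 := by simp [V, state]
      rw [this, zero_pow two_ne_zero]; positivity
    · have hM := moments_state (g := g) (x₁ := x₁) (z := z) β₁ β₂ C₀ ε₀ i
      have h1 := abs_ratio_sub_le (C₀ := C₀) (ε₀ := ε₀) H.nonneg₁ H.lt_one₁ H.pos₂ H.lt_one
        H.pos_C.le n (denom_succ_pos H n) (sqrt_mul_denom_le hM H (n + 1))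
      have e : move p g x₁ z (n + 1) i
        = stepSize p (n + 1) / b (n + 1) i * (state p g x₁ z (n + 1)).m i := by
        simp only [move, b]; ring
      simp only [V, e]
      rw [mul_pow, mul_pow, ← sq_abs (_ - _)]
      calc _ ≤ (β₁ / (1 - β₁)) ^ 2 * ((sigmaMax β₂ * (stepSize p (n + 1) / b (n + 1) i)) ^ 2
              * (state p g x₁ z (n + 1)).m i ^ 2) := by gcongr
        _ = _ := by ring
  have e : WithLp.toLp 2 (auxIncrement p g x₁ z n) = -WithLp.toLp 2 U - WithLp.toLp 2 V := by
    ext i; rfl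
  rw [e]
  refine (norm_sub_le _ _).trans ?_
  rw [norm_neg, EuclideanSpace.norm_eq, EuclideanSpace.norm_eq]
  simp only [Real.norm_eq_abs, sq_abs]
  refine add_le_add_right ?_ _
  rw [← mul_assoc]
  apply Real.sqrt_le_iff.2 ⟨by positivity, ?_⟩
  rw [mul_pow, Real.sq_sqrt (by positivity), Finset.mul_sum]
  exact Finset.sum_le_sum fun i _ => hV i

lemma norm_aux_sub (H : Admissible β₁ β₂ C₀ ε₀) (n : ℕ) :
    ‖aux (params β₁ β₂ C₀ ε₀) g x₁ z n - (state (params β₁ β₂ C₀ ε₀) g x₁ z n).x‖ =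
      β₁ / (1 - β₁) * √(∑ i, move (params β₁ β₂ C₀ ε₀) g x₁ z n i ^ 2) := by
  have hk : 0 ≤ β₁ / (1 - β₁) := div_nonneg H.nonneg₁ (sub_pos.2 H.lt_one₁).le
  have e : (params β₁ β₂ C₀ ε₀).β₁ = β₁ := rfl
  rw [aux, sub_sub_cancel_left, norm_neg, norm_smul, EuclideanSpace.norm_eq, e,
    Real.norm_of_nonneg hk]
  simp

lemma aux_descent (H : Admissible β₁ β₂ C₀ ε₀) (hL : 0 ≤ L) (hf : LSmooth f L) (t : ℕ) :
    let p := params β₁ β₂ C₀ ε₀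
    f (aux p g x₁ z t) ≤ f x₁
      + ∑ i, ∑ n ∈ Finset.range t,
          gradient f (state p g x₁ z n).x i * auxIncrement p g x₁ z n i
      + L * ((1 / 2 + 2 * sigmaMax β₂ ^ 2) * ((β₁ / (1 - β₁)) ^ 2 *
          ∑ i, ∑ n ∈ Finset.range t, move p g x₁ z n i ^ 2)
        + 3 / 2 * ∑ i, ∑ n ∈ Finset.range t,
          (stepSize p (n + 1) * (g (state p g x₁ z n).x (z (n + 1)) i / denom p
            (fun n => (state p g x₁ z n).v i) (n + 1))) ^ 2) := by
  intro p
  induction t with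
  | zero => simp [aux_zero]
  | succ t ih =>
    have h1 := hf.le_add_inner_near hL (state p g x₁ z t).x (aux p g x₁ z t)
      (WithLp.toLp 2 (auxIncrement p g x₁ z t)) (le_max_left 1 (√((1 + β₂) / β₂) - 1))
      (norm_aux_sub H t).le (norm_auxIncrement_le H t)
    rw [← aux_succ H, mul_pow, Real.sq_sqrt (Finset.sum_nonneg fun i _ => sq_nonneg _),
      Real.sq_sqrt (Finset.sum_nonneg fun i _ => sq_nonneg _), PiLp.inner_apply] at h1
    simp only [Finset.sum_range_succ, Finset.sum_add_distrib]
    have e : ∑ i, inner ℝ (gradient f (state p g x₁ z t).x i)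
        ((WithLp.toLp 2 (auxIncrement p g x₁ z t) : EuclideanSpace ℝ (Fin d)) i) =
        ∑ i, gradient f (state p g x₁ z t).x i * auxIncrement p g x₁ z t i :=
      Finset.sum_congr rfl fun i _ => by simp [mul_comm]
    rw [e] at h1
    change _ ≤ _ + _ + L * ((1 / 2 + 2 * sigmaMax β₂ ^ 2) * _ + _) at h1
    linarith

end

end Adam

namespace Adam

/-! ### The pathwise bound -/

/-- The algebra defining `G`. Here n is the dimension, D = 1-β₁, and σ, s are the sup norms of σ₀,
σ₁. The four terms linear in √G cost G/8 each plus twice a square; the rest of the right-hand side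
and those squares fit in the other G/2. The descent sum carries 4L·7/24 = 7L/6 ≥ L. -/
lemma boundG_absorb {L C D r B β₁ β₂ k σ s ε₀ n ℓ Λ Δ Sm X G F : ℝ} (hL : 0 ≤ L) (hC : 0 ≤ C)
    (hD : 0 < D) (hr : 0 < r) (hβ₂ : 0 < β₂) (hβ₂' : β₂ ≤ 1)
    (hk : k = β₁ / D) (hn : 0 ≤ n)
    (hΛ : 0 ≤ Λ) (hX : 0 ≤ X) (hG0 : 0 ≤ G)
    (hB : B = -(7 / 24) * X + n * (6 * C / D * (σ + s * √G) * ℓ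
      + 8 * (σ + s * √G) * (C / D * Λ) + 4 * k ^ 2 * (σ + s * √G) * (C / r * Λ / β₂)
      + k ^ 2 * ((ε₀ + √2 * (σ + √(1 + s ^ 2) * √G)) / √β₂) * (C / r * Λ)
      + k * (2 * C / D * √(D / r) * √G))
      + L * ((1 / 2 + 2 * Sm ^ 2) * (k ^ 2 * (n * (C ^ 2 / r * Λ)))
        + 3 / 2 * (n * (C ^ 2 / D ^ 2 * Λ))))
    (hF : F ≤ 4 * L * (Δ + B) + 2 * L ^ 2 * (k ^ 2 * (n * (C ^ 2 / r))))
    (hG : G = 8 * L * Δ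
      + 256 * L ^ 2 * C ^ 2 * β₁ ^ 2 * n ^ 2 / (D ^ 3 * r)
      + 4 * L ^ 2 * C ^ 2 * β₁ ^ 2 * n / (D ^ 2 * r)
      + 48 * L * C * σ / D * n * ℓ
      + 8 * L * C * β₁ ^ 2 / (D ^ 2 * r)
          * (4 * σ / β₂ + (ε₀ + √2 * σ) / √β₂ + L * C / 2 * (1 + 4 * Sm ^ 2)) * n * Λ
      + 8 * (3 * L ^ 2 * C ^ 2 / D ^ 2 + 8 * L * σ * C / D) * n * Λ
      + 2304 * L ^ 2 * C ^ 2 * s ^ 2 / D ^ 2 * n ^ 2 * ℓ ^ 2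
      + 256 * (16 * L ^ 2 * C ^ 2 * s ^ 2 / D ^ 2
          + 9 * L ^ 2 * C ^ 2 * β₁ ^ 4 * (1 + s ^ 2) / (β₂ ^ 2 * D ^ 4 * r ^ 2))
          * n ^ 2 * Λ ^ 2) :
    F ≤ G - L * X := by
  have hsb : 0 < √β₂ := Real.sqrt_pos.2 hβ₂
  set q := √(1 + s ^ 2) with hq
  have hq2 : q ^ 2 = 1 + s ^ 2 := Real.sq_sqrt (by positivity)
  have hq0 : 0 ≤ q := Real.sqrt_nonneg _
  have hsq : s ≤ q := Real.le_sqrt_of_sq_le (by linarith)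
  set ρ := √(D / r) with hρ
  have hρ2 : ρ ^ 2 = D / r := Real.sq_sqrt (by positivity)
  have hg : 0 ≤ √G := Real.sqrt_nonneg _
  have y1 := mul_sqrt_le (24 * L * C * s / D * n * ℓ) hG0
  have y2 := mul_sqrt_le (32 * L * C * s / D * n * Λ) hG0
  have y3 := mul_sqrt_le (24 * L * C * β₁ ^ 2 * q / (β₂ * D ^ 2 * r) * n * Λ) hG0
  have y4 := mul_sqrt_le (8 * L * k * C * n * ρ / D) hG0
  have e4 : (8 * L * k * C * n * ρ / D) ^ 2
      = 64 * L ^ 2 * C ^ 2 * β₁ ^ 2 * n ^ 2 / (D ^ 3 * r) := by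
    calc _ = 64 * L ^ 2 * k ^ 2 * C ^ 2 * n ^ 2 * ρ ^ 2 / D ^ 2 := by ring
      _ = _ := by rw [hρ2, hk]; field_simp
  have e3 : (24 * L * C * β₁ ^ 2 * q / (β₂ * D ^ 2 * r) * n * Λ) ^ 2
      = 576 * L ^ 2 * C ^ 2 * β₁ ^ 4 * (1 + s ^ 2) / (β₂ ^ 2 * D ^ 4 * r ^ 2) * n ^ 2 * Λ ^ 2 := by
    rw [← hq2]; ring
  rw [e4] at y4
  rw [e3] at y3
  -- With s ≤ q, √2 ≤ 2 and β₂ ≤ √β₂ the two contributions merge into 6q/β₂, hence 24.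
  have h3 : 4 * L * (n * (k ^ 2 * (C / r * Λ) * (4 * s / β₂ + √2 * q / √β₂))) ≤
      24 * L * C * β₁ ^ 2 * q / (β₂ * D ^ 2 * r) * n * Λ := by
    have i1 : β₂ ≤ √β₂ := Real.le_sqrt_of_sq_le (pow_le_of_le_one hβ₂.le hβ₂' two_ne_zero)
    have i2 : √2 ≤ 2 := Real.sqrt_le_iff.2 ⟨by norm_num, by norm_num⟩
    have i3 : 4 * s / β₂ + √2 * q / √β₂ ≤ 6 * q / β₂ := by
      calc _ ≤ 4 * q / β₂ + 2 * q / β₂ := by gcongr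
        _ = _ := by ring
    calc _ ≤ 4 * L * (n * (k ^ 2 * (C / r * Λ) * (6 * q / β₂))) := by gcongr
      _ = _ := by rw [hk]; field_simp; ring
  have h3' := mul_le_mul_of_nonneg_right h3 hg
  have hkk : k ^ 2 = β₁ ^ 2 / D ^ 2 := by rw [hk, div_pow]
  have hLX : 0 ≤ L * X := mul_nonneg hL hX
  -- `G` allots the coefficient 12 to this term where 6 suffices.
  have hslack : 0 ≤ L ^ 2 * (n * (C ^ 2 / D ^ 2 * Λ)) := by positivity
  have hsplit : 4 * L * (Δ + B) + 2 * L ^ 2 * (k ^ 2 * (n * (C ^ 2 / r))) =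
      4 * L * Δ - 7 / 6 * (L * X) + 2 * L ^ 2 * (k ^ 2 * (n * (C ^ 2 / r)))
      + 24 * L * C * σ / D * n * ℓ + 32 * L * C * σ / D * n * Λ
      + 4 * L * C * (k ^ 2 / r) * (4 * σ / β₂ + (ε₀ + √2 * σ) / √β₂
          + L * C / 2 * (1 + 4 * Sm ^ 2)) * n * Λ
      + 6 * (L ^ 2 * (n * (C ^ 2 / D ^ 2 * Λ)))
      + 24 * L * C * s / D * n * ℓ * √G + 32 * L * C * s / D * n * Λ * √G
      + 4 * L * (n * (k ^ 2 * (C / r * Λ) * (4 * s / β₂ + √2 * q / √β₂))) * √G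
      + 8 * L * k * C * n * ρ / D * √G := by
    rw [hB]; ring
  have hGsplit : G = 2 * (4 * L * Δ + 2 * L ^ 2 * (k ^ 2 * (n * (C ^ 2 / r)))
      + 24 * L * C * σ / D * n * ℓ + 32 * L * C * σ / D * n * Λ
      + 4 * L * C * (k ^ 2 / r) * (4 * σ / β₂ + (ε₀ + √2 * σ) / √β₂
          + L * C / 2 * (1 + 4 * Sm ^ 2)) * n * Λ
      + 12 * (L ^ 2 * (n * (C ^ 2 / D ^ 2 * Λ)))
      + 2 * (24 * L * C * s / D * n * ℓ) ^ 2 + 2 * (32 * L * C * s / D * n * Λ) ^ 2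
      + 2 * (576 * L ^ 2 * C ^ 2 * β₁ ^ 4 * (1 + s ^ 2) / (β₂ ^ 2 * D ^ 4 * r ^ 2)
        * n ^ 2 * Λ ^ 2)
      + 2 * (64 * L ^ 2 * C ^ 2 * β₁ ^ 2 * n ^ 2 / (D ^ 3 * r))) := by
    rw [hG, hkk]; ring
  linarith

section

variable {d : ℕ} {Z : Type*} {f : EuclideanSpace ℝ (Fin d) → ℝ} {L fstar : ℝ}
  {g : EuclideanSpace ℝ (Fin d) → Z → EuclideanSpace ℝ (Fin d)} {σ₀ σ₁ : Fin d → ℝ}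
  {x₁ : EuclideanSpace ℝ (Fin d)} {β₁ β₂ C₀ ε₀ δ : ℝ} {z : ℕ → Z}

lemma log_confidence_nonneg (hδ : 0 < δ) (hδ' : δ < 1) {T : ℕ} (hT : 1 ≤ T) (d : ℕ) :
    0 ≤ Real.log (d * T / δ) := by
  rcases Nat.eq_zero_or_pos d with rfl | hd
  · simp
  · apply Real.log_nonneg
    rw [one_le_div hδ]
    have h1 : (1 : ℝ) ≤ d := by exact_mod_cast hd
    have h2 : (1 : ℝ) ≤ T := by exact_mod_cast hT
    nlinarith

lemma log_polyF_nonneg (H : Admissible β₁ β₂ C₀ ε₀) (T : ℕ) :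
    0 ≤ Real.log (polyF f L σ₀ σ₁ x₁ β₁ β₂ C₀ ε₀ T / β₂ ^ T) := by
  have hb := H.pos₂
  apply Real.log_nonneg
  rw [one_le_div (by positivity)]
  exact (pow_le_one₀ hb.le H.lt_one.le).trans (one_le_polyF H T)

lemma boundG_nonneg (H : Admissible β₁ β₂ C₀ ε₀) (hL : 0 ≤ L) (hbelow : ∀ x, fstar ≤ f x)
    (hδ : 0 < δ) (hδ' : δ < 1) {T : ℕ} (hT : 1 ≤ T) :
    0 ≤ boundG f fstar L σ₀ σ₁ x₁ β₁ β₂ C₀ ε₀ δ T := by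
  have h1 := log_confidence_nonneg hδ hδ' hT d
  have h2 := log_polyF_nonneg (f := f) (L := L) (σ₀ := σ₀) (σ₁ := σ₁) (x₁ := x₁) H T
  have h3 := H.r_pos
  have h4 : 0 < 1 - β₁ := sub_pos.2 H.lt_one₁
  have h5 : 0 ≤ f x₁ - fstar := sub_nonneg.2 (hbelow x₁)
  have h6 := H.pos₂
  have h7 := H.pos_C
  have h8 := H.pos_ε
  have h9 := H.nonneg₁
  unfold boundG
  positivity

/-- Strong induction on time: earlier gradients below `G` bound the noise levels and, through
`hmart`, the martingale. `hmart` is conditional on those earlier bounds, which is what the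
switched-off martingale can provide. -/
theorem gradient_bound_of_martingale_bound (H : Admissible β₁ β₂ C₀ ε₀) (hL : 0 ≤ L)
    (hf : LSmooth f L) (hbelow : ∀ x, fstar ≤ f x)
    (hσ₀ : ∀ i, 0 ≤ σ₀ i) (hσ₁ : ∀ i, 0 ≤ σ₁ i) (hδ : 0 < δ) (hδ' : δ < 1)
    {T : ℕ} (hT : 1 ≤ T)
    (hnoise : ∀ n < T, ∀ i, |g (state (params β₁ β₂ C₀ ε₀) g x₁ z n).x (z (n + 1)) i
        - gradient f (state (params β₁ β₂ C₀ ε₀) g x₁ z n).x i| ≤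
      noiseLevel (σ₀ i) (σ₁ i) (gradient f (state (params β₁ β₂ C₀ ε₀) g x₁ z n).x i))
    (hmart : ∀ t ≤ T, (∀ n < t, ‖gradient f (state (params β₁ β₂ C₀ ε₀) g x₁ z n).x‖ ^ 2 ≤
        boundG f fstar L σ₀ σ₁ x₁ β₁ β₂ C₀ ε₀ δ T) → ∀ i,
      ∑ n ∈ Finset.range t, -(stepSize (params β₁ β₂ C₀ ε₀) (n + 1)
          * gradient f (state (params β₁ β₂ C₀ ε₀) g x₁ z n).x i
          / proxy (params β₁ β₂ C₀ ε₀) f σ₀ σ₁ g x₁ z (n + 1) i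
          * (g (state (params β₁ β₂ C₀ ε₀) g x₁ z n).x (z (n + 1)) i
            - gradient f (state (params β₁ β₂ C₀ ε₀) g x₁ z n).x i)) ≤
        1 / 12 * ∑ n ∈ Finset.range t, stepSize (params β₁ β₂ C₀ ε₀) (n + 1)
          * (gradient f (state (params β₁ β₂ C₀ ε₀) g x₁ z n).x i ^ 2
          / proxy (params β₁ β₂ C₀ ε₀) f σ₀ σ₁ g x₁ z (n + 1) i)
        + 6 * C₀ / (1 - β₁) *
          (‖σ₀‖ + ‖σ₁‖ * √(boundG f fstar L σ₀ σ₁ x₁ β₁ β₂ C₀ ε₀ δ T))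
          * Real.log (d * T / δ)) (t : ℕ) (htT : t ≤ T) :
    ‖gradient f (state (params β₁ β₂ C₀ ε₀) g x₁ z t).x‖ ^ 2 ≤
      boundG f fstar L σ₀ σ₁ x₁ β₁ β₂ C₀ ε₀ δ T
      - L * ∑ i, ∑ n ∈ Finset.range t, stepSize (params β₁ β₂ C₀ ε₀) (n + 1)
          * (gradient f (state (params β₁ β₂ C₀ ε₀) g x₁ z n).x i ^ 2
          / proxy (params β₁ β₂ C₀ ε₀) f σ₀ σ₁ g x₁ z (n + 1) i) := by
  set p := params β₁ β₂ C₀ ε₀ with hp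
  set G := boundG f fstar L σ₀ σ₁ x₁ β₁ β₂ C₀ ε₀ δ T with hG
  have hG0 : 0 ≤ G := boundG_nonneg H hL hbelow hδ hδ' hT
  have hD : 0 < 1 - β₁ := sub_pos.2 H.lt_one₁
  have hk : 0 ≤ β₁ / (1 - β₁) := div_nonneg H.nonneg₁ hD.le
  have hr := H.r_pos
  have hX : ∀ t, 0 ≤ ∑ i, ∑ n ∈ Finset.range t, stepSize p (n + 1)
          * (gradient f (state p g x₁ z n).x i ^ 2 / proxy p f σ₀ σ₁ g x₁ z (n + 1) i) := by
    intro t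
    refine Finset.sum_nonneg fun i _ => Finset.sum_nonneg fun n _ => ?_
    refine mul_nonneg (stepSize_nonneg H.nonneg₁ H.lt_one₁ H.pos_C.le _)
      (div_nonneg (sq_nonneg _) ?_)
    exact add_nonneg (Real.sqrt_nonneg _) (eps_nonneg H.pos_ε.le _)
  induction t using Nat.strong_induction_on with
  | _ t ih =>
  have hprev : ∀ n < t, ‖gradient f (state p g x₁ z n).x‖ ^ 2 ≤ G := fun n hn => by
    have h1 := ih n hn (by omega)
    have h2 := mul_nonneg hL (hX n)
    linarith
  set Λ := Real.log (polyF f L σ₀ σ₁ x₁ β₁ β₂ C₀ ε₀ T / β₂ ^ T) with hΛ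
  have hΛ0 : 0 ≤ Λ := log_polyF_nonneg H T
  have hpot := fun i => log_potential_le (g := g) (x₁ := x₁) (z := z) H hL hf hσ₀ hσ₁ htT i
    fun n hn => hnoise n (by omega) i
  have hdesc := aux_descent (g := g) (x₁ := x₁) (z := z) H hL hf t
  have hcoord := fun i => coordinate_sum (moments_state (g := g) (x₁ := x₁) (z := z)
    β₁ β₂ C₀ ε₀ i) H t (hpot i) hk (G := G)
    (h := fun n => gradient f (state p g x₁ z n).x i)
    (fun n hn => (sq_apply_le_sq_norm _ i).trans (hprev n hn)) (hσ₀ i) (hσ₁ i)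
    ((le_abs_self _).trans (norm_le_pi_norm σ₀ i)) ((le_abs_self _).trans (norm_le_pi_norm σ₁ i))
    (fun n hn => hnoise n (by omega) i) (hmart t htT hprev i)
  have hmove := fun i => sum_sq_move_le (moments_state (g := g) (x₁ := x₁) (z := z)
    β₁ β₂ C₀ ε₀ i) H t (hpot i)
  have hgrad := fun i => sum_sq_gradient_term_le (moments_state (g := g) (x₁ := x₁) (z := z)
    β₁ β₂ C₀ ε₀ i) H t (hpot i)
  have hcoord' := Finset.sum_le_sum fun i (_ : i ∈ Finset.univ) => hcoord i
  have hmove' := Finset.sum_le_sum fun i (_ : i ∈ Finset.univ) => hmove i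
  have hgrad' := Finset.sum_le_sum fun i (_ : i ∈ Finset.univ) => hgrad i
  simp only [Finset.sum_add_distrib, ← Finset.mul_sum, Finset.sum_const, Finset.card_univ,
    Fintype.card_fin, nsmul_eq_mul] at hcoord' hmove' hgrad'
  -- from the auxiliary point back to the iterate
  have hy := hf.sq_norm_gradient_le hL hbelow (aux p g x₁ z t)
  have hlast : ‖aux p g x₁ z t - (state p g x₁ z t).x‖ ^ 2 ≤
      (β₁ / (1 - β₁)) ^ 2 * (d * (C₀ ^ 2 / (1 - β₁ / β₂))) := by
    rw [norm_aux_sub H t, mul_pow, Real.sq_sqrt (Finset.sum_nonneg fun i _ => sq_nonneg _)]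
    refine mul_le_mul_of_nonneg_left ?_ (sq_nonneg _)
    calc _ ≤ ∑ _i : Fin d, C₀ ^ 2 / (1 - β₁ / β₂) :=
          Finset.sum_le_sum fun i _ => move_sq_le H t i
      _ = _ := by simp
  -- The factor 2 here and the 2L of `hy` give the 4L in `boundG_absorb`.
  have htri : ‖gradient f (state p g x₁ z t).x‖ ^ 2 ≤
      2 * ‖gradient f (aux p g x₁ z t)‖ ^ 2
        + 2 * (L ^ 2 * ‖aux p g x₁ z t - (state p g x₁ z t).x‖ ^ 2) := by
    have h1 := norm_add_le (gradient f (aux p g x₁ z t))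
      (gradient f (state p g x₁ z t).x - gradient f (aux p g x₁ z t))
    rw [add_sub_cancel, norm_sub_rev (gradient f (state p g x₁ z t).x)] at h1
    have h2 := hf.gradient_lipschitz (aux p g x₁ z t) (state p g x₁ z t).x
    have h3 := pow_le_pow_left₀ (norm_nonneg _) h2 2
    rw [mul_pow] at h3
    have h4 := pow_le_pow_left₀ (norm_nonneg _) h1 2
    nlinarith [sq_nonneg (‖gradient f (aux p g x₁ z t)‖
      - ‖gradient f (aux p g x₁ z t) - gradient f (state p g x₁ z t).x‖)]
  have hS : 0 ≤ sigmaMax β₂ ^ 2 := sq_nonneg _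
  have hdesc' := hdesc.trans (add_le_add (add_le_add_right hcoord' _)
    (mul_le_mul_of_nonneg_left (add_le_add
      (mul_le_mul_of_nonneg_left (mul_le_mul_of_nonneg_left hmove' (sq_nonneg _))
        (show (0 : ℝ) ≤ 1 / 2 + 2 * sigmaMax β₂ ^ 2 by positivity))
      (mul_le_mul_of_nonneg_left hgrad' (show (0 : ℝ) ≤ 3 / 2 by norm_num))) hL))
  refine boundG_absorb (ε₀ := ε₀) (ℓ := Real.log (d * T / δ)) (Λ := Λ) (Sm := sigmaMax β₂)
    (Δ := f x₁ - fstar) (σ := ‖σ₀‖) (s := ‖σ₁‖) (n := d) hL H.pos_C.le hD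
    hr H.pos₂ H.lt_one.le rfl (Nat.cast_nonneg _) hΛ0 (hX t) hG0 rfl ?_ rfl
  have hfin := mul_le_mul_of_nonneg_left hdesc' (show 0 ≤ 4 * L by positivity)
  have hlast' := mul_le_mul_of_nonneg_left hlast (show 0 ≤ 2 * L ^ 2 by positivity)
  refine htri.trans ?_
  have hXe : ∑ i, ∑ n ∈ Finset.range t, stepSize (params β₁ β₂ C₀ ε₀) (n + 1) *
      (gradient f (state p g x₁ z n).x i ^ 2 / proxyDenom (params β₁ β₂ C₀ ε₀) (σ₀ i) (σ₁ i)
        (fun n => (state (params β₁ β₂ C₀ ε₀) g x₁ z n).v i)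
        (fun n => gradient f (state p g x₁ z n).x i) n) =
      ∑ i, ∑ n ∈ Finset.range t, stepSize p (n + 1)
          * (gradient f (state p g x₁ z n).x i ^ 2 / proxy p f σ₀ σ₁ g x₁ z (n + 1) i) := rfl
  rw [hXe] at hfin
  linarith

end

end Adam

namespace Adam

/-! ### Measurability of the trajectory -/

section

variable {d : ℕ} {Z : Type*} [MeasurableSpace Z]
  {f : EuclideanSpace ℝ (Fin d) → ℝ} {L : ℝ}
  {g : EuclideanSpace ℝ (Fin d) → Z → EuclideanSpace ℝ (Fin d)} {x₁ : EuclideanSpace ℝ (Fin d)}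

lemma measurable_apply {Ω : Type*} [MeasurableSpace Ω] {X : Ω → EuclideanSpace ℝ (Fin d)}
    (hX : Measurable X) (i : Fin d) : Measurable fun ω => X ω i :=
  (measurable_pi_apply i).comp ((WithLp.measurable_ofLp 2 (Fin d → ℝ)).comp hX)

lemma measurable_state {Ω : Type*} [MeasurableSpace Ω] (hg : Measurable (Function.uncurry g))
    (p : Params) {z : ℕ → Ω → Z} (n : ℕ) (hz : ∀ s ≤ n, Measurable (z s)) :
    Measurable (fun ω => (state p g x₁ (fun s => z s ω) n).x) ∧
    (∀ i, Measurable fun ω => (state p g x₁ (fun s => z s ω) n).m i) ∧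
    (∀ i, Measurable fun ω => (state p g x₁ (fun s => z s ω) n).v i) := by
  induction n with
  | zero => exact ⟨measurable_const, fun i => measurable_const, fun i => measurable_const⟩
  | succ n ih =>
    obtain ⟨hx, hm, hv⟩ := ih fun s hs => hz s (by omega)
    have hgm : Measurable fun ω => g (state p g x₁ (fun s => z s ω) n).x (z (n + 1) ω) :=
      hg.comp (hx.prodMk (hz (n + 1) le_rfl))
    have hgi := fun i => measurable_apply hgm i
    have hm' : ∀ i, Measurable fun ω => (state p g x₁ (fun s => z s ω) (n + 1)).m i := fun i =>
      ((hm i).const_mul _).add ((hgi i).const_mul _)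
    have hv' : ∀ i, Measurable fun ω => (state p g x₁ (fun s => z s ω) (n + 1)).v i := fun i =>
      ((hv i).const_mul _).add (((hgi i).pow_const 2).const_mul _)
    refine ⟨?_, hm', hv'⟩
    refine (WithLp.measurable_toLp 2 (Fin d → ℝ)).comp (measurable_pi_lambda _ fun i => ?_)
    exact (measurable_apply hx i).sub
      ((((hv' i).sqrt).add_const _ |>.const_div _).mul (hm' i))

/-- The coefficient of the noise in the martingale, switched off once the gradient exceeds the
threshold. -/
noncomputable def martingaleCoeff (p : Params) (f : EuclideanSpace ℝ (Fin d) → ℝ)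
    (σ₀ σ₁ : Fin d → ℝ) (g : EuclideanSpace ℝ (Fin d) → Z → EuclideanSpace ℝ (Fin d))
    (x₁ : EuclideanSpace ℝ (Fin d)) (G : ℝ) (i : Fin d) (n : ℕ) (z : ℕ → Z) : ℝ :=
  if ‖gradient f (state p g x₁ z n).x‖ ^ 2 ≤ G then
    -(stepSize p (n + 1) * gradient f (state p g x₁ z n).x i
      / proxy p f σ₀ σ₁ g x₁ z (n + 1) i)
  else 0

lemma measurable_martingaleCoeff {Ω : Type*} [MeasurableSpace Ω] (hf : LSmooth f L)
    (hg : Measurable (Function.uncurry g)) (p : Params) (σ₀ σ₁ : Fin d → ℝ) (G : ℝ) (i : Fin d)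
    {z : ℕ → Ω → Z} (n : ℕ) (hz : ∀ s ≤ n, Measurable (z s)) :
    Measurable fun ω => martingaleCoeff p f σ₀ σ₁ g x₁ G i n (fun s => z s ω) := by
  obtain ⟨hx, -, hv⟩ := measurable_state (x₁ := x₁) hg p n hz
  have hG := hf.continuous_gradient.measurable.comp hx
  have hGi := measurable_apply hG i
  refine Measurable.ite (measurableSet_le (hG.norm.pow_const 2) measurable_const) ?_
    measurable_const
  refine ((hGi.const_mul _).div ?_).neg
  exact ((((hv i).const_mul _).add
    ((((hGi.pow_const 2).const_mul _).const_add _).const_mul _)).sqrt).add_const _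

end

/-! ### The history of the samples -/

section

variable {Z Ω : Type*} [MeasurableSpace Z] {z : ℕ → Ω → Z}

/-- The information carried by the samples up to time `n`. -/
abbrev history (z : ℕ → Ω → Z) (n : ℕ) : MeasurableSpace Ω :=
  ⨆ s ∈ Set.Iic n, MeasurableSpace.comap (z s) inferInstance

lemma measurable_history {s n : ℕ} (hs : s ≤ n) : Measurable[history z n] (z s) :=
  Measurable.mono (comap_measurable (z s))
    (le_iSup₂ (f := fun s (_ : s ∈ Set.Iic n) => MeasurableSpace.comap (z s) inferInstance) s hs)
    le_rfl

lemma history_mono {m n : ℕ} (h : m ≤ n) : history z m ≤ history z n :=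
  iSup₂_le fun s hs =>
    le_iSup₂ (f := fun s (_ : s ∈ Set.Iic n) => MeasurableSpace.comap (z s) inferInstance) s
      (le_trans hs h)

variable [MeasurableSpace Ω]

lemma history_le (hz : ∀ s, Measurable (z s)) (n : ℕ) :
    history z n ≤ (inferInstance : MeasurableSpace Ω) :=
  iSup₂_le fun s _ => (hz s).comap_le

lemma indepFun_history (hz : ∀ s, Measurable (z s)) {μ : Measure Ω} (hindep : iIndepFun z μ) {Y : Type*}
    [MeasurableSpace Y] {n : ℕ} {y : Ω → Y} (hy : Measurable[history z n] y) :
    IndepFun y (z (n + 1)) μ := by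
  have h := indep_iSup_of_disjoint (fun s => (hz s).comap_le) hindep
    (S := Set.Iic n) (T := {n + 1}) (by simp)
  rw [iSup_singleton] at h
  exact indep_of_indep_of_le_left h hy.comap_le

end

/-! ### Exponential moments of the noise -/

section

variable {d : ℕ} {Z Ω : Type*} [MeasurableSpace Z] [MeasurableSpace Ω]
  {f : EuclideanSpace ℝ (Fin d) → ℝ} {L : ℝ}
  {P : Measure Z} [IsProbabilityMeasure P]
  {g : EuclideanSpace ℝ (Fin d) → Z → EuclideanSpace ℝ (Fin d)}
  {σ₀ σ₁ : Fin d → ℝ}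
  {μ : Measure Ω} [IsProbabilityMeasure μ] {z : ℕ → Ω → Z}
  {x₁ : EuclideanSpace ℝ (Fin d)}

/-- The exponential compensated noise with parameter `τ` at the point `x`. -/
noncomputable def expNoise (f : EuclideanSpace ℝ (Fin d) → ℝ)
    (g : EuclideanSpace ℝ (Fin d) → Z → EuclideanSpace ℝ (Fin d)) (σ₀ σ₁ : Fin d → ℝ) (i : Fin d)
    (y : EuclideanSpace ℝ (Fin d) × ℝ) (ζ : Z) : ENNReal :=
  ENNReal.ofReal (Real.exp (y.2 * (g y.1 ζ i - gradient f y.1 i)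
    - y.2 ^ 2 * noiseLevel (σ₀ i) (σ₁ i) (gradient f y.1 i) ^ 2 / 2))

/-- Hoeffding's lemma: a centred variable in [-N, N] is sub-Gaussian with variance proxy N², which
the compensator cancels for every τ. -/
lemma lintegral_expNoise_le (hunbiased : ∀ x, Integrable (g x) P ∧ ∫ ζ, g x ζ ∂P = gradient f x)
    (hnoise : ∀ x i, ∀ᵐ ζ ∂P,
      (g x ζ i - gradient f x i) ^ 2 ≤ σ₀ i ^ 2 + σ₁ i ^ 2 * gradient f x i ^ 2)
    (i : Fin d) (y : EuclideanSpace ℝ (Fin d) × ℝ) :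
    ∫⁻ ζ, expNoise f g σ₀ σ₁ i y ζ ∂P ≤ 1 := by
  obtain ⟨x, τ⟩ := y
  obtain ⟨hint, hmean⟩ := hunbiased x
  set N := noiseLevel (σ₀ i) (σ₁ i) (gradient f x i) with hN
  have hN0 : 0 ≤ N := noiseLevel_nonneg _ _ _
  have hinti : Integrable (fun ζ => g x ζ i) P :=
    (EuclideanSpace.proj (𝕜 := ℝ) i).integrable_comp hint
  have hmeani : ∫ ζ, g x ζ i ∂P = gradient f x i := by
    have := (EuclideanSpace.proj (𝕜 := ℝ) i).integral_comp_comm hint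
    rw [hmean] at this
    exact this
  have hbound : ∀ᵐ ζ ∂P, g x ζ i - gradient f x i ∈ Set.Icc (-N) N := by
    filter_upwards [hnoise x i] with ζ hζ
    exact abs_le.1 (Real.abs_le_sqrt hζ)
  have hsub := hasSubgaussianMGF_of_mem_Icc_of_integral_eq_zero
    (hinti.aestronglyMeasurable.aemeasurable.sub_const _) hbound (by
      rw [integral_sub hinti (integrable_const _), hmeani]; simp)
  have hc : (((‖N - -N‖₊ / 2) ^ 2 : NNReal) : ℝ) = N ^ 2 := by
    push_cast
    rw [Real.norm_of_nonneg (by linarith)]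
    ring
  have hmgf := hsub.mgf_le τ
  rw [hc] at hmgf
  have hI := hsub.integrable_exp_mul τ
  have e : ∀ ζ, expNoise f g σ₀ σ₁ i (x, τ) ζ =
      ENNReal.ofReal (Real.exp (τ * (g x ζ i - gradient f x i)) * Real.exp (-(τ ^ 2 * N ^ 2 / 2))) :=
    fun ζ => by rw [expNoise, ← Real.exp_add, sub_eq_add_neg]
  simp only [e]
  rw [← ofReal_integral_eq_lintegral_ofReal (hI.mul_const _)
    (Filter.Eventually.of_forall fun ζ => by positivity), integral_mul_const,
    ENNReal.ofReal_le_one]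
  calc _ ≤ Real.exp (N ^ 2 * τ ^ 2 / 2) * Real.exp (-(τ ^ 2 * N ^ 2 / 2)) :=
        mul_le_mul_of_nonneg_right hmgf (Real.exp_pos _).le
    _ = 1 := by rw [← Real.exp_add, ← Real.exp_zero]; congr 1; ring

lemma measurable_expNoise (hf : LSmooth f L) (hg : Measurable (Function.uncurry g)) (i : Fin d) :
    Measurable (Function.uncurry (expNoise f g σ₀ σ₁ i)) := by
  have h1 : Measurable fun q : (EuclideanSpace ℝ (Fin d) × ℝ) × Z => g q.1.1 q.2 :=
    hg.comp ((measurable_fst.comp measurable_fst).prodMk measurable_snd)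
  have h2 : Measurable fun q : (EuclideanSpace ℝ (Fin d) × ℝ) × Z => gradient f q.1.1 :=
    hf.continuous_gradient.measurable.comp (measurable_fst.comp measurable_fst)
  have h3 : Measurable fun q : (EuclideanSpace ℝ (Fin d) × ℝ) × Z => q.1.2 :=
    measurable_snd.comp measurable_fst
  have h1i := measurable_apply h1 i
  have h2i := measurable_apply h2 i
  refine ENNReal.measurable_ofReal.comp (Real.measurable_exp.comp ?_)
  refine (h3.mul (h1i.sub h2i)).sub (((h3.pow_const 2).mul (Measurable.pow_const ?_ 2)).div_const 2)
  exact ((((h2i.pow_const 2).const_mul _).const_add _)).sqrt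

/-- Integrating out a fresh independent sample. -/
lemma lintegral_mul_le_of_indepFun {Y : Type*} [MeasurableSpace Y] {D : Ω → ENNReal} {y : Ω → Y}
    {ζ : Ω → Z} (hD : Measurable D) (hy : Measurable y) (hζ : Measurable ζ)
    (hlaw : μ.map ζ = P) (hind : IndepFun (fun ω => (D ω, y ω)) ζ μ)
    {Ψ : Y → Z → ENNReal} (hΨ : Measurable (Function.uncurry Ψ))
    (hΨ1 : ∀ y, ∫⁻ ζ, Ψ y ζ ∂P ≤ 1) :
    ∫⁻ ω, D ω * Ψ (y ω) (ζ ω) ∂μ ≤ ∫⁻ ω, D ω ∂μ := by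
  have hW : Measurable fun ω => (D ω, y ω) := hD.prodMk hy
  have hprod := (indepFun_iff_map_prod_eq_prod_map_map hW.aemeasurable hζ.aemeasurable).1 hind
  rw [hlaw] at hprod
  have hΦ : Measurable fun q : (ENNReal × Y) × Z => q.1.1 * Ψ q.1.2 q.2 :=
    (measurable_fst.comp measurable_fst).mul
      (hΨ.comp ((measurable_snd.comp measurable_fst).prodMk measurable_snd))
  calc ∫⁻ ω, D ω * Ψ (y ω) (ζ ω) ∂μ
      = ∫⁻ q, q.1.1 * Ψ q.1.2 q.2 ∂(μ.map fun ω => ((D ω, y ω), ζ ω)) :=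
        (lintegral_map hΦ (hW.prodMk hζ)).symm
    _ = ∫⁻ q, ∫⁻ s, q.1 * Ψ q.2 s ∂P ∂(μ.map fun ω => (D ω, y ω)) := by
        have := Measure.isProbabilityMeasure_map (μ := μ) hW.aemeasurable
        rw [hprod, lintegral_prod _ hΦ.aemeasurable]
    _ ≤ ∫⁻ q, q.1 ∂(μ.map fun ω => (D ω, y ω)) := by
        refine lintegral_mono fun q => ?_
        rw [lintegral_const_mul _ (show Measurable (Ψ q.2) from hΨ.comp measurable_prodMk_left)]
        exact mul_le_of_le_one_right zero_le (hΨ1 q.2)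
    _ = ∫⁻ ω, D ω ∂μ := lintegral_map measurable_fst hW

/-- The exponential martingale bound. -/
lemma lintegral_prod_expNoise_le (hf : LSmooth f L) (hg : Measurable (Function.uncurry g))
    (hunbiased : ∀ x, Integrable (g x) P ∧ ∫ ζ, g x ζ ∂P = gradient f x)
    (hnoise : ∀ x i, ∀ᵐ ζ ∂P,
      (g x ζ i - gradient f x i) ^ 2 ≤ σ₀ i ^ 2 + σ₁ i ^ 2 * gradient f x i ^ 2)
    (hz : ∀ s, Measurable (z s)) (hlaw : ∀ s, μ.map (z s) = P) (hindep : iIndepFun z μ)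
    (i : Fin d) {x : ℕ → Ω → EuclideanSpace ℝ (Fin d)} {τ : ℕ → Ω → ℝ}
    (hx : ∀ n, Measurable[history z n] (x n)) (hτ : ∀ n, Measurable[history z n] (τ n)) (t : ℕ) :
    Measurable[history z t] (fun ω => ∏ n ∈ Finset.range t,
      expNoise f g σ₀ σ₁ i (x n ω, τ n ω) (z (n + 1) ω)) ∧
    ∫⁻ ω, ∏ n ∈ Finset.range t, expNoise f g σ₀ σ₁ i (x n ω, τ n ω) (z (n + 1) ω) ∂μ ≤ 1 := by
  induction t with
  | zero => exact ⟨by simp, by simp⟩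
  | succ t ih =>
    obtain ⟨hm, hle⟩ := ih
    have hΨ := measurable_expNoise (σ₀ := σ₀) (σ₁ := σ₁) hf hg i
    have hy : Measurable[history z t] fun ω => (x t ω, τ t ω) :=
      Measurable.prodMk (hx t) (hτ t)
    simp only [Finset.prod_range_succ]
    constructor
    · refine Measurable.mul (Measurable.mono hm (history_mono t.le_succ) le_rfl) ?_
      exact hΨ.comp (Measurable.prodMk (Measurable.mono hy (history_mono t.le_succ) le_rfl)
        (measurable_history le_rfl))
    · refine le_trans ?_ hle
      exact lintegral_mul_le_of_indepFun (Measurable.mono hm (history_le hz t) le_rfl)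
        (Measurable.mono hy (history_le hz t) le_rfl) (hz _) (hlaw _)
        (indepFun_history hz hindep (Measurable.prodMk hm hy)) hΨ
        (lintegral_expNoise_le hunbiased hnoise i)

/-- Markov's inequality for the exponential product. The compensator stays inside the event, so no
prior bound on the accumulated variance is needed. -/
lemma martingale_tail (hf : LSmooth f L) (hg : Measurable (Function.uncurry g))
    (hunbiased : ∀ x, Integrable (g x) P ∧ ∫ ζ, g x ζ ∂P = gradient f x)
    (hnoise : ∀ x i, ∀ᵐ ζ ∂P,
      (g x ζ i - gradient f x i) ^ 2 ≤ σ₀ i ^ 2 + σ₁ i ^ 2 * gradient f x i ^ 2)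
    (hz : ∀ s, Measurable (z s)) (hlaw : ∀ s, μ.map (z s) = P) (hindep : iIndepFun z μ)
    (i : Fin d) {x : ℕ → Ω → EuclideanSpace ℝ (Fin d)} {τ : ℕ → Ω → ℝ}
    (hx : ∀ n, Measurable[history z n] (x n)) (hτ : ∀ n, Measurable[history z n] (τ n)) (t : ℕ)
    {c : ℝ} (hc : 0 < c) :
    μ {ω | Real.log c ≤ ∑ n ∈ Finset.range t,
      (τ n ω * (g (x n ω) (z (n + 1) ω) i - gradient f (x n ω) i)
        - τ n ω ^ 2 * noiseLevel (σ₀ i) (σ₁ i) (gradient f (x n ω) i) ^ 2 / 2)}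
      ≤ ENNReal.ofReal c⁻¹ := by
  obtain ⟨hm, hle⟩ := lintegral_prod_expNoise_le hf hg hunbiased hnoise hz hlaw hindep i hx hτ t
  have hm' := Measurable.mono hm (history_le hz t) le_rfl
  have hM := meas_ge_le_lintegral_div (μ := μ) hm'.aemeasurable
    (ε := ENNReal.ofReal c) (by simpa using hc) ENNReal.ofReal_ne_top
  refine (measure_mono fun ω hω => ?_).trans (hM.trans ?_)
  · simp only [Set.mem_ofPred_eq] at hω ⊢
    simp only [expNoise]
    rw [← ENNReal.ofReal_prod_of_nonneg fun n _ => (Real.exp_pos _).le, ← Real.exp_sum]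
    apply ENNReal.ofReal_le_ofReal
    rw [← Real.exp_log hc]
    exact Real.exp_le_exp.2 hω
  · rw [ENNReal.ofReal_inv_of_pos hc, ← one_div]
    exact ENNReal.div_le_div_right hle _

/-- The noise bound holds almost surely at each fixed point. It transfers to the random iterate by
Fubini, since the next sample is independent of the past. -/
lemma ae_noise_le (hf : LSmooth f L) (hg : Measurable (Function.uncurry g))
    (hnoise : ∀ x i, ∀ᵐ ζ ∂P,
      (g x ζ i - gradient f x i) ^ 2 ≤ σ₀ i ^ 2 + σ₁ i ^ 2 * gradient f x i ^ 2)
    (hz : ∀ s, Measurable (z s)) (hlaw : ∀ s, μ.map (z s) = P) (hindep : iIndepFun z μ)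
    {n : ℕ} {x : Ω → EuclideanSpace ℝ (Fin d)} (hx : Measurable[history z n] x) (i : Fin d) :
    ∀ᵐ ω ∂μ, |g (x ω) (z (n + 1) ω) i - gradient f (x ω) i| ≤
      noiseLevel (σ₀ i) (σ₁ i) (gradient f (x ω) i) := by
  have hx' : Measurable x := Measurable.mono hx (history_le hz n) le_rfl
  have hprod := (indepFun_iff_map_prod_eq_prod_map_map hx'.aemeasurable
    (hz (n + 1)).aemeasurable).1 (indepFun_history hz hindep hx)
  rw [hlaw] at hprod
  have := Measure.isProbabilityMeasure_map (μ := μ) hx'.aemeasurable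
  have h1 : Measurable fun q : EuclideanSpace ℝ (Fin d) × Z => g q.1 q.2 i :=
    measurable_apply hg i
  have h2 : Measurable fun q : EuclideanSpace ℝ (Fin d) × Z => gradient f q.1 i :=
    measurable_apply (hf.continuous_gradient.measurable.comp measurable_fst) i
  have hset : MeasurableSet {q : EuclideanSpace ℝ (Fin d) × Z |
      (g q.1 q.2 i - gradient f q.1 i) ^ 2 ≤ σ₀ i ^ 2 + σ₁ i ^ 2 * gradient f q.1 i ^ 2} :=
    measurableSet_le ((h1.sub h2).pow_const 2) (((h2.pow_const 2).const_mul _).const_add _)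
  have hae : ∀ᵐ q ∂(μ.map fun ω => (x ω, z (n + 1) ω)),
      (g q.1 q.2 i - gradient f q.1 i) ^ 2 ≤ σ₀ i ^ 2 + σ₁ i ^ 2 * gradient f q.1 i ^ 2 := by
    rw [hprod, Measure.ae_prod_iff_ae_ae hset]
    exact Filter.Eventually.of_forall fun y => hnoise y i
  filter_upwards [ae_of_ae_map (hx'.prodMk (hz (n + 1))).aemeasurable hae] with ω hω
  exact Real.abs_le_sqrt hω

end

end Adam

namespace Adam

/-! ### The high-probability bound -/

section

variable {d : ℕ} {Z : Type*} {f : EuclideanSpace ℝ (Fin d) → ℝ}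
  {g : EuclideanSpace ℝ (Fin d) → Z → EuclideanSpace ℝ (Fin d)}
  {σ₀ σ₁ : Fin d → ℝ} {x₁ : EuclideanSpace ℝ (Fin d)} {β₁ β₂ C₀ ε₀ : ℝ}

/-- The exponent at which the martingale is tested. -/
noncomputable def exponent (β₁ C₀ S : ℝ) : ℝ := (1 - β₁) / (6 * C₀ * S)

/-- Deterministic consequence of the exponential bound for one coordinate of the martingale. -/
lemma martingale_le_of_exponent (H : Admissible β₁ β₂ C₀ ε₀) (hσ₀ : ∀ i, 0 ≤ σ₀ i)
    (hσ₁ : ∀ i, 0 ≤ σ₁ i) {G ℓ : ℝ} (ζ : ℕ → Z) (i : Fin d) (t : ℕ)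
    (hnoise : ∀ n < t, |g (state (params β₁ β₂ C₀ ε₀) g x₁ ζ n).x (ζ (n + 1)) i
        - gradient f (state (params β₁ β₂ C₀ ε₀) g x₁ ζ n).x i| ≤
      noiseLevel (σ₀ i) (σ₁ i) (gradient f (state (params β₁ β₂ C₀ ε₀) g x₁ ζ n).x i))
    (hprev : ∀ n < t, ‖gradient f (state (params β₁ β₂ C₀ ε₀) g x₁ ζ n).x‖ ^ 2 ≤ G)
    (hexp : ∑ n ∈ Finset.range t,
      (exponent β₁ C₀ (‖σ₀‖ + ‖σ₁‖ * √G)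
          * martingaleCoeff (params β₁ β₂ C₀ ε₀) f σ₀ σ₁ g x₁ G i n ζ
          * (g (state (params β₁ β₂ C₀ ε₀) g x₁ ζ n).x (ζ (n + 1)) i
            - gradient f (state (params β₁ β₂ C₀ ε₀) g x₁ ζ n).x i)
        - (exponent β₁ C₀ (‖σ₀‖ + ‖σ₁‖ * √G)
          * martingaleCoeff (params β₁ β₂ C₀ ε₀) f σ₀ σ₁ g x₁ G i n ζ) ^ 2
          * noiseLevel (σ₀ i) (σ₁ i)
            (gradient f (state (params β₁ β₂ C₀ ε₀) g x₁ ζ n).x i) ^ 2 / 2) ≤ ℓ) :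
    ∑ n ∈ Finset.range t, -(stepSize (params β₁ β₂ C₀ ε₀) (n + 1)
          * gradient f (state (params β₁ β₂ C₀ ε₀) g x₁ ζ n).x i
          / proxy (params β₁ β₂ C₀ ε₀) f σ₀ σ₁ g x₁ ζ (n + 1) i
          * (g (state (params β₁ β₂ C₀ ε₀) g x₁ ζ n).x (ζ (n + 1)) i
            - gradient f (state (params β₁ β₂ C₀ ε₀) g x₁ ζ n).x i)) ≤
        1 / 12 * ∑ n ∈ Finset.range t, stepSize (params β₁ β₂ C₀ ε₀) (n + 1)
          * (gradient f (state (params β₁ β₂ C₀ ε₀) g x₁ ζ n).x i ^ 2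
          / proxy (params β₁ β₂ C₀ ε₀) f σ₀ σ₁ g x₁ ζ (n + 1) i)
        + 6 * C₀ / (1 - β₁) * (‖σ₀‖ + ‖σ₁‖ * √G) * ℓ := by
  set p := params β₁ β₂ C₀ ε₀ with hp
  set S := ‖σ₀‖ + ‖σ₁‖ * √G with hS
  have hD : 0 < 1 - β₁ := sub_pos.2 H.lt_one₁
  have hC := H.pos_C
  have hS0 : 0 ≤ S := by positivity
  let h : ℕ → ℝ := fun n => gradient f (state p g x₁ ζ n).x i
  let a : ℕ → ℝ := fun n => proxy p f σ₀ σ₁ g x₁ ζ (n + 1) i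
  let w : ℕ → ℝ := fun n => stepSize p (n + 1)
  let ξ : ℕ → ℝ := fun n => g (state p g x₁ ζ n).x (ζ (n + 1)) i - h n
  let N : ℕ → ℝ := fun n => noiseLevel (σ₀ i) (σ₁ i) (h n)
  have ha : ∀ n, 0 < a n := fun n => add_pos_of_nonneg_of_pos (Real.sqrt_nonneg _)
    (eps_succ_pos H.pos₂.le H.lt_one H.pos_ε n)
  have hw : ∀ n, 0 ≤ w n := fun n => stepSize_nonneg H.nonneg₁ H.lt_one₁ hC.le _
  have hN0 : ∀ n, 0 ≤ N n := fun n => noiseLevel_nonneg _ _ _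
  have hNS : ∀ n < t, N n ≤ S := fun n hn => noiseLevel_le (hσ₀ i) (hσ₁ i)
    ((le_abs_self _).trans (norm_le_pi_norm σ₀ i)) ((le_abs_self _).trans (norm_le_pi_norm σ₁ i))
    ((sq_apply_le_sq_norm _ i).trans (hprev n hn))
  have hterm : ∀ n, 0 ≤ w n * (h n ^ 2 / a n) := fun n =>
    mul_nonneg (hw n) (div_nonneg (sq_nonneg _) (ha n).le)
  change ∑ n ∈ Finset.range t, -(w n * h n / a n * ξ n) ≤
    1 / 12 * ∑ n ∈ Finset.range t, w n * (h n ^ 2 / a n) + 6 * C₀ / (1 - β₁) * S * ℓ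
  rcases hS0.eq_or_lt with hz | hpos
  -- For S = 0 the exponent is zero by convention and the test is void, but the noise itself
  -- vanishes.
  · have hξ : ∀ n < t, ξ n = 0 := fun n hn => by
      have h1 : |ξ n| ≤ N n := hnoise n hn
      have h2 := hNS n hn
      rw [← hz] at h2
      exact abs_eq_zero.1 (le_antisymm (h1.trans h2) (abs_nonneg _))
    rw [← hz, Finset.sum_eq_zero fun n hn => by rw [hξ n (Finset.mem_range.1 hn)]; ring]
    have := Finset.sum_nonneg fun n (_ : n ∈ Finset.range t) => hterm n
    linarith
  · set lam := exponent β₁ C₀ S with hlam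
    have hlam0 : 0 < lam := by rw [hlam, exponent]; positivity
    -- From w ≤ C₀√(1-β₂)/(1-β₁) and √(1-β₂)·N ≤ a, one factor wN/a is bounded, so the variance is a
    -- multiple of the descent term.
    have hvar : ∀ n < t, (w n * h n / a n) ^ 2 * N n ^ 2 ≤
        (w n * (h n ^ 2 / a n)) * (C₀ / (1 - β₁) * S) := fun n hn => by
      have hwN : w n * N n / a n ≤ C₀ / (1 - β₁) := by
        have h1 : w n ≤ C₀ * √(1 - β₂) / (1 - β₁) :=
          stepSize_succ_le H.nonneg₁ H.lt_one₁ H.pos₂.le hC.le n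
        have h2 : √(1 - β₂) * N n ≤ a n :=
          noise_le_proxyDenom H n (v := fun n => (state p g x₁ ζ n).v i) (h := h)
          ((moments_state β₁ β₂ C₀ ε₀ i).v_nonneg H.pos₂.le H.lt_one n)
        rw [div_le_iff₀ (ha n)]
        calc _ ≤ C₀ * √(1 - β₂) / (1 - β₁) * N n := mul_le_mul_of_nonneg_right h1 (hN0 n)
          _ = C₀ / (1 - β₁) * (√(1 - β₂) * N n) := by ring
          _ ≤ _ := by gcongr
      calc _ = (w n * (h n ^ 2 / a n)) * ((w n * N n / a n) * N n) := by ring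
        _ ≤ _ := by
          refine mul_le_mul_of_nonneg_left ?_ (hterm n)
          exact mul_le_mul hwN (hNS n hn) (hN0 n) (by positivity)
    have hstep : ∀ n ∈ Finset.range t,
        lam * -(w n * h n / a n * ξ n)
          - lam ^ 2 / 2 * ((w n * (h n ^ 2 / a n)) * (C₀ / (1 - β₁) * S)) ≤
        lam * martingaleCoeff p f σ₀ σ₁ g x₁ G i n ζ * ξ n
          - (lam * martingaleCoeff p f σ₀ σ₁ g x₁ G i n ζ) ^ 2 * N n ^ 2 / 2 := fun n hn => by
      have hn := Finset.mem_range.1 hn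
      have e : martingaleCoeff p f σ₀ σ₁ g x₁ G i n ζ = -(w n * h n / a n) :=
        if_pos (hprev n hn)
      rw [e]
      have := mul_le_mul_of_nonneg_left (hvar n hn) (show 0 ≤ lam ^ 2 / 2 by positivity)
      nlinarith
    have hsum := (Finset.sum_le_sum hstep).trans hexp
    rw [Finset.sum_sub_distrib, ← Finset.mul_sum, ← Finset.mul_sum, ← Finset.sum_mul] at hsum
    -- `exponent` is tuned so that the compensator λ²/2 becomes λ/12 of the descent term.
    have e1 : lam * (C₀ / (1 - β₁) * S) = 1 / 6 := by
      rw [hlam, exponent]; field_simp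
    have e2 : lam * (6 * C₀ / (1 - β₁) * S * ℓ) = ℓ := by
      rw [hlam, exponent]; field_simp
    refine le_of_mul_le_mul_left ?_ hlam0
    rw [mul_add, e2]
    have e3 : ∀ X : ℝ, lam ^ 2 / 2 * (X * (C₀ / (1 - β₁) * S)) = lam * (1 / 12 * X) := fun X => by
      calc _ = lam / 2 * X * (lam * (C₀ / (1 - β₁) * S)) := by ring
        _ = _ := by rw [e1]; ring
    rw [e3] at hsum
    linarith

lemma sum_Icc_one_eq_sum_range (F : ℕ → ℝ) (t : ℕ) :
    ∑ s ∈ Finset.Icc 1 t, F s = ∑ n ∈ Finset.range t, F (n + 1) := by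
  induction t with
  | zero => simp
  | succ t ih => rw [Finset.sum_Icc_succ_top (by omega), ih, Finset.sum_range_succ]

end

section

variable {d : ℕ} {Z Ω : Type*} [MeasurableSpace Z] [MeasurableSpace Ω]
  {f : EuclideanSpace ℝ (Fin d) → ℝ} {L fstar : ℝ}
  {P : Measure Z} [IsProbabilityMeasure P]
  {g : EuclideanSpace ℝ (Fin d) → Z → EuclideanSpace ℝ (Fin d)}
  {σ₀ σ₁ : Fin d → ℝ}
  {μ : Measure Ω} [IsProbabilityMeasure μ] {z : ℕ → Ω → Z}
  {x₁ : EuclideanSpace ℝ (Fin d)} {β₁ β₂ C₀ ε₀ δ : ℝ}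

theorem high_probability_bound (hL : 0 ≤ L) (hf : LSmooth f L) (hbelow : ∀ x, fstar ≤ f x)
    (hg : Measurable (Function.uncurry g))
    (hunbiased : ∀ x, Integrable (g x) P ∧ ∫ ζ, g x ζ ∂P = gradient f x)
    (hσ₀ : ∀ i, 0 ≤ σ₀ i) (hσ₁ : ∀ i, 0 ≤ σ₁ i)
    (hnoise : ∀ x i, ∀ᵐ ζ ∂P,
      (g x ζ i - gradient f x i) ^ 2 ≤ σ₀ i ^ 2 + σ₁ i ^ 2 * gradient f x i ^ 2)
    (hz : ∀ s, Measurable (z s)) (hlaw : ∀ s, μ.map (z s) = P) (hindep : iIndepFun z μ)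
    (H : Admissible β₁ β₂ C₀ ε₀) (hδ : 0 < δ) (hδ' : δ < 1) {T : ℕ} (hT : 1 ≤ T) :
    let p := params β₁ β₂ C₀ ε₀
    let G := boundG f fstar L σ₀ σ₁ x₁ β₁ β₂ C₀ ε₀ δ T
    let x := fun ω => iterate p g x₁ (fun s => z s ω)
    let a := fun ω => proxy p f σ₀ σ₁ g x₁ (fun s => z s ω)
    1 - δ ≤ μ.real {ω |
      (∀ t ∈ Finset.Icc 1 T,
        ‖gradient f (x ω (t + 1))‖ ^ 2 ≤
          G - L * ∑ s ∈ Finset.Icc 1 t, ∑ i,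
            stepSize p s * (gradient f (x ω s) i ^ 2 / a ω s i)) ∧
      (∀ t ∈ Finset.Icc 1 (T + 1), ‖gradient f (x ω t)‖ ^ 2 ≤ G)} := by
  intro p G x a
  set good := {ω |
      (∀ t ∈ Finset.Icc 1 T,
        ‖gradient f (x ω (t + 1))‖ ^ 2 ≤
          G - L * ∑ s ∈ Finset.Icc 1 t, ∑ i,
            stepSize p s * (gradient f (x ω s) i ^ 2 / a ω s i)) ∧
      (∀ t ∈ Finset.Icc 1 (T + 1), ‖gradient f (x ω t)‖ ^ 2 ≤ G)} with hgood
  let X : ℕ → Ω → EuclideanSpace ℝ (Fin d) := fun n ω => (state p g x₁ (fun s => z s ω) n).x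
  let τ : Fin d → ℕ → Ω → ℝ := fun i n ω => exponent β₁ C₀ (‖σ₀‖ + ‖σ₁‖ * √G)
    * martingaleCoeff p f σ₀ σ₁ g x₁ G i n (fun s => z s ω)
  have hX : ∀ n, Measurable[history z n] (X n) := fun n =>
    (@measurable_state d Z _ g x₁ Ω (history z n) hg p z n
      fun s hs => measurable_history hs).1
  have hτ : ∀ i n, Measurable[history z n] (τ i n) := fun i n =>
    Measurable.const_mul (@measurable_martingaleCoeff d Z _ f L g x₁ Ω (history z n) hf hg p σ₀ σ₁
      G i z n fun s hs => measurable_history hs) _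
  -- The threshold is log c with c = dT/δ, so each of the dT events has probability at most δ/(dT).
  let bad : ℕ → Fin d → Set Ω := fun t i => {ω | Real.log (d * T / δ) ≤ ∑ n ∈ Finset.range t,
      (τ i n ω * (g (X n ω) (z (n + 1) ω) i - gradient f (X n ω) i)
        - τ i n ω ^ 2 * noiseLevel (σ₀ i) (σ₁ i) (gradient f (X n ω) i) ^ 2 / 2)}
  have hbad : ∀ t i, μ (bad t i) ≤ ENNReal.ofReal (d * T / δ)⁻¹ := fun t i => by
    have hd : (0 : ℝ) < d := by exact_mod_cast i.pos
    have hT0 : (0 : ℝ) < T := by exact_mod_cast hT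
    exact martingale_tail hf hg hunbiased hnoise hz hlaw hindep i hX (hτ i) t (by positivity)
  let noisy : Set Ω := {ω | ¬ ∀ n i, |g (X n ω) (z (n + 1) ω) i - gradient f (X n ω) i| ≤
      noiseLevel (σ₀ i) (σ₁ i) (gradient f (X n ω) i)}
  have hnoisy : μ noisy = 0 := by
    have : ∀ᵐ ω ∂μ, ∀ n i, |g (X n ω) (z (n + 1) ω) i - gradient f (X n ω) i| ≤
        noiseLevel (σ₀ i) (σ₁ i) (gradient f (X n ω) i) :=
      ae_all_iff.2 fun n => ae_all_iff.2 fun i => ae_noise_le hf hg hnoise hz hlaw hindep (hX n) i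
    exact this
  have hsub : goodᶜ ⊆ noisy ∪ ⋃ t ∈ Finset.Icc 1 T, ⋃ i ∈ Finset.univ, bad t i := by
    intro ω hω
    by_contra hcon
    simp only [Set.mem_union, Set.mem_iUnion, not_or, not_exists] at hcon
    obtain ⟨hc1, hc2⟩ := hcon
    have hn : ∀ n i, |g (X n ω) (z (n + 1) ω) i - gradient f (X n ω) i| ≤
      noiseLevel (σ₀ i) (σ₁ i) (gradient f (X n ω) i) := not_not.1 hc1
    refine hω ?_
    have hℓ := log_confidence_nonneg hδ hδ' hT d
    have key := gradient_bound_of_martingale_bound (g := g) (x₁ := x₁) (z := fun s => z s ω)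
      H hL hf hbelow hσ₀ hσ₁ hδ hδ' hT (fun n _ i => hn n i) (fun t ht hprev i => by
        refine martingale_le_of_exponent H hσ₀ hσ₁ _ i t (fun n _ => hn n i) hprev ?_
        -- No event is attached to t = 0, where the sum is empty and ℓ ≥ 0 suffices.
        rcases Nat.eq_zero_or_pos t with rfl | htpos
        · simpa using hℓ
        · exact (not_le.1 (hc2 t (Finset.mem_Icc.2 ⟨htpos, ht⟩) i (Finset.mem_univ i))).le)
    have hfirst : ∀ t ≤ T, ‖gradient f (x ω (t + 1))‖ ^ 2 ≤
          G - L * ∑ s ∈ Finset.Icc 1 t, ∑ i,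
            stepSize p s * (gradient f (x ω s) i ^ 2 / a ω s i) := fun t ht => by
      have := key t ht
      rw [Finset.sum_comm] at this
      rw [sum_Icc_one_eq_sum_range]
      exact this
    refine ⟨fun t ht => hfirst t (Finset.mem_Icc.1 ht).2, fun t ht => ?_⟩
    obtain ⟨ht1, ht2⟩ := Finset.mem_Icc.1 ht
    obtain ⟨t, rfl⟩ := Nat.exists_eq_add_of_le' ht1
    refine (hfirst t (by omega)).trans (sub_le_self _ (mul_nonneg hL ?_))
    refine Finset.sum_nonneg fun s _ => Finset.sum_nonneg fun i _ => ?_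
    refine mul_nonneg (stepSize_nonneg H.nonneg₁ H.lt_one₁ H.pos_C.le _)
      (div_nonneg (sq_nonneg _) ?_)
    exact add_nonneg (Real.sqrt_nonneg _) (eps_nonneg H.pos_ε.le _)
  have hcompl : μ goodᶜ ≤ ENNReal.ofReal δ := by
    calc μ goodᶜ ≤ μ noisy + ∑ t ∈ Finset.Icc 1 T, ∑ i, μ (bad t i) :=
          (measure_mono hsub).trans ((measure_union_le _ _).trans (add_le_add_right
            ((measure_biUnion_finset_le _ _).trans (Finset.sum_le_sum fun t _ =>
              measure_biUnion_finset_le _ _)) _))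
      _ ≤ 0 + ∑ _t ∈ Finset.Icc 1 T, ∑ _i : Fin d, ENNReal.ofReal (d * T / δ)⁻¹ := by
          rw [hnoisy]
          gcongr with t _ i _
          exact hbad t i
      _ = ENNReal.ofReal (T * (d * (d * T / δ)⁻¹)) := by
          rw [ENNReal.ofReal_mul (by positivity), ENNReal.ofReal_mul (by positivity)]
          simp
      _ ≤ ENNReal.ofReal δ := by
          apply ENNReal.ofReal_le_ofReal
          rcases Nat.eq_zero_or_pos d with hd | hd
          · simp [hd, hδ.le]
          · have hd : (0 : ℝ) < d := by exact_mod_cast hd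
            have hT0 : (0 : ℝ) < T := by exact_mod_cast hT
            apply le_of_eq
            field_simp
  -- Subadditivity alone, so measurability of the good event is not needed.
  have hone : (1 : ENNReal) ≤ μ good + μ goodᶜ := by
    rw [← measure_univ (μ := μ), ← Set.union_compl_self good]
    exact measure_union_le _ _
  have hreal : (1 : ℝ) ≤ μ.real good + δ := by
    have h1 : (1 : ENNReal) ≤ ENNReal.ofReal (μ.real good + δ) := by
      rw [ENNReal.ofReal_add measureReal_nonneg hδ.le, ofReal_measureReal]
      exact hone.trans (add_le_add_right hcompl _)
    rwa [ENNReal.one_le_ofReal] at h1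
  linarith

end

end Adam

namespace Adam

/-! ### Asymptotics -/

section

open Asymptotics Filter

lemma tendsto_one_sub_inv_nat : Tendsto (fun T : ℕ => 1 - 1 / (T : ℝ)) atTop (nhds 1) := by
  simpa using tendsto_const_nhds.sub tendsto_one_div_atTop_nhds_zero_nat (a := (1 : ℝ))

lemma isBigO_one_of_continuousAt {F : ℝ → ℝ} (hF : ContinuousAt F 1) :
    (fun T : ℕ => F (1 - 1 / (T : ℝ))) =O[atTop] (fun _ : ℕ => (1 : ℝ)) :=
  (hF.tendsto.comp tendsto_one_sub_inv_nat).isBigO_one ℝ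

lemma one_isBigO_log : (fun _ : ℕ => (1 : ℝ)) =O[atTop] (fun T : ℕ => Real.log (T : ℝ)) :=
  (isLittleO_const_left.2 (Or.inr (tendsto_norm_atTop_atTop.comp
    (Real.tendsto_log_atTop.comp tendsto_natCast_atTop_atTop)))).isBigO

lemma log_confidence_isBigO (d : ℕ) {δ : ℝ} (hδ : 0 < δ) :
    (fun T : ℕ => Real.log (d * T / δ)) =O[atTop] (fun T : ℕ => Real.log (T : ℝ)) := by
  rcases Nat.eq_zero_or_pos d with rfl | hd
  · simpa using isBigO_zero _ _
  · have hd : (0 : ℝ) < d := by exact_mod_cast hd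
    have h : (fun T : ℕ => Real.log (d / δ) * 1 + Real.log (T : ℝ)) =O[atTop]
        (fun T : ℕ => Real.log (T : ℝ)) :=
      (one_isBigO_log.const_mul_left _).add (isBigO_refl _ _)
    refine h.congr' ?_ EventuallyEq.rfl
    filter_upwards [eventually_ge_atTop 1] with T hT
    have hT : (0 : ℝ) < T := by exact_mod_cast hT
    rw [mul_one, ← Real.log_mul (by positivity) hT.ne']
    congr 1
    ring

variable {d : ℕ} (f : EuclideanSpace ℝ (Fin d) → ℝ) (L : ℝ) (σ₀ σ₁ : Fin d → ℝ)
  (x₁ : EuclideanSpace ℝ (Fin d)) {β₁ C₀ ε₀ δ : ℝ}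

lemma eventually_admissible (hβ₁ : 0 ≤ β₁) (hβ₁' : β₁ < 1) (hC₀ : 0 < C₀) (hε₀ : 0 < ε₀) :
    ∀ᶠ T : ℕ in atTop, Admissible β₁ (1 - 1 / (T : ℝ)) C₀ ε₀ := by
  filter_upwards [tendsto_one_sub_inv_nat.eventually (lt_mem_nhds hβ₁'),
    eventually_ge_atTop 1] with T h1 h2
  have hT : (0 : ℝ) < T := by exact_mod_cast h2
  exact ⟨hβ₁, h1, by linarith [show 0 < 1 / (T : ℝ) by positivity], hC₀, hε₀⟩

/-- Here ε² = ε₀²/T, so 𝓕(T) is at most K·T⁴, while -T·log(1-1/T) stays bounded. Eventually r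
exceeds r₀ = (1-β₁)/2. -/
lemma log_polyF_isBigO (hβ₁ : 0 ≤ β₁) (hβ₁' : β₁ < 1) (hC₀ : 0 < C₀) (hε₀ : 0 < ε₀) :
    (fun T : ℕ => Real.log (polyF f L σ₀ σ₁ x₁ β₁ (1 - 1 / (T : ℝ)) C₀ ε₀ T
      / (1 - 1 / (T : ℝ)) ^ T)) =O[atTop] (fun T : ℕ => Real.log (T : ℝ)) := by
  set A := ‖σ₀‖ ^ 2 + 2 * (1 + ‖σ₁‖ ^ 2) * ‖gradient f x₁‖ ^ 2 with hA
  set B := 2 * (1 + ‖σ₁‖ ^ 2) * d * L ^ 2 * C₀ ^ 2 with hB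
  have hA0 : 0 ≤ A := by positivity
  have hB0 : 0 ≤ B := by positivity
  have hD : 0 < 1 - β₁ := sub_pos.2 hβ₁'
  set r₀ := (1 - β₁) / 2 with hr₀
  have hr₀0 : 0 < r₀ := by positivity
  set K := 1 + 2 / ε₀ ^ 2 * (A + B / r₀) with hK
  have hK0 : 1 ≤ K := by
    rw [hK, le_add_iff_nonneg_right]; positivity
  have hr : ∀ᶠ T : ℕ in atTop, r₀ < 1 - β₁ / (1 - 1 / (T : ℝ)) := by
    have hc : ContinuousAt (fun b : ℝ => 1 - β₁ / b) 1 := by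
      fun_prop (disch := norm_num)
    have ht := hc.tendsto.comp tendsto_one_sub_inv_nat
    refine ht.eventually (lt_mem_nhds ?_)
    rw [div_one, hr₀]; linarith
  have hbig : (fun T : ℕ => (Real.log K + 2) * 1 + 4 * Real.log (T : ℝ)) =O[atTop]
      (fun T : ℕ => Real.log (T : ℝ)) :=
    (one_isBigO_log.const_mul_left _).add ((isBigO_refl _ _).const_mul_left _)
  refine (IsBigO.of_bound 1 ?_).trans hbig
  filter_upwards [eventually_admissible (C₀ := C₀) (ε₀ := ε₀) hβ₁ hβ₁' hC₀ hε₀, hr,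
    eventually_ge_atTop 2] with T H hrT hT2
  have hT2 : (2 : ℝ) ≤ T := by exact_mod_cast hT2
  have hT0 : (0 : ℝ) < T := by linarith
  have hb := H.pos₂
  have hF1 := one_le_polyF (f := f) (L := L) (σ₀ := σ₀) (σ₁ := σ₁) (x₁ := x₁) H T
  have hF : polyF f L σ₀ σ₁ x₁ β₁ (1 - 1 / (T : ℝ)) C₀ ε₀ T ≤ K * (T : ℝ) ^ 4 := by
    have e1 : (ε₀ * √(1 - (1 - 1 / (T : ℝ)))) ^ 2 = ε₀ ^ 2 / T := by
      rw [sub_sub_cancel, mul_pow, Real.sq_sqrt (by positivity)]; ring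
    rw [polyF, e1, ← hA, ← hB]
    have i1 : (1 : ℝ) ≤ (T : ℝ) ^ 4 := one_le_pow₀ (by linarith)
    have i2 : (T : ℝ) * T ≤ (T : ℝ) ^ 4 := by
      rw [← pow_two]; exact pow_le_pow_right₀ (by linarith) (by norm_num)
    calc 1 + 2 / (ε₀ ^ 2 / (T : ℝ)) * (A * T + B / (1 - β₁ / (1 - 1 / (T : ℝ))) * (T : ℝ) ^ 3)
        ≤ 1 + 2 / (ε₀ ^ 2 / (T : ℝ)) * (A * T + B / r₀ * (T : ℝ) ^ 3) := by gcongr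
      _ = 1 + 2 / ε₀ ^ 2 * (A * (T * T) + B / r₀ * (T : ℝ) ^ 4) := by field_simp
      _ ≤ (T : ℝ) ^ 4 + 2 / ε₀ ^ 2 * (A * (T : ℝ) ^ 4 + B / r₀ * (T : ℝ) ^ 4) := by gcongr
      _ = _ := by rw [hK]; ring
  have h0 := log_polyF_nonneg (f := f) (L := L) (σ₀ := σ₀) (σ₁ := σ₁) (x₁ := x₁) H T
  have hup : Real.log (polyF f L σ₀ σ₁ x₁ β₁ (1 - 1 / (T : ℝ)) C₀ ε₀ T
      / (1 - 1 / (T : ℝ)) ^ T) ≤ (Real.log K + 2) * 1 + 4 * Real.log (T : ℝ) := by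
    rw [Real.log_div (by positivity) (by positivity), Real.log_pow]
    have j1 := Real.log_le_log (by positivity) hF
    rw [Real.log_mul (by positivity) (by positivity), Real.log_pow] at j1
    have j2 := Real.one_sub_inv_le_log_of_pos hb
    have j3 := mul_le_mul_of_nonneg_left j2 hT0.le
    -- The quantity equals -T/(T-1), which is at least -2 once T ≥ 2.
    have j4 : -2 ≤ (T : ℝ) * (1 - (1 - 1 / (T : ℝ))⁻¹) := by
      have : (T : ℝ) - 1 ≠ 0 := by linarith
      have e : (T : ℝ) * (1 - (1 - 1 / (T : ℝ))⁻¹) = -(T / (T - 1)) := by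
        field_simp
        ring
      rw [e, neg_le_neg_iff, div_le_iff₀ (by linarith)]
      linarith
    push_cast at j1
    linarith
  rw [one_mul, Real.norm_of_nonneg h0, Real.norm_of_nonneg (h0.trans hup)]
  exact hup

/-- Every summand of `G` is a coefficient continuous in β₂ at 1, hence bounded along 1 - 1/T, times
at most two logarithmic factors. -/
theorem boundG_isBigO (fstar : ℝ) (hβ₁ : 0 ≤ β₁) (hβ₁' : β₁ < 1) (hC₀ : 0 < C₀) (hε₀ : 0 < ε₀)
    (hδ : 0 < δ) :
    (fun T : ℕ => boundG f fstar L σ₀ σ₁ x₁ β₁ (1 - 1 / (T : ℝ)) C₀ ε₀ δ T)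
      =O[atTop] (fun T : ℕ => Real.log (T : ℝ) ^ 2) := by
  have hD : 1 - β₁ ≠ 0 := (sub_pos.2 hβ₁').ne'
  have hD' : 1 - β₁ / 1 ≠ 0 := by rwa [div_one]
  have hℓ := log_confidence_isBigO d hδ
  have hΛ := log_polyF_isBigO f L σ₀ σ₁ x₁ (C₀ := C₀) (ε₀ := ε₀) hβ₁ hβ₁' hC₀ hε₀
  have h1 := one_isBigO_log
  have bounded : ∀ {F : ℝ → ℝ}, ContinuousAt F 1 →
      (fun T : ℕ => F (1 - 1 / (T : ℝ))) =O[atTop] (fun T : ℕ => Real.log (T : ℝ) ^ 2) :=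
    fun hF => (isBigO_one_of_continuousAt hF).trans (by simpa using h1.pow 2)
  have bounded_mul : ∀ {F : ℝ → ℝ} {u : ℕ → ℝ}, ContinuousAt F 1 →
      u =O[atTop] (fun T : ℕ => Real.log (T : ℝ)) →
      (fun T : ℕ => F (1 - 1 / (T : ℝ)) * u T) =O[atTop]
        (fun T : ℕ => Real.log (T : ℝ) ^ 2) := fun hF hu => by
    simpa [pow_two] using ((isBigO_one_of_continuousAt hF).trans h1).mul hu
  have bounded_mul_sq : ∀ {F : ℝ → ℝ} {u : ℕ → ℝ}, ContinuousAt F 1 →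
      u =O[atTop] (fun T : ℕ => Real.log (T : ℝ)) →
      (fun T : ℕ => F (1 - 1 / (T : ℝ)) * u T ^ 2) =O[atTop]
        (fun T : ℕ => Real.log (T : ℝ) ^ 2) := fun hF hu => by
    simpa using (isBigO_one_of_continuousAt hF).mul (hu.pow 2)
  have hsig : ContinuousAt sigmaMax 1 := by
    have : ContinuousAt (fun b : ℝ => √((1 + b) / b) - 1) 1 := by
      fun_prop (disch := norm_num)
    exact continuousAt_const.max this
  unfold boundG
  refine (((((((IsBigO.add ?_ ?_).add ?_).add ?_).add ?_).add ?_).add ?_).add ?_)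
  · exact bounded (F := fun _ => _) continuousAt_const
  · refine bounded (F := fun b => 256 * L ^ 2 * C₀ ^ 2 * β₁ ^ 2 * d ^ 2 /
      ((1 - β₁) ^ 3 * (1 - β₁ / b))) ?_
    fun_prop (disch := simp [hD])
  · refine bounded (F := fun b => 4 * L ^ 2 * C₀ ^ 2 * β₁ ^ 2 * d /
      ((1 - β₁) ^ 2 * (1 - β₁ / b))) ?_
    fun_prop (disch := simp [hD])
  · exact bounded_mul (F := fun _ => _) continuousAt_const hℓ
  · refine bounded_mul (F := fun b => 8 * L * C₀ * β₁ ^ 2 / ((1 - β₁) ^ 2 * (1 - β₁ / b))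
      * (4 * ‖σ₀‖ / b + (ε₀ + √2 * ‖σ₀‖) / √b + L * C₀ / 2 * (1 + 4 * sigmaMax b ^ 2))
      * d) ?_ hΛ
    fun_prop (disch := simp [hD])
  · exact bounded_mul (F := fun _ => _) continuousAt_const hΛ
  · exact bounded_mul_sq (F := fun _ => _) continuousAt_const hℓ
  · refine bounded_mul_sq (F := fun b => 256 * (16 * L ^ 2 * C₀ ^ 2 * ‖σ₁‖ ^ 2 / (1 - β₁) ^ 2
      + 9 * L ^ 2 * C₀ ^ 2 * β₁ ^ 4 * (1 + ‖σ₁‖ ^ 2)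
        / (b ^ 2 * (1 - β₁) ^ 4 * (1 - β₁ / b) ^ 2)) * d ^ 2) ?_ hΛ
    fun_prop (disch := simp [hD])

end

end Adam
theorem mainTheorem2 {d : ℕ} {Z Ω : Type*} [MeasurableSpace Z] [MeasurableSpace Ω]
    -- the objective: `L`-smooth and bounded below
    (f : EuclideanSpace ℝ (Fin d) → ℝ) (L fstar : ℝ) (hL : 0 ≤ L) (hf : Adam.LSmooth f L)
    (hbelow : ∀ x, fstar ≤ f x)
    -- the stochastic gradient oracle: unbiased, with coordinate-wise affine noise
    (P : Measure Z) [IsProbabilityMeasure P]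
    (g : EuclideanSpace ℝ (Fin d) → Z → EuclideanSpace ℝ (Fin d))
    (hg : Measurable (Function.uncurry g))
    (hunbiased : ∀ x, Integrable (g x) P ∧ ∫ ζ, g x ζ ∂P = gradient f x)
    (σ₀ σ₁ : Fin d → ℝ) (hσ₀ : ∀ i, 0 ≤ σ₀ i) (hσ₁ : ∀ i, 0 ≤ σ₁ i)
    (hnoise : ∀ x i, ∀ᵐ ζ ∂P,
      (g x ζ i - gradient f x i) ^ 2 ≤ σ₀ i ^ 2 + σ₁ i ^ 2 * gradient f x i ^ 2)
    -- the independent samples used by the oracle in the successive iterations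
    (μ : Measure Ω) [IsProbabilityMeasure μ] (z : ℕ → Ω → Z)
    (hz : ∀ s, Measurable (z s)) (hlaw : ∀ s, μ.map (z s) = P) (hindep : iIndepFun z μ)
    -- the initial point, the hyper-parameters and the failure probability
    (x₁ : EuclideanSpace ℝ (Fin d)) (β₁ C₀ ε₀ δ : ℝ)
    (hβ₁ : 0 ≤ β₁) (hβ₁' : β₁ < 1) (hC₀ : 0 < C₀) (hε₀ : 0 < ε₀) (hδ : 0 < δ) (hδ' : δ < 1) :
    (∀ (T : ℕ) (β₂ : ℝ), 1 ≤ T → β₁ < β₂ → β₂ < 1 →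
      let p := Adam.params β₁ β₂ C₀ ε₀
      let G := Adam.boundG f fstar L σ₀ σ₁ x₁ β₁ β₂ C₀ ε₀ δ T
      let x := fun ω => Adam.iterate p g x₁ (fun s => z s ω)
      let a := fun ω => Adam.proxy p f σ₀ σ₁ g x₁ (fun s => z s ω)
      1 - δ ≤ μ.real {ω |
        (∀ t ∈ Finset.Icc 1 T,
          ‖gradient f (x ω (t + 1))‖ ^ 2 ≤
            G - L * ∑ s ∈ Finset.Icc 1 t, ∑ i,
              Adam.stepSize p s * (gradient f (x ω s) i ^ 2 / a ω s i)) ∧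
        (∀ t ∈ Finset.Icc 1 (T + 1), ‖gradient f (x ω t)‖ ^ 2 ≤ G)}) ∧
    (fun T : ℕ => Adam.boundG f fstar L σ₀ σ₁ x₁ β₁ (1 - 1 / (T : ℝ)) C₀ ε₀ δ T)
      =O[Filter.atTop] (fun T : ℕ => Real.log (T : ℝ) ^ 2) := by
  refine ⟨fun T β₂ hT h₁₂ h₂ => ?_,
    Adam.boundG_isBigO f L σ₀ σ₁ x₁ fstar hβ₁ hβ₁' hC₀ hε₀ hδ⟩
  exact Adam.high_probability_bound hL hf hbelow hg hunbiased hσ₀ hσ₁ hnoise hz hlaw hindep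
    ⟨hβ₁, h₁₂, h₂, hC₀, hε₀⟩ hδ hδ' hT
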